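/- Let $k$ be a field and let $\Lambda$ and $\Gamma$ be finite dimensional $k$-algebras that are self-injective (each is injective as a left module over itself). Let $X$ be a $\Gamma$-$\Lambda$-bimodule and $Y$ a $\Lambda$-$\Gamma$-bimodule, both finite dimensional over $k$ and with $k$ acting centrally, that induce a stable equivalence of Morita type between $\Lambda$ and $\Gamma$; that is, $X$ and $Y$ are projective both as left and as right modules, and $$Y\otimes_\Gamma X\cong\Lambda\oplus P\ \text{ as $\Lambda$-$\Lambda$-bimodules},\qquad X\otimes_\Lambda Y\cong\Gamma\oplus Q\ \text{ as $\Gamma$-$\Gamma$-bimodules}$$ for some projective $\Lambda$-$\Lambda$-bimodule $P$ (i.e. projective over $\Lambda\otimes_k\Lambda^{\mathrm{op}}$) and some projective $\Gamma$-$\Gamma$-bimodule $Q$. Let $\hat{\mathcal C}$ be the category of complete local commutative Noetherian $k$-algebras with residue field $k$, with continuous $k$-algebra homomorphisms inducing the identity on $k$ as morphisms. For a finitely generated left $\Lambda$-module $V$ and $R\in\hat{\mathcal C}$, a lift of $V$ over $R$ is a pair $(L,\lambda)$ of a finitely generated $R\otimes_k\Lambda$-module $L$ that is free over $R$ and an isomorphism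 $\lambda:k\otimes_R L\to V$ of $\Lambda$-modules; two lifts $(L,\lambda)$, $(L',\lambda')$ are isomorphic if there is an isomorphism $f:L\to L'$ of $R\otimes_k\Lambda$-modules with $\lambda'\circ(k\otimes_R f)=\lambda$. The deformation functor $\hat F_V:\hat{\mathcal C}\to\mathrm{Sets}$ sends $R$ to the set of isomorphism classes $[L,\lambda]$ of lifts of $V$ over $R$, and $\alpha:R\to R'$ to the map $[L,\lambda]\mapsto[R'\otimes_{R,\alpha}L,\lambda_\alpha]$, where $\lambda_\alpha$ is the composition $k\otimes_{R'}(R'\otimes_{R,\alpha}L)\cong k\otimes_R L\xrightarrow{\lambda}V$. A versal deformation ring of $V$ is an object $R$ of $\hat{\mathcal C}$ for which there is $\xi\in\hat F_V(R)$ such that $(R,\xi)$ is a pro-representable hull: for every surjection $B\to A$ between Artinian objects of $\hat{\mathcal C}$ the map $\mathrm{Hom}_{\hat{\mathcal C}}(R,B)\to\mathrm{Hom}_{\hat{\mathcal C}}(R,A)\times_{\hat F_V(A)}\hat F_V(B)$ given by $\xi$ is surjective, and $\mathrm{Hom}_{\hat{\mathcal C}}(R,k[\varepsilon])\to\hat F_V(k[\varepsilon])$,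 $\alpha\mapsto\hat F_V(\alpha)(\xi)$, is bijective, where $\varepsilon^2=0$. It is a universal deformation ring of $V$ if it represents $\hat F_V$. The same notions are used for $\Gamma$-modules. Let $V$ be a finitely generated left $\Lambda$-module, and let $V'=X\otimes_\Lambda V$. Then the functors $\hat F_V$ and $\hat F_{V'}$ are naturally isomorphic. In particular, the versal deformation rings $R(\Lambda,V)$ of $V$ and $R(\Gamma,V')$ of $V'$, which exist, are isomorphic in $\hat{\mathcal C}$ (for any choice of them), and $R(\Lambda,V)$ is a universal deformation ring of $V$ if and only if $R(\Gamma,V')$ is a universal deformation ring of $V'$. -/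

import Mathlib

open CategoryTheory TensorProduct MulOpposite

universe u w

noncomputable section

set_option linter.style.haveILetI false

/-! ### The category of complete local commutative Noetherian `k`-algebras with residue field `k` -/

/-- Complete local commutative Noetherian `k`-algebras with residue field `k`. -/
structure CompleteLocalAlg (k : Type u) [Field k] : Type (u + 1) where
  carrier : Type u
  [commRing : CommRing carrier]
  [algebra : Algebra k carrier]
  [isLocalRing : IsLocalRing carrier]
  [isNoetherianRing : IsNoetherianRing carrier]
  [isAdicComplete : IsAdicComplete (IsLocalRing.maximalIdeal carrier) carrier]
  residue_bijective : Function.Bijective (algebraMap k (IsLocalRing.ResidueField carrier))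

namespace CompleteLocalAlg

variable {k : Type u} [Field k]

instance : CoeSort (CompleteLocalAlg k) (Type u) := ⟨carrier⟩

attribute [instance] commRing algebra isLocalRing isNoetherianRing isAdicComplete

/-- Morphisms: local `k`-algebra homomorphisms. For the adic topologies a ring homomorphism
of local rings is continuous if and only if it is local, and a local `k`-algebra homomorphism
induces the identity on the residue field `k`. -/
@[ext]
structure Hom (R S : CompleteLocalAlg k) where
  toAlgHom : R →ₐ[k] S
  isLocalHom : IsLocalHom toAlgHom.toRingHom

instance : Category (CompleteLocalAlg k) where
  Hom R S := Hom R S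
  id R := ⟨AlgHom.id k R, ⟨fun _ h => h⟩⟩
  comp f g := ⟨g.toAlgHom.comp f.toAlgHom,
    ⟨fun a h => f.isLocalHom.map_nonunit a (g.isLocalHom.map_nonunit _ h)⟩⟩

/-- The underlying ring homomorphism of a morphism. -/
def Hom.ringHom {R S : CompleteLocalAlg k} (f : R ⟶ S) : R →+* S :=
  (Hom.toAlgHom f).toRingHom

theorem Hom.ringHom_id (R : CompleteLocalAlg k) : Hom.ringHom (𝟙 R) = RingHom.id R := rfl

theorem Hom.ringHom_comp {R S T : CompleteLocalAlg k} (f : R ⟶ S) (g : S ⟶ T) :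
    (Hom.ringHom g).comp (Hom.ringHom f) = Hom.ringHom (f ≫ g) := rfl

/-- The residue map `π_R : R → k`. -/
def residue (R : CompleteLocalAlg k) : R →+* k :=
  (RingEquiv.ofBijective _ R.residue_bijective).symm.toRingHom.comp (IsLocalRing.residue R)

theorem residue_algebraMap (R : CompleteLocalAlg k) (c : k) :
    R.residue (algebraMap k R c) = c := by
  change (RingEquiv.ofBijective _ R.residue_bijective).symm
    (IsLocalRing.residue R (algebraMap k R c)) = c
  rw [RingEquiv.symm_apply_eq]
  rfl

theorem residue_eq_zero_iff (R : CompleteLocalAlg k) (r : R) :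
    R.residue r = 0 ↔ r ∈ IsLocalRing.maximalIdeal R := by
  change (RingEquiv.ofBijective _ R.residue_bijective).symm (IsLocalRing.residue R r) = 0 ↔ _
  rw [EmbeddingLike.map_eq_zero_iff, IsLocalRing.residue_eq_zero_iff]

theorem residue_comp {R S : CompleteLocalAlg k} (f : R ⟶ S) :
    S.residue.comp (Hom.ringHom f) = R.residue := by
  ext r
  have h1 : r - algebraMap k R (R.residue r) ∈ IsLocalRing.maximalIdeal R := by
    rw [← residue_eq_zero_iff, map_sub, residue_algebraMap, sub_self]
  have h2 : Hom.ringHom f (r - algebraMap k R (R.residue r)) ∈ IsLocalRing.maximalIdeal S := by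
    rw [IsLocalRing.mem_maximalIdeal, mem_nonunits_iff] at h1 ⊢
    exact fun h => h1 (f.isLocalHom.map_nonunit _ h)
  rw [← residue_eq_zero_iff, map_sub, map_sub, sub_eq_zero] at h2
  change S.residue (Hom.ringHom f r) = _
  rw [h2]
  change S.residue (f.toAlgHom (algebraMap k R (R.residue r))) = _
  rw [AlgHom.commutes, residue_algebraMap]

theorem dualNumber_maximalIdeal_sq :
    IsLocalRing.maximalIdeal (DualNumber k) ^ 2 = ⊥ := by
  rw [DualNumber.maximalIdeal_eq_span_singleton_eps, Ideal.span_singleton_pow, pow_two,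
    DualNumber.eps_mul_eps, Ideal.span_singleton_eq_bot]

instance : IsAdicComplete (IsLocalRing.maximalIdeal (DualNumber k)) (DualNumber k) where
  haus' x hx := by
    have h := hx 2
    rw [dualNumber_maximalIdeal_sq, Submodule.bot_smul] at h
    exact SModEq.bot.1 h
  prec' f hf := by
    refine ⟨f 2, fun n => ?_⟩
    rcases le_total n 2 with hn | hn
    · exact hf hn
    · have h := hf hn
      rw [dualNumber_maximalIdeal_sq, Submodule.bot_smul, SModEq.bot] at h
      exact h ▸ SModEq.rfl

/-- The ring of dual numbers `k[ε]`. -/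
def dualNumber (k : Type u) [Field k] : CompleteLocalAlg k where
  carrier := DualNumber k
  residue_bijective := by
    refine ⟨(algebraMap k _).injective, fun y => ?_⟩
    obtain ⟨x, rfl⟩ := IsLocalRing.residue_surjective y
    refine ⟨x.fst, ?_⟩
    change IsLocalRing.residue (DualNumber k) (algebraMap k (DualNumber k) x.fst) = _
    rw [← sub_eq_zero, ← map_sub, IsLocalRing.residue_eq_zero_iff,
      DualNumber.maximalIdeal_eq_span_singleton_eps, Ideal.mem_span_singleton,
      ← DualNumber.fst_eq_zero_iff_eps_dvd]
    simp [TrivSqZeroExt.algebraMap_eq_inl]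

end CompleteLocalAlg

/-! ### Base change -/

/-- The base change `S ⊗_{R,f} L` of an `R`-module `L` along a ring homomorphism `f : R → S`. -/
def BaseChange {R S : Type u} [CommRing R] [CommRing S] (f : R →+* S) (L : Type u)
    [AddCommGroup L] [Module R L] : Type u :=
  letI := f.toAlgebra
  S ⊗[R] L

namespace BaseChange

variable {R S T : Type u} [CommRing R] [CommRing S] [CommRing T]
variable (f : R →+* S) {L L' : Type u} [AddCommGroup L] [Module R L] [AddCommGroup L'] [Module R L']

instance : AddCommGroup (BaseChange f L) :=
  letI := f.toAlgebra
  (inferInstance : AddCommGroup (S ⊗[R] L))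

instance : Module S (BaseChange f L) :=
  letI := f.toAlgebra
  (inferInstance : Module S (S ⊗[R] L))

/-- Pure tensors. -/
def tmul (s : S) (x : L) : BaseChange f L :=
  letI := f.toAlgebra
  s ⊗ₜ[R] x

/-- The map `S ⊗_{R,f} g`. -/
def map (g : L →ₗ[R] L') : BaseChange f L →ₗ[S] BaseChange f L' :=
  letI := f.toAlgebra
  g.baseChange S

theorem map_tmul (g : L →ₗ[R] L') (s : S) (x : L) : map f g (tmul f s x) = tmul f s (g x) := rfl

variable {f} in
theorem induction_on {p : BaseChange f L → Prop} (z : BaseChange f L) (zero : p 0)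
    (tmul : ∀ s x, p (tmul f s x)) (add : ∀ y z, p y → p z → p (y + z)) : p z :=
  letI := f.toAlgebra
  TensorProduct.induction_on (R := R) (M := S) (N := L) z zero tmul add

theorem map_id (z : BaseChange f L) : map f LinearMap.id z = z := by
  induction z using induction_on with
  | zero => simp
  | tmul s x => rfl
  | add y z hy hz => rw [map_add, hy, hz]

theorem map_comp_apply {L'' : Type u} [AddCommGroup L''] [Module R L''] (g : L →ₗ[R] L')
    (h : L' →ₗ[R] L'') (z : BaseChange f L) : map f (h ∘ₗ g) z = map f h (map f g z) := by
  induction z using induction_on with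
  | zero => simp
  | tmul s x => rfl
  | add y z hy hz => rw [map_add, hy, hz, map_add, map_add]

theorem smul_tmul (t s : S) (x : L) : t • tmul f s x = tmul f (t * s) x := rfl

theorem tmul_zero (s : S) : tmul f s (0 : L) = 0 := by
  letI := f.toAlgebra
  exact TensorProduct.tmul_zero _ s

theorem tmul_add (s : S) (x y : L) : tmul f s (x + y) = tmul f s x + tmul f s y := by
  letI := f.toAlgebra
  exact TensorProduct.tmul_add s x y

theorem tmul_smul (r : R) (s : S) (x : L) : tmul f s (r • x) = tmul f (f r * s) x := by
  letI := f.toAlgebra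
  exact (TensorProduct.tmul_smul r s x).trans rfl

instance [Module.Finite R L] : Module.Finite S (BaseChange f L) :=
  letI := f.toAlgebra
  (inferInstance : Module.Finite S (S ⊗[R] L))

instance [Module.Free R L] : Module.Free S (BaseChange f L) :=
  letI := f.toAlgebra
  (inferInstance : Module.Free S (S ⊗[R] L))

/-- An isomorphism of `R`-modules induces an isomorphism of base changes. -/
def congr (e : L ≃ₗ[R] L') : BaseChange f L ≃ₗ[S] BaseChange f L' :=
  letI := f.toAlgebra
  e.baseChange R S L L'

theorem congr_apply (e : L ≃ₗ[R] L') (z : BaseChange f L) :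
    congr f e z = map f e.toLinearMap z := rfl

/-- `R ⊗_{R,id} L ≅ L`. -/
def lid (e : R →+* R) (he : e = RingHom.id R) : BaseChange e L ≃ₗ[R] L := by
  subst he
  exact TensorProduct.lid R L

theorem lid_tmul (e : R →+* R) (he : e = RingHom.id R) (r : R) (x : L) :
    lid e he (tmul e r x) = r • x := by
  subst he
  rfl

/-- Transitivity: `T ⊗_{S,g} (S ⊗_{R,f} L) ≅ T ⊗_{R,h} L` if `h = g ∘ f`. -/
def cancel (f : R →+* S) (g : S →+* T) (h : R →+* T) (e : g.comp f = h) (L : Type u)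
    [AddCommGroup L] [Module R L] : BaseChange g (BaseChange f L) ≃ₗ[T] BaseChange h L :=
  letI := f.toAlgebra
  letI := g.toAlgebra
  letI := h.toAlgebra
  haveI : IsScalarTower R S T := IsScalarTower.of_algebraMap_eq' e.symm
  AlgebraTensorModule.cancelBaseChange R S T T L

theorem cancel_tmul (f : R →+* S) (g : S →+* T) (h : R →+* T) (e : g.comp f = h)
    (t : T) (s : S) (x : L) :
    cancel f g h e L (tmul g t (tmul f s x)) = tmul h (g s * t) x := by
  letI := f.toAlgebra
  letI := g.toAlgebra
  letI := h.toAlgebra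
  haveI : IsScalarTower R S T := IsScalarTower.of_algebraMap_eq' e.symm
  exact AlgebraTensorModule.cancelBaseChange_tmul R S T t x s

section Action

variable {Λ : Type u} [Ring Λ] [Module Λ L] [SMulCommClass Λ R L] [Module Λ L']
  [SMulCommClass Λ R L']

/-- If `Λ` acts `R`-linearly on `L`, then it acts on `S ⊗_{R,f} L` through the second factor. -/
def actionHom (Λ : Type u) [Ring Λ] (L : Type u) [AddCommGroup L] [Module R L] [Module Λ L]
    [SMulCommClass Λ R L] : Λ →+* Module.End S (BaseChange f L) where
  toFun a := map f (Module.toModuleEnd R L a)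
  map_one' := by
    rw [map_one]
    exact LinearMap.ext fun z => map_id f z
  map_mul' a b := by
    rw [map_mul]
    exact LinearMap.ext fun z => map_comp_apply f _ _ z
  map_zero' := by
    letI := f.toAlgebra
    rw [map_zero]
    exact LinearMap.baseChange_zero
  map_add' a b := by
    letI := f.toAlgebra
    rw [map_add]
    exact LinearMap.baseChange_add _ _

instance actionModule : Module Λ (BaseChange f L) := Module.compHom _ (actionHom f Λ L)

theorem action_def (a : Λ) (z : BaseChange f L) :
    a • z = map f (Module.toModuleEnd R L a) z := rfl

theorem action_tmul (a : Λ) (s : S) (x : L) : a • tmul f s x = tmul f s (a • x) := rfl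

instance : SMulCommClass Λ S (BaseChange f L) where
  smul_comm a s z := by rw [action_def, action_def, map_smul]

theorem map_action (g : L →ₗ[R] L') (hg : ∀ (a : Λ) (x : L), g (a • x) = a • g x) (a : Λ)
    (z : BaseChange f L) : map f g (a • z) = a • map f g z := by
  induction z using induction_on with
  | zero => simp
  | tmul s x => rw [action_tmul, map_tmul, map_tmul, action_tmul, hg]
  | add y z hy hz => rw [smul_add, map_add, hy, hz, map_add, smul_add]

theorem cancel_action (f : R →+* S) (g : S →+* T) (h : R →+* T) (e : g.comp f = h) (a : Λ)
    (z : BaseChange g (BaseChange f L)) : cancel f g h e L (a • z) = a • cancel f g h e L z := by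
  induction z using induction_on with
  | zero => simp
  | tmul t y =>
    induction y using induction_on with
    | zero =>
      simp [tmul_zero]
    | tmul s x => rw [action_tmul, action_tmul, cancel_tmul, cancel_tmul, action_tmul]
    | add y z hy hz =>
      rw [tmul_add, smul_add, map_add, hy, hz, map_add, smul_add]
  | add y z hy hz => rw [smul_add, map_add, hy, hz, map_add, smul_add]

end Action

end BaseChange

/-! ### Lifts and deformations of modules -/

/-- A lift `(L, λ)` of the `Λ`-module `V` over `R`. An `R ⊗_k Λ`-module is an abelian group with
commuting actions of `R` and `Λ` that agree on `k`; as `Λ` has finite dimension over `k`,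
such a module is finitely generated over `R ⊗_k Λ` if and only if it is so over `R`. -/
structure ModuleLift {k : Type u} [Field k] (Λ : Type u) [Ring Λ] [Algebra k Λ]
    (V : Type u) [AddCommGroup V] [Module Λ V] (R : CompleteLocalAlg k) : Type (u + 1) where
  carrier : Type u
  [addCommGroup : AddCommGroup carrier]
  [moduleBase : Module R carrier]
  [moduleAlg : Module Λ carrier]
  [smulCommClass : SMulCommClass Λ R carrier]
  algebraMap_smul : ∀ (c : k) (x : carrier), algebraMap k Λ c • x = algebraMap k R c • x
  [finite : Module.Finite R carrier]
  [free : Module.Free R carrier]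
  /-- the isomorphism `λ : k ⊗_R L → V` of `Λ`-modules -/
  reduction : BaseChange R.residue carrier ≃ₗ[Λ] V

namespace ModuleLift

variable {k : Type u} [Field k] {Λ : Type u} [Ring Λ] [Algebra k Λ]
  {V : Type u} [AddCommGroup V] [Module Λ V] {R S T : CompleteLocalAlg k}

attribute [instance] addCommGroup moduleBase moduleAlg smulCommClass finite free

/-- Two lifts `(L, λ)` and `(L', λ')` over `R` are isomorphic if there is an isomorphism
`f : L → L'` of `R ⊗_k Λ`-modules with `λ' ∘ (k ⊗_R f) = λ`. -/
def Isomorphic (L L' : ModuleLift Λ V R) : Prop :=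
  ∃ f : L.carrier ≃ₗ[R] L'.carrier, (∀ (a : Λ) (x : L.carrier), f (a • x) = a • f x) ∧
    ∀ z : BaseChange R.residue L.carrier,
      L'.reduction (BaseChange.map R.residue f.toLinearMap z) = L.reduction z

theorem Isomorphic.refl (L : ModuleLift Λ V R) : Isomorphic L L :=
  ⟨LinearEquiv.refl R L.carrier, fun _ _ => rfl,
    fun z => congrArg L.reduction (BaseChange.map_id R.residue z)⟩

theorem Isomorphic.symm {L L' : ModuleLift Λ V R} (h : Isomorphic L L') : Isomorphic L' L := by
  obtain ⟨f, hf, hr⟩ := h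
  refine ⟨f.symm, fun a x => ?_, fun z => ?_⟩
  · rw [LinearEquiv.symm_apply_eq, hf, LinearEquiv.apply_symm_apply]
  · rw [← hr, ← BaseChange.map_comp_apply, LinearEquiv.comp_symm, BaseChange.map_id]

theorem Isomorphic.trans {L L' L'' : ModuleLift Λ V R} (h : Isomorphic L L')
    (h' : Isomorphic L' L'') : Isomorphic L L'' := by
  obtain ⟨f, hf, hr⟩ := h
  obtain ⟨g, hg, hs⟩ := h'
  refine ⟨f.trans g, fun a x => ?_, fun z => ?_⟩
  · rw [LinearEquiv.trans_apply, hf, hg, LinearEquiv.trans_apply]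
  · rw [LinearEquiv.coe_trans, BaseChange.map_comp_apply, hs, hr]

/-- Isomorphism of lifts as an equivalence relation. -/
instance setoid (Λ : Type u) [Ring Λ] [Algebra k Λ] (V : Type u) [AddCommGroup V] [Module Λ V]
    (R : CompleteLocalAlg k) : Setoid (ModuleLift Λ V R) where
  r := Isomorphic
  iseqv := ⟨Isomorphic.refl, Isomorphic.symm, Isomorphic.trans⟩

/-- The lift `(S ⊗_{R,α} L, λ_α)`, where `λ_α` is the composition
`k ⊗_S (S ⊗_{R,α} L) ≅ k ⊗_R L → V`. -/
abbrev baseChange (α : R ⟶ S) (L : ModuleLift Λ V R) : ModuleLift Λ V S where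
  carrier := BaseChange (CompleteLocalAlg.Hom.ringHom α) L.carrier
  algebraMap_smul c z := by
    induction z using BaseChange.induction_on with
    | zero => simp
    | tmul s x =>
      rw [BaseChange.action_tmul, L.algebraMap_smul, BaseChange.tmul_smul, BaseChange.smul_tmul]
      congr 2
      exact α.toAlgHom.commutes c
    | add y z hy hz => rw [smul_add, smul_add, hy, hz]
  reduction :=
    { toFun := fun z => L.reduction
        (BaseChange.cancel _ _ _ (CompleteLocalAlg.residue_comp α) L.carrier z)
      invFun := fun v =>
        (BaseChange.cancel _ _ _ (CompleteLocalAlg.residue_comp α) L.carrier).symm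
          (L.reduction.symm v)
      map_add' := fun y z => by rw [map_add, map_add]
      map_smul' := fun a z => by
        rw [BaseChange.cancel_action, map_smul, RingHom.id_apply]
      left_inv := fun z => by simp
      right_inv := fun v => by simp }

theorem baseChange_reduction_tmul (α : R ⟶ S) (L : ModuleLift Λ V R) (c : k) (s : S)
    (x : L.carrier) :
    (L.baseChange α).reduction
      (BaseChange.tmul S.residue c (BaseChange.tmul (CompleteLocalAlg.Hom.ringHom α) s x)) =
      L.reduction (BaseChange.tmul R.residue (S.residue s * c) x) :=
  congrArg L.reduction (BaseChange.cancel_tmul _ _ _ (CompleteLocalAlg.residue_comp α) c s x)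

theorem Isomorphic.baseChange (α : R ⟶ S) {L L' : ModuleLift Λ V R} (h : Isomorphic L L') :
    Isomorphic (L.baseChange α) (L'.baseChange α) := by
  obtain ⟨f, hf, hr⟩ := h
  refine ⟨BaseChange.congr _ f, fun a x => ?_, fun z => ?_⟩
  · exact BaseChange.map_action _ f.toLinearMap hf a x
  · induction z using BaseChange.induction_on with
    | zero => simp
    | tmul c y =>
      induction y using BaseChange.induction_on with
      | zero =>
        rw [BaseChange.tmul_zero]; simp
      | tmul s x =>
        rw [BaseChange.map_tmul, baseChange_reduction_tmul, ← hr, BaseChange.map_tmul]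
        exact baseChange_reduction_tmul α L' c s (f x)
      | add y z hy hz => rw [BaseChange.tmul_add, map_add, map_add, map_add, hy, hz]
    | add y z hy hz => rw [map_add, map_add, map_add, hy, hz]

theorem baseChange_id (L : ModuleLift Λ V R) : Isomorphic (L.baseChange (𝟙 R)) L := by
  refine ⟨BaseChange.lid _ (CompleteLocalAlg.Hom.ringHom_id R), fun a x => ?_, fun z => ?_⟩
  · induction x using BaseChange.induction_on with
    | zero => simp
    | tmul s x =>
      rw [BaseChange.action_tmul, BaseChange.lid_tmul, BaseChange.lid_tmul]
      exact (smul_comm a s x).symm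
    | add y z hy hz => rw [smul_add, map_add, hy, hz, map_add, smul_add]
  · induction z using BaseChange.induction_on with
    | zero => simp
    | tmul c y =>
      induction y using BaseChange.induction_on with
      | zero =>
        rw [BaseChange.tmul_zero]; simp
      | tmul s x =>
        rw [BaseChange.map_tmul, baseChange_reduction_tmul, LinearEquiv.coe_coe,
          BaseChange.lid_tmul, BaseChange.tmul_smul]
      | add y z hy hz => rw [BaseChange.tmul_add, map_add, map_add, map_add, hy, hz]
    | add y z hy hz => rw [map_add, map_add, map_add, hy, hz]

theorem baseChange_comp (α : R ⟶ S) (β : S ⟶ T) (L : ModuleLift Λ V R) :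
    Isomorphic ((L.baseChange α).baseChange β) (L.baseChange (α ≫ β)) := by
  refine ⟨BaseChange.cancel _ _ _ (CompleteLocalAlg.Hom.ringHom_comp α β) L.carrier, fun a x => ?_, fun z => ?_⟩
  · exact BaseChange.cancel_action _ _ _ _ a x
  · induction z using BaseChange.induction_on with
    | zero => simp
    | tmul c y =>
      induction y using BaseChange.induction_on with
      | zero =>
        rw [BaseChange.tmul_zero]; simp
      | tmul t y =>
        induction y using BaseChange.induction_on with
        | zero =>
          rw [BaseChange.tmul_zero, BaseChange.tmul_zero]; simp
        | tmul s x =>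
          have h := RingHom.congr_fun (CompleteLocalAlg.residue_comp β) s
          rw [BaseChange.map_tmul, LinearEquiv.coe_coe, BaseChange.cancel_tmul,
            baseChange_reduction_tmul, baseChange_reduction_tmul, baseChange_reduction_tmul,
            map_mul, mul_assoc]
          congr 3
        | add y z hy hz =>
          rw [BaseChange.tmul_add, BaseChange.tmul_add, map_add, map_add, map_add, hy, hz]
      | add y z hy hz => rw [BaseChange.tmul_add, map_add, map_add, map_add, hy, hz]
    | add y z hy hz => rw [map_add, map_add, map_add, hy, hz]

end ModuleLift

/-- The deformation functor of the `Λ`-module `V`: it sends `R` to the set of isomorphism classes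
`[L, λ]` of lifts of `V` over `R`, and `α : R → S` to `[L, λ] ↦ [S ⊗_{R,α} L, λ_α]`. -/
def deformationFunctor {k : Type u} [Field k] (Λ : Type u) [Ring Λ] [Algebra k Λ]
    (V : Type u) [AddCommGroup V] [Module Λ V] : CompleteLocalAlg k ⥤ Type (u + 1) where
  obj R := Quotient (ModuleLift.setoid Λ V R)
  map α := TypeCat.ofHom (Quotient.map (ModuleLift.baseChange α)
    fun _ _ h => ModuleLift.Isomorphic.baseChange α h)
  map_id R := by
    ext ξ
    induction ξ using Quotient.inductionOn with
    | h L => exact Quotient.sound (ModuleLift.baseChange_id L)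
  map_comp α β := by
    ext ξ
    induction ξ using Quotient.inductionOn with
    | h L => exact Quotient.sound (ModuleLift.baseChange_comp α β L).symm

/-! ### Versal and universal deformation rings -/

/-- The pair `(R, ξ)` is a pro-representable hull of (the restriction to Artinian rings of) `F`:
the transformation `Hom(R, -) → F` given by `ξ` is smooth on Artinian rings, and it is bijective
on the dual numbers. -/
structure IsHull {k : Type u} [Field k] (F : CompleteLocalAlg k ⥤ Type w)
    (R : CompleteLocalAlg k) (ξ : F.obj R) : Prop where
  smooth : ∀ (A B : CompleteLocalAlg k) [IsArtinianRing A] [IsArtinianRing B] (p : B ⟶ A),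
    Function.Surjective (CompleteLocalAlg.Hom.ringHom p) →
    ∀ (g : R ⟶ A) (η : F.obj B), F.map p η = F.map g ξ →
      ∃ h : R ⟶ B, h ≫ p = g ∧ F.map h ξ = η
  tangent : Function.Bijective
    fun h : R ⟶ CompleteLocalAlg.dualNumber k => F.map h ξ

/-- `R` is a versal deformation ring `R(Λ, V)` of the `Λ`-module `V`. -/
def IsVersalDeformationRing {k : Type u} [Field k] (Λ : Type u) [Ring Λ] [Algebra k Λ]
    (V : Type u) [AddCommGroup V] [Module Λ V] (R : CompleteLocalAlg k) : Prop :=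
  ∃ ξ : (deformationFunctor (k := k) Λ V).obj R, IsHull (deformationFunctor Λ V) R ξ

/-- `R` is a universal deformation ring of the `Λ`-module `V`: it represents the deformation
functor. -/
def IsUniversalDeformationRing {k : Type u} [Field k] (Λ : Type u) [Ring Λ] [Algebra k Λ]
    (V : Type u) [AddCommGroup V] [Module Λ V] (R : CompleteLocalAlg k) : Prop :=
  ∃ ξ : (deformationFunctor (k := k) Λ V).obj R, ∀ S : CompleteLocalAlg k,
    Function.Bijective fun α : R ⟶ S => (deformationFunctor Λ V).map α ξ

/-! ### Tensor products over noncommutative rings and stable equivalences of Morita type -/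

/-- The subgroup of `M ⊗_ℤ N` generated by the elements `(m a) ⊗ n - m ⊗ (a n)`. -/
def balancedRelations (A M N : Type u) [Ring A] [AddCommGroup M] [Module Aᵐᵒᵖ M]
    [AddCommGroup N] [Module A N] : Submodule ℤ (M ⊗[ℤ] N) :=
  Submodule.span ℤ {z | ∃ (m : M) (a : A) (n : N), z = (op a • m) ⊗ₜ[ℤ] n - m ⊗ₜ[ℤ] (a • n)}

/-- The tensor product `M ⊗_A N` of a right `A`-module `M` and a left `A`-module `N`. -/
def BalancedTensor (A M N : Type u) [Ring A] [AddCommGroup M] [Module Aᵐᵒᵖ M]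
    [AddCommGroup N] [Module A N] : Type u :=
  (M ⊗[ℤ] N) ⧸ balancedRelations A M N

namespace BalancedTensor

variable (A : Type u) {M N : Type u} [Ring A] [AddCommGroup M] [Module Aᵐᵒᵖ M]
  [AddCommGroup N] [Module A N]

instance : AddCommGroup (BalancedTensor A M N) :=
  inferInstanceAs (AddCommGroup ((M ⊗[ℤ] N) ⧸ balancedRelations A M N))

/-- Pure tensors. -/
def tmul (m : M) (n : N) : BalancedTensor A M N :=
  (balancedRelations A M N).mkQ (m ⊗ₜ[ℤ] n)

variable {A} in
theorem induction_on {p : BalancedTensor A M N → Prop} (z : BalancedTensor A M N) (zero : p 0)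
    (tmul : ∀ m n, p (tmul A m n)) (add : ∀ y z, p y → p z → p (y + z)) : p z := by
  obtain ⟨z, rfl⟩ := (balancedRelations A M N).mkQ_surjective z
  induction z using TensorProduct.induction_on with
  | zero => exact (map_zero (balancedRelations A M N).mkQ).symm ▸ zero
  | tmul m n => exact tmul m n
  | add y z hy hz => exact (map_add (balancedRelations A M N).mkQ y z).symm ▸ add _ _ hy hz

theorem add_tmul (m m' : M) (n : N) : tmul A (m + m') n = tmul A m n + tmul A m' n := by
  rw [tmul, TensorProduct.add_tmul, map_add]
  rfl

theorem tmul_add (m : M) (n n' : N) : tmul A m (n + n') = tmul A m n + tmul A m n' := by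
  rw [tmul, TensorProduct.tmul_add, map_add]
  rfl

theorem op_smul_tmul (m : M) (a : A) (n : N) : tmul A (op a • m) n = tmul A m (a • n) :=
  (Submodule.Quotient.eq (balancedRelations A M N)).2 (Submodule.subset_span ⟨m, a, n, rfl⟩)

/-- The additive map `f ⊗ g` for right `A`-linear `f` and left `A`-linear `g`. -/
def map {M' N' : Type u} [AddCommGroup M'] [Module Aᵐᵒᵖ M'] [AddCommGroup N'] [Module A N']
    (f : M →ₗ[Aᵐᵒᵖ] M') (g : N →ₗ[A] N') : BalancedTensor A M N →+ BalancedTensor A M' N' :=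
  ((balancedRelations A M N).mapQ (balancedRelations A M' N')
    (TensorProduct.map f.toAddMonoidHom.toIntLinearMap g.toAddMonoidHom.toIntLinearMap) (by
      rw [balancedRelations, Submodule.span_le]
      rintro _ ⟨m, a, n, rfl⟩
      refine Submodule.subset_span ⟨f m, a, g n, ?_⟩
      refine (map_sub (TensorProduct.map _ _) _ _).trans ?_
      exact congrArg₂ (fun p q => p ⊗ₜ[ℤ] g n - f m ⊗ₜ[ℤ] q) (f.map_smul (op a) m)
        (g.map_smul a n))).toAddMonoidHom

theorem map_tmul {M' N' : Type u} [AddCommGroup M'] [Module Aᵐᵒᵖ M'] [AddCommGroup N']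
    [Module A N'] (f : M →ₗ[Aᵐᵒᵖ] M') (g : N →ₗ[A] N') (m : M) (n : N) :
    map A f g (tmul A m n) = tmul A (f m) (g n) := rfl

section Left

variable {B : Type u} [Ring B] [Module B M] [SMulCommClass B Aᵐᵒᵖ M]

/-- If `M` is a `B`-`A`-bimodule, then `M ⊗_A N` is a left `B`-module. -/
instance leftModule : Module B (BalancedTensor A M N) where
  smul b z := map A (Module.toModuleEnd Aᵐᵒᵖ M b) LinearMap.id z
  one_smul z := by
    change map A _ _ z = z
    induction z using induction_on with
    | zero => simp
    | tmul m n => rw [map_tmul]; simp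
    | add y z hy hz => rw [map_add, hy, hz]
  mul_smul b c z := by
    change map A _ _ z = map A _ _ (map A _ _ z)
    induction z using induction_on with
    | zero => simp
    | tmul m n => rw [map_tmul, map_tmul, map_tmul]; simp [mul_smul]
    | add y z hy hz => rw [map_add, hy, hz, map_add, map_add]
  smul_zero b := map_zero _
  smul_add b := map_add _
  add_smul b c z := by
    change map A _ _ z = map A _ _ z + map A _ _ z
    induction z using induction_on with
    | zero => simp
    | tmul m n => rw [map_tmul, map_tmul, map_tmul]; simp [add_smul, add_tmul]
    | add y z hy hz => rw [map_add, hy, hz, map_add, map_add]; abel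
  zero_smul z := by
    change map A _ _ z = 0
    induction z using induction_on with
    | zero => simp
    | tmul m n =>
      rw [map_tmul, map_zero, LinearMap.zero_apply, tmul, TensorProduct.zero_tmul, map_zero]
      rfl
    | add y z hy hz => rw [map_add, hy, hz, add_zero]

theorem smul_tmul (b : B) (m : M) (n : N) : b • tmul A m n = tmul A (b • m) n := rfl

end Left

section Right

variable {C : Type u} [Ring C] [Module Cᵐᵒᵖ N] [SMulCommClass A Cᵐᵒᵖ N]

/-- If `N` is an `A`-`C`-bimodule, then `M ⊗_A N` is a right `C`-module. -/
instance rightModule : Module Cᵐᵒᵖ (BalancedTensor A M N) :=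
  haveI : SMulCommClass Cᵐᵒᵖ A N := SMulCommClass.symm A Cᵐᵒᵖ N
  { smul := fun c z => map A LinearMap.id (Module.toModuleEnd A N c) z
    one_smul := fun z => by
      change map A _ _ z = z
      induction z using induction_on with
      | zero => simp
      | tmul m n => rw [map_tmul]; simp
      | add y z hy hz => rw [map_add, hy, hz]
    mul_smul := fun b c z => by
      change map A _ _ z = map A _ _ (map A _ _ z)
      induction z using induction_on with
      | zero => simp
      | tmul m n => rw [map_tmul, map_tmul, map_tmul]; simp [mul_smul]
      | add y z hy hz => rw [map_add, hy, hz, map_add, map_add]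
    smul_zero := fun b => map_zero _
    smul_add := fun b => map_add _
    add_smul := fun b c z => by
      change map A _ _ z = map A _ _ z + map A _ _ z
      induction z using induction_on with
      | zero => simp
      | tmul m n => rw [map_tmul, map_tmul, map_tmul]; simp [add_smul, tmul_add]
      | add y z hy hz => rw [map_add, hy, hz, map_add, map_add]; abel
    zero_smul := fun z => by
      change map A _ _ z = 0
      induction z using induction_on with
      | zero => simp
      | tmul m n =>
        rw [map_tmul, map_zero, LinearMap.zero_apply, tmul, TensorProduct.tmul_zero, map_zero]
        rfl
      | add y z hy hz => rw [map_add, hy, hz, add_zero] }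

theorem op_smul_tmul' (c : C) (m : M) (n : N) : op c • tmul A m n = tmul A m (op c • n) := rfl

end Right

end BalancedTensor

/-- `W ≅ A ⊕ P` as `A`-`A`-bimodules for some projective `A`-`A`-bimodule `P`, where
`A`-`A`-bimodules (with `k` acting centrally) are the same as left `A ⊗_k Aᵒᵖ`-modules. -/
def IsRegularPlusProjective (k A W : Type u) [Field k] [Ring A] [Algebra k A] [AddCommGroup W]
    [Module A W] [Module Aᵐᵒᵖ W] : Prop :=
  ∃ (P : Type u) (_ : AddCommGroup P) (_ : Module (A ⊗[k] Aᵐᵒᵖ) P),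
    Module.Projective (A ⊗[k] Aᵐᵒᵖ) P ∧
    ∃ e : W ≃+ A × P,
      (∀ (a : A) (z : W), e (a • z) = (a * (e z).1, (a ⊗ₜ[k] (1 : Aᵐᵒᵖ)) • (e z).2)) ∧
      (∀ (b : A) (z : W), e (op b • z) = ((e z).1 * b, ((1 : A) ⊗ₜ[k] op b) • (e z).2))

/-- The `Γ`-`Λ`-bimodule `X` and the `Λ`-`Γ`-bimodule `Y` induce a stable equivalence of Morita
type between `Λ` and `Γ`. -/
structure InducesStableEquivalenceOfMoritaType (k Λ Γ X Y : Type u) [Field k]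
    [Ring Λ] [Algebra k Λ] [Ring Γ] [Algebra k Γ]
    [AddCommGroup X] [Module Γ X] [Module Λᵐᵒᵖ X] [SMulCommClass Γ Λᵐᵒᵖ X]
    [AddCommGroup Y] [Module Λ Y] [Module Γᵐᵒᵖ Y] [SMulCommClass Λ Γᵐᵒᵖ Y] : Prop where
  projective_left_X : Module.Projective Γ X
  projective_right_X : Module.Projective Λᵐᵒᵖ X
  projective_left_Y : Module.Projective Λ Y
  projective_right_Y : Module.Projective Γᵐᵒᵖ Y
  tensor_YX : IsRegularPlusProjective k Λ (BalancedTensor Γ Y X)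
  tensor_XY : IsRegularPlusProjective k Γ (BalancedTensor Λ X Y)

end

noncomputable section

set_option linter.style.haveILetI false

/-! ### Lifts in terms of their reduction maps -/

namespace CompleteLocalAlg

variable {k : Type u} [Field k]

/-! The natural isomorphism is `L ↦ X ⊗_Λ L`. Since `X` is finite projective over `Λᵐᵒᵖ`, the module
`X ⊗_Λ L` is an `R`-summand of some `L ^ n`. It is therefore free over `R`, its reduction is `X ⊗_Λ
V`, and the construction commutes with base change. What remains is bijectivity on isomorphism
classes for each `R`. Throughout, an equivariant `R`-linear map of lifts that is compatible with the
reductions is automatically an isomorphism, by Nakayama and freeness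
(`ModuleLift.bijective_of_red`).

Injectivity needs only that `Λ` is a bimodule summand of `Y ⊗_Γ X`. An isomorphism `X ⊗ L ≅ X ⊗ L'`
is tensored with `Y`, then composed with the natural inclusion of `L` and the natural retraction
onto `L'`. The result need not be visibly invertible, but by naturality it reduces to the identity
of `V`, so it is an isomorphism (`Isomorphic.of_tensor_tensor`).

For surjectivity, let `L'` lift `X ⊗ V` and put `M = Y ⊗ L'`, a lift of `Y ⊗ X ⊗ V ≅ V ⊕ (P ⊗_Λ V)`.
The projection to the second summand factors through a finite free `Λ`-module (`exists_splitting`).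
Over a self-injective algebra such maps lift to arbitrary lifts of source and target: the embedding
of `Λ` in its coinduced module splits, so a form with values in `Λ` is a trace of `k`-linear forms
(`exists_casimir`), and `k`-linear forms lift over `R` because lifts are free
(`exists_hom_lifting`). The kernel of the lifted projection is a lift `L` of `V` with `Y ⊗ X ⊗ L ≅ Y
⊗ L'` (`exists_isomorphic_tensor_tensor`). Tensoring with `X` and applying the injectivity argument
with the roles of `X` and `Y` exchanged gives `X ⊗ L ≅ L'`.

Versal rings are handled in the style of Schlessinger. Two hulls map to each other compatibly modulo
every power of the maximal ideal. Bijectivity on tangent spaces makes both maps surjective, and a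
surjective endomorphism of a Noetherian ring is injective (`IsHull.nonempty_iso`). A hull is
constructed explicitly: with a basis of `V`, lifts become matrix representations modulo conjugation
by matrices congruent to `1`, and the hull represents the representations in a linear slice
transversal to the conjugation orbits (`hull_smooth`, `hull_tangent_injective`). Hulls and
representability are then transported along the isomorphism of functors. -/

theorem residue_surjective (R : CompleteLocalAlg k) : Function.Surjective R.residue :=
  fun c => ⟨algebraMap k R c, R.residue_algebraMap c⟩

theorem Hom.ringHom_algebraMap {R S : CompleteLocalAlg k} (α : R ⟶ S) (c : k) :
    Hom.ringHom α (algebraMap k R c) = algebraMap k S c :=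
  α.toAlgHom.commutes c

theorem residue_ringHom {R S : CompleteLocalAlg k} (α : R ⟶ S) (r : R) :
    S.residue (Hom.ringHom α r) = R.residue r :=
  RingHom.congr_fun (residue_comp α) r

theorem sub_algebraMap_residue_mem (R : CompleteLocalAlg k) (r : R) :
    r - algebraMap k R (R.residue r) ∈ IsLocalRing.maximalIdeal R := by
  rw [← residue_eq_zero_iff, map_sub, residue_algebraMap, sub_self]

theorem ker_residue (R : CompleteLocalAlg k) :
    RingHom.ker R.residue = IsLocalRing.maximalIdeal R :=
  Ideal.ext fun r => R.residue_eq_zero_iff r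

end CompleteLocalAlg

namespace BaseChange

variable {R S : Type u} [CommRing R] [CommRing S] (f : R →+* S) {L W : Type u}
  [AddCommGroup L] [Module R L] [AddCommGroup W] [Module S W]

/-- The `S`-linear map out of `S ⊗_{R,f} L` induced by an `f`-semilinear map. -/
def lift (g : L →+ W) (hg : ∀ (r : R) (x : L), g (r • x) = f r • g x) :
    BaseChange f L →ₗ[S] W :=
  letI := f.toAlgebra
  letI : Module R W := Module.compHom W f
  haveI : IsScalarTower R S W := ⟨fun r s x => mul_smul (f r) s x⟩
  LinearMap.liftBaseChange S ({ g with map_smul' := hg } : L →ₗ[R] W)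

theorem lift_tmul (g : L →+ W) (hg : ∀ (r : R) (x : L), g (r • x) = f r • g x) (s : S) (x : L) :
    lift f g hg (tmul f s x) = s • g x := rfl

/-- Surjectivity identifies `S` with `R ⧸ ker f`, hence `S ⊗ L` with `L ⧸ (ker f) L`. -/
theorem one_tmul_eq_zero_iff (hf : Function.Surjective f) (x : L) :
    tmul f 1 x = 0 ↔ x ∈ RingHom.ker f • (⊤ : Submodule R L) := by
  letI := f.toAlgebra
  let g : R →ₗ[R] S := Algebra.linearMap R S
  let e : (R ⧸ RingHom.ker f) ≃ₗ[R] S := g.quotKerEquivOfSurjective hf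
  have h2 : TensorProduct.quotTensorEquivQuotSMul L (RingHom.ker f)
      ((1 : R ⧸ RingHom.ker f) ⊗ₜ[R] x) = Submodule.Quotient.mk x := by
    refine (TensorProduct.quotTensorEquivQuotSMul_mk_tmul (RingHom.ker f) 1 x).trans ?_
    rw [one_smul]
  rw [← Submodule.Quotient.mk_eq_zero, ← h2, LinearEquiv.map_eq_zero_iff]
  have h1 : e.rTensor L ((1 : R ⧸ RingHom.ker f) ⊗ₜ[R] x) = tmul f 1 x := by
    change e 1 ⊗ₜ[R] x = (1 : S) ⊗ₜ[R] x
    congr 1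
    exact map_one f
  rw [← h1]
  exact (e.rTensor L).map_eq_zero_iff

theorem exists_one_tmul {k : Type u} [Field k] {R : CompleteLocalAlg k} {L : Type u}
    [AddCommGroup L] [Module R L] (z : BaseChange R.residue L) :
    ∃ x, tmul R.residue 1 x = z := by
  induction z using BaseChange.induction_on with
  | zero => exact ⟨0, BaseChange.tmul_zero _ _⟩
  | tmul c x =>
    refine ⟨algebraMap k R c • x, ?_⟩
    rw [BaseChange.tmul_smul, CompleteLocalAlg.residue_algebraMap, mul_one]
  | add y z hy hz =>
    obtain ⟨x, rfl⟩ := hy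
    obtain ⟨x', rfl⟩ := hz
    exact ⟨x + x', BaseChange.tmul_add _ _ _ _⟩

end BaseChange

namespace ModuleLift

variable {k : Type u} [Field k] {Λ : Type u} [Ring Λ] [Algebra k Λ]
  {V : Type u} [AddCommGroup V] [Module Λ V] {R S T : CompleteLocalAlg k}

/-- The map `L → k ⊗_R L → V` of a lift `(L, λ)`. -/
def red (L : ModuleLift Λ V R) : L.carrier →ₗ[Λ] V where
  toFun x := L.reduction (BaseChange.tmul R.residue 1 x)
  map_add' x y := by rw [BaseChange.tmul_add, map_add]
  map_smul' a x := by rw [← BaseChange.action_tmul, map_smul, RingHom.id_apply]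

theorem reduction_tmul (L : ModuleLift Λ V R) (c : k) (x : L.carrier) :
    L.reduction (BaseChange.tmul R.residue c x) = algebraMap k Λ c • L.red x := by
  change _ = algebraMap k Λ c • L.reduction _
  rw [← map_smul, BaseChange.action_tmul, L.algebraMap_smul, BaseChange.tmul_smul,
    CompleteLocalAlg.residue_algebraMap, mul_one]

theorem red_smul (L : ModuleLift Λ V R) (r : R) (x : L.carrier) :
    L.red (r • x) = algebraMap k Λ (R.residue r) • L.red x := by
  rw [← reduction_tmul]
  change L.reduction _ = _
  rw [BaseChange.tmul_smul, mul_one]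

theorem red_surjective (L : ModuleLift Λ V R) : Function.Surjective L.red := fun v => by
  obtain ⟨x, hx⟩ := BaseChange.exists_one_tmul (L.reduction.symm v)
  exact ⟨x, by change L.reduction _ = _; rw [hx, LinearEquiv.apply_symm_apply]⟩

/-- Together with surjectivity, this replaces the isomorphism `k ⊗_R L ≅ V` by a semilinear
surjection with kernel `𝔪 L`. Lifts are built and compared in this form from here on. -/
theorem red_eq_zero_iff (L : ModuleLift Λ V R) (x : L.carrier) :
    L.red x = 0 ↔ x ∈ IsLocalRing.maximalIdeal R • (⊤ : Submodule R L.carrier) := by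
  rw [← R.ker_residue, ← BaseChange.one_tmul_eq_zero_iff _ R.residue_surjective]
  exact L.reduction.map_eq_zero_iff

/-- The isomorphism `k ⊗_R L → V` induced by a semilinear surjection `L → V` with kernel `𝔪 L`. -/
def reductionOfRed {L : Type u} [AddCommGroup L] [Module R L] [Module Λ L] [SMulCommClass Λ R L]
    (g : L →ₗ[Λ] V) (hg : ∀ (r : R) (x : L), g (r • x) = algebraMap k Λ (R.residue r) • g x)
    (hsurj : Function.Surjective g)
    (hker : ∀ x, g x = 0 → x ∈ IsLocalRing.maximalIdeal R • (⊤ : Submodule R L)) :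
    BaseChange R.residue L ≃ₗ[Λ] V := by
  letI : Module k V := Module.compHom V (algebraMap k Λ)
  let f : BaseChange R.residue L →ₗ[k] V := BaseChange.lift R.residue g.toAddMonoidHom hg
  have hf : ∀ c x, f (BaseChange.tmul R.residue c x) = algebraMap k Λ c • g x :=
    fun c x => BaseChange.lift_tmul _ _ _ _ _
  have h1 : ∀ x, f (BaseChange.tmul R.residue 1 x) = g x := fun x => by
    rw [hf, map_one, one_smul]
  refine LinearEquiv.ofBijective
    ({ toFun := f, map_add' := map_add f, map_smul' := fun a z => ?_ } :
      BaseChange R.residue L →ₗ[Λ] V) ⟨?_, fun v => ?_⟩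
  · obtain ⟨x, rfl⟩ := BaseChange.exists_one_tmul z
    rw [BaseChange.action_tmul, h1, h1, map_smul, RingHom.id_apply]
  · rw [injective_iff_map_eq_zero]
    intro z hz
    obtain ⟨x, rfl⟩ := BaseChange.exists_one_tmul z
    rw [BaseChange.one_tmul_eq_zero_iff _ R.residue_surjective, R.ker_residue]
    exact hker x ((h1 x).symm.trans hz)
  · obtain ⟨x, rfl⟩ := hsurj v
    exact ⟨_, h1 x⟩

/-- A lift constructed from a semilinear surjection `L → V` with kernel `𝔪 L`. -/
abbrev ofRed (L : Type u) [AddCommGroup L] [Module R L] [Module Λ L] [SMulCommClass Λ R L]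
    [Module.Finite R L] [Module.Free R L]
    (hk : ∀ (c : k) (x : L), algebraMap k Λ c • x = algebraMap k R c • x)
    (g : L →ₗ[Λ] V) (hg : ∀ (r : R) (x : L), g (r • x) = algebraMap k Λ (R.residue r) • g x)
    (hsurj : Function.Surjective g)
    (hker : ∀ x, g x = 0 → x ∈ IsLocalRing.maximalIdeal R • (⊤ : Submodule R L)) :
    ModuleLift Λ V R where
  carrier := L
  algebraMap_smul := hk
  reduction := reductionOfRed g hg hsurj hker

theorem ofRed_red (L : Type u) [AddCommGroup L] [Module R L] [Module Λ L] [SMulCommClass Λ R L]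
    [Module.Finite R L] [Module.Free R L]
    (hk : ∀ (c : k) (x : L), algebraMap k Λ c • x = algebraMap k R c • x)
    (g : L →ₗ[Λ] V) (hg : ∀ (r : R) (x : L), g (r • x) = algebraMap k Λ (R.residue r) • g x)
    (hsurj : Function.Surjective g)
    (hker : ∀ x, g x = 0 → x ∈ IsLocalRing.maximalIdeal R • (⊤ : Submodule R L)) (x : L) :
    (ofRed L hk g hg hsurj hker).red x = g x := by
  change algebraMap k Λ 1 • g x = g x
  rw [map_one, one_smul]

/-- A linear map between lifts that is surjective modulo the maximal ideal is surjective. -/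
theorem surjective_of_red {W : Type u} [AddCommGroup W] [Module Λ W] {M : Type*}
    [AddCommGroup M] [Module R M] (L' : ModuleLift Λ W R) (f : M →ₗ[R] L'.carrier)
    (hf : ∀ w, ∃ x, L'.red (f x) = w) : Function.Surjective f := by
  -- Nakayama: the target is finite over the local ring `R`, so surjectivity modulo `𝔪` is enough.
  refine f.surjective_of_surjective_comp_mkQ (IsLocalRing.maximalIdeal R)
    (IsLocalRing.maximalIdeal_le_jacobson _) fun y => ?_
  obtain ⟨y, rfl⟩ := Submodule.mkQ_surjective _ y
  obtain ⟨x, hx⟩ := hf (L'.red y)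
  refine ⟨x, ?_⟩
  rw [LinearMap.comp_apply, ← sub_eq_zero, ← map_sub, Submodule.mkQ_apply,
    Submodule.Quotient.mk_eq_zero, ← red_eq_zero_iff, map_sub, hx, sub_self]

/-- Nakayama gives surjectivity, and freeness of the target gives a section `σ`. Since `σ` is
compatible with the reductions too, it is also surjective by Nakayama, which forces injectivity. Two
different algebras are allowed so that a lift can be compared with a bare free module, viewed as a
lift for `k` alone. -/
theorem bijective_of_red {W : Type u} [AddCommGroup W] [Module Λ W] {Λ' : Type u} [Ring Λ']
    [Algebra k Λ'] [Module Λ' W] (L : ModuleLift Λ W R) (L' : ModuleLift Λ' W R)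
    (f : L.carrier →ₗ[R] L'.carrier) (hf : ∀ x, L'.red (f x) = L.red x) :
    Function.Bijective f := by
  have hs : Function.Surjective f := L'.surjective_of_red f fun w => by
    obtain ⟨x, hx⟩ := L.red_surjective w
    exact ⟨x, (hf x).trans hx⟩
  obtain ⟨σ, hσ⟩ := f.exists_rightInverse_of_surjective (LinearMap.range_eq_top.2 hs)
  have hσ' : ∀ y, f (σ y) = y := fun y => LinearMap.congr_fun hσ y
  have hσs : Function.Surjective σ := L.surjective_of_red σ fun w => by
    obtain ⟨y, hy⟩ := L'.red_surjective w
    exact ⟨y, by rw [← hf, hσ', hy]⟩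
  refine ⟨fun x x' h => ?_, hs⟩
  obtain ⟨y, rfl⟩ := hσs x
  obtain ⟨y', rfl⟩ := hσs x'
  rw [hσ', hσ'] at h
  rw [h]

/-- No inverse has to be exhibited: every isomorphism of lifts below is produced by writing down one
equivariant map over the identity of `V`. -/
theorem Isomorphic.of_hom {L L' : ModuleLift Λ V R} (f : L.carrier →ₗ[R] L'.carrier)
    (hΛ : ∀ (a : Λ) (x : L.carrier), f (a • x) = a • f x)
    (hf : ∀ x, L'.red (f x) = L.red x) : Isomorphic L L' := by
  refine ⟨LinearEquiv.ofBijective f (bijective_of_red L L' f hf), hΛ, fun z => ?_⟩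
  obtain ⟨x, rfl⟩ := BaseChange.exists_one_tmul z
  exact hf x

theorem Isomorphic.exists_hom {L L' : ModuleLift Λ V R} (h : Isomorphic L L') :
    ∃ f : L.carrier →ₗ[R] L'.carrier, (∀ (a : Λ) (x : L.carrier), f (a • x) = a • f x) ∧
      ∀ x, L'.red (f x) = L.red x := by
  obtain ⟨f, hΛ, hf⟩ := h
  exact ⟨f.toLinearMap, hΛ, fun x => hf (BaseChange.tmul R.residue 1 x)⟩

theorem baseChange_red_tmul (α : R ⟶ S) (L : ModuleLift Λ V R) (s : S) (x : L.carrier) :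
    (L.baseChange α).red (BaseChange.tmul (CompleteLocalAlg.Hom.ringHom α) s x) =
      algebraMap k Λ (S.residue s) • L.red x := by
  refine (baseChange_reduction_tmul α L 1 s x).trans ?_
  rw [mul_one, reduction_tmul]

/-- Lifts over a ring with zero maximal ideal are all isomorphic. -/
theorem isomorphic_of_maximalIdeal_eq_bot (hR : IsLocalRing.maximalIdeal R = ⊥)
    (L L' : ModuleLift Λ V R) : Isomorphic L L' := by
  have hinj : ∀ {x y : L'.carrier}, L'.red x = L'.red y → x = y := fun {x y} h => by
    rw [← sub_eq_zero, ← map_sub, red_eq_zero_iff, hR, Submodule.bot_smul, Submodule.mem_bot,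
      sub_eq_zero] at h
    exact h
  choose f hf using fun x => L'.red_surjective (L.red x)
  refine Isomorphic.of_hom ⟨⟨f, fun x y => hinj ?_⟩, fun r x => hinj ?_⟩ (fun a x => hinj ?_) hf
  · rw [hf, map_add, map_add, hf, hf]
  · rw [RingHom.id_apply, hf, red_smul, red_smul, hf]
  · change L'.red (f (a • x)) = L'.red (a • f x)
    rw [hf, map_smul, map_smul, hf]

end ModuleLift

/-! ### Tensor products over noncommutative rings -/

/-- A finite projective module has a finite dual basis. -/
theorem exists_finite_dualBasis (A M : Type*) [Ring A] [AddCommGroup M] [Module A M]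
    [Module.Finite A M] [Module.Projective A M] :
    ∃ (n : ℕ) (x : Fin n → M) (f : Fin n → M →ₗ[A] A), ∀ z, ∑ i, f i z • x i = z := by
  obtain ⟨n, g, hg⟩ := Module.Finite.exists_fin' A M
  obtain ⟨s, hs⟩ := Module.projective_lifting_property g LinearMap.id hg
  refine ⟨n, fun i => g (Pi.single i 1), fun i => LinearMap.proj i ∘ₗ s, fun z => ?_⟩
  have h := LinearMap.congr_fun hs z
  rw [LinearMap.comp_apply, ← Finset.univ_sum_single (s z), map_sum] at h
  refine (Finset.sum_congr rfl fun i _ => ?_).trans h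
  rw [LinearMap.comp_apply, LinearMap.proj_apply, ← map_smul, ← Pi.single_smul, smul_eq_mul,
    mul_one]

namespace BalancedTensor

section Lift

variable (A : Type u) {M N : Type u} [Ring A] [AddCommGroup M] [Module Aᵐᵒᵖ M]
  [AddCommGroup N] [Module A N]

theorem zero_tmul (n : N) : tmul A (0 : M) n = 0 := by
  rw [tmul, TensorProduct.zero_tmul, map_zero]
  rfl

theorem tmul_zero (m : M) : tmul A m (0 : N) = 0 := by
  rw [tmul, TensorProduct.tmul_zero, map_zero]
  rfl

/-- The additive map out of `M ⊗_A N` induced by a balanced biadditive map. -/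
def lift {W : Type*} [AddCommGroup W] (f : M → N → W)
    (hl : ∀ m m' n, f (m + m') n = f m n + f m' n) (hr : ∀ m n n', f m (n + n') = f m n + f m n')
    (hb : ∀ m (a : A) n, f (op a • m) n = f m (a • n)) : BalancedTensor A M N →+ W :=
  let F : M →+ N →+ W := AddMonoidHom.mk' (fun m => AddMonoidHom.mk' (f m) (hr m))
    fun m m' => AddMonoidHom.ext fun n => hl m m' n
  ((balancedRelations A M N).liftQ
    (TensorProduct.liftAddHom (R := ℤ) F fun r m n => by
      rw [map_zsmul, map_zsmul, AddMonoidHom.coe_smul, Pi.smul_apply]).toIntLinearMap (by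
    rw [balancedRelations, Submodule.span_le]
    rintro _ ⟨m, a, n, rfl⟩
    rw [SetLike.mem_coe, LinearMap.mem_ker, map_sub, sub_eq_zero]
    exact hb m a n)).toAddMonoidHom

variable {A} in
theorem lift_tmul {W : Type*} [AddCommGroup W] (f : M → N → W)
    (hl : ∀ m m' n, f (m + m') n = f m n + f m' n) (hr : ∀ m n n', f m (n + n') = f m n + f m n')
    (hb : ∀ m (a : A) n, f (op a • m) n = f m (a • n)) (m : M) (n : N) :
    lift A f hl hr hb (tmul A m n) = f m n := rfl

variable {A} in
theorem addHom_ext {W : Type*} [AddCommGroup W] {f g : BalancedTensor A M N →+ W}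
    (h : ∀ m n, f (tmul A m n) = g (tmul A m n)) (z : BalancedTensor A M N) : f z = g z := by
  induction z using induction_on with
  | zero => rw [map_zero, map_zero]
  | tmul m n => exact h m n
  | add y z hy hz => rw [map_add, map_add, hy, hz]

end Lift

section Base

variable (A : Type u) {M N N' : Type u} [Ring A] [AddCommGroup M] [Module Aᵐᵒᵖ M]
  [AddCommGroup N] [Module A N] [AddCommGroup N'] [Module A N']
  {R : Type u} [CommRing R] [Module R N] [SMulCommClass A R N] [Module R N'] [SMulCommClass A R N']

/-- An action of a commutative ring `R` on `N` commuting with `A` induces one on `M ⊗_A N`. -/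
instance baseModule : Module R (BalancedTensor A M N) :=
  haveI : SMulCommClass R A N := SMulCommClass.symm A R N
  { smul := fun r => map A LinearMap.id (Module.toModuleEnd A N r)
    one_smul := addHom_ext (f := map A LinearMap.id (Module.toModuleEnd A N (1 : R)))
      (g := AddMonoidHom.id _) fun m n => congrArg (tmul A m) (one_smul R n)
    mul_smul := fun r s => addHom_ext
      (f := map A LinearMap.id (Module.toModuleEnd A N (r * s)))
      (g := (map A LinearMap.id (Module.toModuleEnd A N r)).comp
        (map A LinearMap.id (Module.toModuleEnd A N s)))
      fun m n => congrArg (tmul A m) (mul_smul r s n)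
    smul_zero := fun _ => map_zero _
    smul_add := fun _ => map_add _
    add_smul := fun r s => addHom_ext
      (f := map A LinearMap.id (Module.toModuleEnd A N (r + s)))
      (g := map A LinearMap.id (Module.toModuleEnd A N r) +
        map A LinearMap.id (Module.toModuleEnd A N s))
      fun m n => (congrArg (tmul A m) (add_smul r s n)).trans (tmul_add A m _ _)
    zero_smul := addHom_ext (f := map A LinearMap.id (Module.toModuleEnd A N (0 : R)))
      (g := 0) fun m n => (congrArg (tmul A m) (zero_smul R n)).trans (tmul_zero A m) }

theorem base_smul_tmul (r : R) (m : M) (n : N) : r • tmul A m n = tmul A m (r • n) := rfl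

instance {B : Type u} [Ring B] [Module B M] [SMulCommClass B Aᵐᵒᵖ M] :
    SMulCommClass B R (BalancedTensor A M N) where
  smul_comm b r z := by
    induction z using induction_on with
    | zero => simp
    | tmul m n => rw [base_smul_tmul, smul_tmul, smul_tmul, base_smul_tmul]
    | add y z hy hz => rw [smul_add, smul_add, hy, hz, smul_add, smul_add]

variable (M) (B : Type u) [Ring B] [Module B M] [SMulCommClass B Aᵐᵒᵖ M]

/-- The map `M ⊗_A g`. -/
def lTensor (g : N →ₗ[A] N') : BalancedTensor A M N →ₗ[B] BalancedTensor A M N' where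
  toFun := map A LinearMap.id g
  map_add' := map_add _
  map_smul' b z := by
    induction z using induction_on with
    | zero => simp
    | tmul m n => rw [smul_tmul, map_tmul, map_tmul, RingHom.id_apply, smul_tmul]; rfl
    | add y z hy hz => rw [smul_add, map_add, hy, hz, map_add, smul_add]

theorem lTensor_tmul (g : N →ₗ[A] N') (m : M) (n : N) :
    lTensor A M B g (tmul A m n) = tmul A m (g n) := rfl

theorem lTensor_base_smul (g : N →ₗ[A] N') (hg : ∀ (r : R) x, g (r • x) = r • g x) (r : R)
    (z : BalancedTensor A M N) : lTensor A M B g (r • z) = r • lTensor A M B g z := by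
  induction z using induction_on with
  | zero => simp
  | tmul m n => rw [base_smul_tmul, lTensor_tmul, lTensor_tmul, hg, base_smul_tmul]
  | add y z hy hz => rw [smul_add, map_add, hy, hz, map_add, smul_add]

theorem lTensor_lTensor {N'' : Type u} [AddCommGroup N''] [Module A N''] (g : N →ₗ[A] N')
    (h : N' →ₗ[A] N'') (z : BalancedTensor A M N) :
    lTensor A M B h (lTensor A M B g z) = lTensor A M B (h ∘ₗ g) z := by
  induction z using induction_on with
  | zero => simp
  | tmul m n => rfl
  | add y z hy hz => rw [map_add, map_add, map_add, hy, hz]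

theorem lTensor_surjective (g : N →ₗ[A] N') (hg : Function.Surjective g) :
    Function.Surjective (lTensor A M B g) := fun z => by
  induction z using induction_on with
  | zero => exact ⟨0, map_zero _⟩
  | tmul m n =>
    obtain ⟨n, rfl⟩ := hg n
    exact ⟨tmul A m n, rfl⟩
  | add y z hy hz =>
    obtain ⟨y, rfl⟩ := hy
    obtain ⟨z, rfl⟩ := hz
    exact ⟨y + z, map_add _ _ _⟩

end Base

section Coord

variable {A M : Type u} (N : Type u) {N' : Type u} [Ring A] [AddCommGroup M] [Module Aᵐᵒᵖ M]
  [AddCommGroup N] [Module A N] [AddCommGroup N'] [Module A N']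
  {R : Type u} [CommRing R] [Module R N] [SMulCommClass A R N]

/-- The map `M ⊗_A N → A ⊗_A N = N` induced by a linear form on `M`. -/
def coord (f : M →ₗ[Aᵐᵒᵖ] Aᵐᵒᵖ) : BalancedTensor A M N →+ N :=
  lift A (fun m n => unop (f m) • n) (fun m m' n => by rw [map_add, MulOpposite.unop_add, add_smul])
    (fun m n n' => smul_add _ _ _)
    (fun m a n => by rw [map_smul, smul_eq_mul, unop_mul, unop_op, mul_smul])

theorem coord_tmul (f : M →ₗ[Aᵐᵒᵖ] Aᵐᵒᵖ) (m : M) (n : N) :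
    coord N f (tmul A m n) = unop (f m) • n := rfl

variable {N}

theorem coord_lTensor (f : M →ₗ[Aᵐᵒᵖ] Aᵐᵒᵖ) (B : Type u) [Ring B] [Module B M]
    [SMulCommClass B Aᵐᵒᵖ M] (g : N →ₗ[A] N') (z : BalancedTensor A M N) :
    coord N' f (lTensor A M B g z) = g (coord N f z) := by
  induction z using induction_on with
  | zero => simp
  | tmul m n => rw [lTensor_tmul, coord_tmul, coord_tmul, map_smul]
  | add y z hy hz => rw [map_add, map_add, map_add, map_add, hy, hz]

theorem coord_base_smul (f : M →ₗ[Aᵐᵒᵖ] Aᵐᵒᵖ) (r : R) (z : BalancedTensor A M N) :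
    coord N f (r • z) = r • coord N f z := by
  induction z using induction_on with
  | zero => simp
  | tmul m n => rw [base_smul_tmul, coord_tmul, coord_tmul, smul_comm]
  | add y z hy hz => rw [smul_add, map_add, hy, hz, map_add, smul_add]

/-- The dual basis expansion of `M` passes to `M ⊗_A N`: the coordinates take values in `A ⊗_A N =
N`, and the basis vectors recombine them. -/
theorem sum_tmul_coord {n : ℕ} {x : Fin n → M} {f : Fin n → M →ₗ[Aᵐᵒᵖ] Aᵐᵒᵖ}
    (h : ∀ z, ∑ i, f i z • x i = z) (z : BalancedTensor A M N) :
    ∑ i, tmul A (x i) (coord N (f i) z) = z := by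
  induction z using induction_on with
  | zero => simp [tmul_zero]
  | tmul m l =>
    let F : M →+ BalancedTensor A M N :=
      AddMonoidHom.mk' (fun m => tmul A m l) fun m m' => add_tmul A m m' l
    have h1 : F (∑ i, f i m • x i) = F m := congrArg F (h m)
    rw [map_sum] at h1
    refine (Finset.sum_congr rfl fun i _ => ?_).trans h1
    rw [coord_tmul, ← op_smul_tmul, op_unop]
    rfl
  | add y z hy hz =>
    simp only [map_add, tmul_add, Finset.sum_add_distrib]
    rw [hy, hz]

end Coord

section Finite

variable (A M N : Type u) [Ring A] [AddCommGroup M] [Module Aᵐᵒᵖ M]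
  [AddCommGroup N] [Module A N] (R : Type u) [CommRing R] [Module R N] [SMulCommClass A R N]
  [Module.Finite Aᵐᵒᵖ M] [Module.Projective Aᵐᵒᵖ M]

/-- The two maps are the coordinates and the recombination along a dual basis of `M`. Finiteness and
freeness over `R` pass from `N` to `M ⊗_A N` through this retract. -/
theorem exists_retract : ∃ (n : ℕ) (i : BalancedTensor A M N →ₗ[R] (Fin n → N))
    (p : (Fin n → N) →ₗ[R] BalancedTensor A M N), p ∘ₗ i = LinearMap.id := by
  obtain ⟨n, x, f, h⟩ := exists_finite_dualBasis Aᵐᵒᵖ M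
  refine ⟨n, LinearMap.pi fun j => ⟨⟨coord N (f j), map_add _⟩, coord_base_smul (f j)⟩,
    ∑ j, (⟨⟨fun l => tmul A (x j) l, tmul_add A (x j)⟩, fun r l => ?_⟩ :
      N →ₗ[R] BalancedTensor A M N) ∘ₗ LinearMap.proj j, ?_⟩
  · rfl
  · ext z
    rw [LinearMap.comp_apply, LinearMap.sum_apply]
    exact sum_tmul_coord h z

theorem finite_base [Module.Finite R N] : Module.Finite R (BalancedTensor A M N) := by
  obtain ⟨n, i, p, h⟩ := exists_retract A M N R
  exact Module.Finite.of_surjective p fun z => ⟨i z, LinearMap.congr_fun h z⟩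

/-- A retract of a finite free module is finite projective, and over a local ring finite projective
modules are free. -/
theorem free_base [IsLocalRing R] [Module.Finite R N] [Module.Free R N] :
    Module.Free R (BalancedTensor A M N) := by
  obtain ⟨n, i, p, h⟩ := exists_retract A M N R
  haveI := Module.Projective.of_split i p h
  haveI := finite_base A M N R
  exact Module.free_of_flat_of_isLocalRing

end Finite

end BalancedTensor

/-! ### Tensoring lifts with a bimodule -/

namespace ModuleLift

open BalancedTensor

variable {k : Type u} [Field k] {Λ Γ : Type u} [Ring Λ] [Algebra k Λ] [Ring Γ] [Algebra k Γ]
  {V : Type u} [AddCommGroup V] [Module Λ V] {R S : CompleteLocalAlg k}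
  (X : Type u) [AddCommGroup X] [Module Γ X] [Module Λᵐᵒᵖ X] [SMulCommClass Γ Λᵐᵒᵖ X]
  [Module.Finite Λᵐᵒᵖ X] [Module.Projective Λᵐᵒᵖ X]
  (hX : ∀ (c : k) (x : X), algebraMap k Γ c • x = op (algebraMap k Λ c) • x)

/-- The lift `X ⊗_Λ L` of `X ⊗_Λ V`. -/
abbrev tensor (L : ModuleLift Λ V R) : ModuleLift Γ (BalancedTensor Λ X V) R :=
  haveI := finite_base Λ X L.carrier R
  haveI := free_base Λ X L.carrier R
  ofRed (BalancedTensor Λ X L.carrier)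
    (fun c z => by
      induction z using induction_on with
      | zero => simp
      | tmul x l => rw [smul_tmul, hX, op_smul_tmul, L.algebraMap_smul, base_smul_tmul]
      | add y z hy hz => rw [smul_add, smul_add, hy, hz])
    (lTensor Λ X Γ L.red)
    (fun r z => by
      induction z using induction_on with
      | zero => simp
      | tmul x l =>
        rw [base_smul_tmul, lTensor_tmul, lTensor_tmul, red_smul, smul_tmul, hX, op_smul_tmul]
      | add y z hy hz => rw [smul_add, map_add, map_add, smul_add, hy, hz])
    (lTensor_surjective Λ X Γ L.red L.red_surjective)
    (fun z hz => by
      -- Coordinates commute with the reduction, so an element of the kernel has all its coordinates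
      -- in `𝔪 L`. Recombining them along the dual basis stays in `𝔪 (X ⊗ L)`.
      obtain ⟨n, x, f, h⟩ := exists_finite_dualBasis Λᵐᵒᵖ X
      rw [← sum_tmul_coord h z]
      refine Submodule.sum_mem _ fun i _ => ?_
      have h1 : coord L.carrier (f i) z ∈
          IsLocalRing.maximalIdeal R • (⊤ : Submodule R L.carrier) := by
        rw [← red_eq_zero_iff, ← coord_lTensor (f i) Γ, hz, map_zero]
      let F : L.carrier →ₗ[R] BalancedTensor Λ X L.carrier :=
        ⟨⟨fun l => tmul Λ (x i) l, tmul_add Λ (x i)⟩, fun r l => rfl⟩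
      have h2 := Submodule.mem_map_of_mem (f := F) h1
      rw [Submodule.map_smul''] at h2
      exact Submodule.smul_mono le_rfl le_top h2)

theorem tensor_red (L : ModuleLift Λ V R) (z : BalancedTensor Λ X L.carrier) :
    (L.tensor X hX).red z = lTensor Λ X Γ L.red z :=
  haveI := finite_base Λ X L.carrier R
  haveI := free_base Λ X L.carrier R
  ofRed_red (BalancedTensor Λ X L.carrier) _ _ _ _ _ z

theorem Isomorphic.tensor {L L' : ModuleLift Λ V R} (h : Isomorphic L L') :
    Isomorphic (L.tensor X hX) (L'.tensor X hX) := by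
  obtain ⟨f, hf, hr⟩ := h.exists_hom
  let g : L.carrier →ₗ[Λ] L'.carrier := ⟨⟨f, map_add f⟩, hf⟩
  refine Isomorphic.of_hom ⟨⟨lTensor Λ X Γ g, map_add _⟩,
    lTensor_base_smul Λ X Γ g fun r x => map_smul f r x⟩
    (fun a z => map_smul (lTensor Λ X Γ g) a z) fun z => ?_
  refine (tensor_red X hX L' _).trans (Eq.trans ?_ (tensor_red X hX L z).symm)
  refine (lTensor_lTensor Λ X Γ g L'.red z).trans ?_
  congr 1
  exact congrArg _ (LinearMap.ext hr)

/-- The natural map is `s ⊗ (x ⊗ l) ↦ s (x ⊗ (1 ⊗ l))`. It is compatible with the reductions, which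
already makes it an isomorphism. This is the naturality of tensoring deformations. -/
theorem tensor_baseChange (α : R ⟶ S) (L : ModuleLift Λ V R) :
    Isomorphic ((L.tensor X hX).baseChange α) ((L.baseChange α).tensor X hX) := by
  let φ := CompleteLocalAlg.Hom.ringHom α
  let j : L.carrier →ₗ[Λ] BaseChange φ L.carrier :=
    ⟨⟨BaseChange.tmul φ 1, BaseChange.tmul_add φ 1⟩, fun a x => rfl⟩
  have hj : ∀ (r : R) x, j (r • x) = φ r • j x := fun r x =>
    (BaseChange.tmul_smul φ r 1 x).trans (BaseChange.smul_tmul φ (φ r) 1 x).symm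
  let g : BalancedTensor Λ X L.carrier →+ BalancedTensor Λ X (BaseChange φ L.carrier) :=
    (lTensor Λ X Γ j).toAddMonoidHom
  have hgt : ∀ x l, g (tmul Λ x l) = tmul Λ x (j l) := fun x l => rfl
  have hg : ∀ (r : R) z, g (r • z) = φ r • g z := fun r z => by
    induction z using induction_on with
    | zero => simp
    | tmul x l => rw [base_smul_tmul, hgt, hgt, hj, base_smul_tmul]
    | add y z hy hz => rw [smul_add, map_add, hy, hz, map_add, smul_add]
  let f : BaseChange φ (BalancedTensor Λ X L.carrier) →ₗ[S]
      BalancedTensor Λ X (BaseChange φ L.carrier) := BaseChange.lift φ g hg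
  have hft : ∀ s z, f (BaseChange.tmul φ s z) = s • g z := fun s z => rfl
  refine Isomorphic.of_hom f (fun a z => ?_) fun z => ?_
  · change f (a • z) = a • f z
    induction z using BaseChange.induction_on with
    | zero => simp
    | tmul s z =>
      refine (hft s (a • z)).trans ?_
      rw [hft]
      refine Eq.trans ?_ (smul_comm a s (g z)).symm
      exact congrArg (s • ·) (map_smul (lTensor Λ X Γ j) a z)
    | add y z hy hz => rw [smul_add, map_add, hy, hz, map_add, smul_add]
  · refine (tensor_red X hX _ _).trans ?_
    change lTensor Λ X Γ _ (f z) = _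
    induction z using BaseChange.induction_on with
    | zero => simp
    | tmul s z =>
      rw [hft, baseChange_red_tmul, tensor_red]
      induction z using induction_on with
      | zero => simp
      | tmul x l =>
        rw [hgt, base_smul_tmul, lTensor_tmul, red_smul, lTensor_tmul, BalancedTensor.smul_tmul, hX,
          op_smul_tmul]
        congr 2
        refine (baseChange_red_tmul α L 1 l).trans ?_
        rw [map_one, map_one, one_smul]
      | add y z hy hz => rw [map_add, smul_add, map_add, hy, hz, map_add, smul_add]
    | add y z hy hz => rw [map_add, map_add, hy, hz, map_add]

end ModuleLift

/-! ### Iterated tensor products with two bimodules -/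

namespace BalancedTensor

section Assoc

variable {Λ Γ X Y : Type u} (N : Type u) {N' : Type u} [Ring Λ] [Ring Γ]
  [AddCommGroup X] [Module Γ X] [Module Λᵐᵒᵖ X] [SMulCommClass Γ Λᵐᵒᵖ X]
  [AddCommGroup Y] [Module Λ Y] [Module Γᵐᵒᵖ Y] [SMulCommClass Λ Γᵐᵒᵖ Y]
  [AddCommGroup N] [Module Λ N] [AddCommGroup N'] [Module Λ N']

/-- The map `X → X ⊗_Λ N`, `x ↦ x ⊗ n`. -/
def tmulRight (Γ X : Type u) [Ring Γ] [AddCommGroup X] [Module Γ X] [Module Λᵐᵒᵖ X]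
    [SMulCommClass Γ Λᵐᵒᵖ X] {N : Type u} [AddCommGroup N] [Module Λ N] (n : N) :
    X →ₗ[Γ] BalancedTensor Λ X N where
  toFun x := tmul Λ x n
  map_add' x x' := add_tmul Λ x x' n
  map_smul' _ _ := rfl

variable {N}

/-- The element `y ⊗ (x ⊗ n)` of `Y ⊗_Γ (X ⊗_Λ N)`, as a function of `y ⊗ x` and `n`. -/
def assocTmul (z : BalancedTensor Γ Y X) (n : N) :
    BalancedTensor Γ Y (BalancedTensor Λ X N) :=
  lTensor Γ Y Λ (tmulRight Γ X n) z

theorem assocTmul_tmul (y : Y) (x : X) (n : N) :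
    assocTmul (tmul Γ y x) n = tmul Γ y (tmul Λ x n) := rfl

theorem assocTmul_add_left (z z' : BalancedTensor Γ Y X) (n : N) :
    assocTmul (Λ := Λ) (z + z') n = assocTmul z n + assocTmul z' n := map_add _ _ _

theorem assocTmul_zero_left (n : N) :
    assocTmul (Λ := Λ) (0 : BalancedTensor Γ Y X) n = 0 := map_zero _

theorem smul_assocTmul (a : Λ) (z : BalancedTensor Γ Y X) (n : N) :
    a • assocTmul (Λ := Λ) z n = assocTmul (a • z) n := (map_smul _ _ _).symm

theorem assocTmul_add_right (z : BalancedTensor Γ Y X) (n n' : N) :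
    assocTmul (Λ := Λ) z (n + n') = assocTmul z n + assocTmul z n' := by
  induction z using induction_on with
  | zero => simp only [assocTmul_zero_left, add_zero]
  | tmul y x => simp only [assocTmul_tmul, tmul_add]
  | add z z' h h' => simp only [assocTmul_add_left, h, h']; abel

theorem assocTmul_op_smul (b : Λ) (z : BalancedTensor Γ Y X) (n : N) :
    assocTmul (Λ := Λ) (op b • z) n = assocTmul z (b • n) := by
  induction z using induction_on with
  | zero => simp only [smul_zero, assocTmul_zero_left]
  | tmul y x => rw [op_smul_tmul', assocTmul_tmul, assocTmul_tmul, op_smul_tmul]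
  | add z z' h h' => rw [smul_add, assocTmul_add_left, assocTmul_add_left, h, h']

theorem assocTmul_base_smul {R : Type u} [CommRing R] [Module R N] [SMulCommClass Λ R N] (r : R)
    (z : BalancedTensor Γ Y X) (n : N) :
    assocTmul (Λ := Λ) z (r • n) = r • assocTmul z n := by
  induction z using induction_on with
  | zero => simp only [smul_zero, assocTmul_zero_left]
  | tmul y x => rfl
  | add z z' h h' => rw [assocTmul_add_left, assocTmul_add_left, h, h', smul_add]

theorem assoc_induction {p : BalancedTensor Γ Y (BalancedTensor Λ X N) → Prop}
    (t : BalancedTensor Γ Y (BalancedTensor Λ X N)) (zero : p 0)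
    (assocTmul : ∀ z n, p (assocTmul z n)) (add : ∀ s t, p s → p t → p (s + t)) : p t := by
  induction t using induction_on with
  | zero => exact zero
  | tmul y z =>
    induction z using induction_on with
    | zero => rw [tmul_zero]; exact zero
    | tmul x n => exact assocTmul (tmul Γ y x) n
    | add z z' h h' => rw [tmul_add]; exact add _ _ h h'
  | add s t hs ht => exact add _ _ hs ht

/-- The additive map out of `Y ⊗_Γ (X ⊗_Λ N)` induced by a balanced biadditive map on
`(Y ⊗_Γ X) × N`. -/
def assocLift {W : Type*} [AddCommGroup W] (G : BalancedTensor Γ Y X → N → W)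
    (hl : ∀ z z' n, G (z + z') n = G z n + G z' n) (hr : ∀ z n n', G z (n + n') = G z n + G z n')
    (hb : ∀ z (b : Λ) n, G (op b • z) n = G z (b • n)) :
    BalancedTensor Γ Y (BalancedTensor Λ X N) →+ W :=
  lift Γ (fun y t => lift Λ (fun x n => G (tmul Γ y x) n)
      (fun x x' n => by rw [tmul_add, hl]) (fun x n n' => hr _ _ _)
      (fun x a n => by rw [← op_smul_tmul', hb]) t)
    (fun y y' t => by
      induction t using induction_on with
      | zero => simp only [map_zero, add_zero]
      | tmul x n => rw [lift_tmul, lift_tmul, lift_tmul, add_tmul, hl]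
      | add s t hs ht => rw [map_add, map_add, map_add, hs, ht]; abel)
    (fun y t t' => map_add _ _ _)
    (fun y c t => by
      induction t using induction_on with
      | zero => simp only [map_zero, smul_zero]
      | tmul x n => rw [smul_tmul, lift_tmul, lift_tmul, op_smul_tmul]
      | add s t hs ht => rw [smul_add, map_add, map_add, hs, ht])

theorem assocLift_assocTmul {W : Type*} [AddCommGroup W] (G : BalancedTensor Γ Y X → N → W)
    (hl : ∀ z z' n, G (z + z') n = G z n + G z' n) (hr : ∀ z n n', G z (n + n') = G z n + G z n')
    (hb : ∀ z (b : Λ) n, G (op b • z) n = G z (b • n)) (z : BalancedTensor Γ Y X) (n : N) :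
    assocLift G hl hr hb (assocTmul z n) = G z n := by
  induction z using induction_on with
  | zero =>
    rw [assocTmul_zero_left, map_zero]
    have h := hl 0 0 n
    rw [add_zero] at h
    exact (left_eq_add.1 h).symm
  | tmul y x => rfl
  | add z z' h h' => rw [assocTmul_add_left, map_add, h, h', hl]

variable (X Y) (Γ)

/-- The map `Y ⊗_Γ (X ⊗_Λ g)`. -/
abbrev lTensor₂ (g : N →ₗ[Λ] N') : BalancedTensor Γ Y (BalancedTensor Λ X N) →ₗ[Λ]
    BalancedTensor Γ Y (BalancedTensor Λ X N') :=
  lTensor Γ Y Λ (lTensor Λ X Γ g)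

theorem lTensor₂_assocTmul (g : N →ₗ[Λ] N') (z : BalancedTensor Γ Y X) (n : N) :
    lTensor₂ Γ X Y g (assocTmul z n) = assocTmul z (g n) := by
  induction z using induction_on with
  | zero => simp only [assocTmul_zero_left, map_zero]
  | tmul y x => rfl
  | add z z' h h' => rw [assocTmul_add_left, assocTmul_add_left, map_add, h, h']

end Assoc

end BalancedTensor

open BalancedTensor in
/-- Bimodule maps `Λ → Y ⊗_Γ X → Λ` composing to the identity; the first is given by the image
of `1`. -/
structure BimoduleSplitting (Λ Γ X Y : Type u) [Ring Λ] [Ring Γ]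
    [AddCommGroup X] [Module Γ X] [Module Λᵐᵒᵖ X] [SMulCommClass Γ Λᵐᵒᵖ X]
    [AddCommGroup Y] [Module Λ Y] [Module Γᵐᵒᵖ Y] [SMulCommClass Λ Γᵐᵒᵖ Y] where
  /-- the bimodule map `Y ⊗_Γ X → Λ` -/
  proj : BalancedTensor Γ Y X →+ Λ
  proj_smul : ∀ (a : Λ) z, proj (a • z) = a * proj z
  proj_op_smul : ∀ (b : Λ) z, proj (op b • z) = proj z * b
  /-- the image of `1` in `Y ⊗_Γ X` -/
  unit : BalancedTensor Γ Y X
  unit_comm : ∀ a : Λ, a • unit = op a • unit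
  proj_unit : proj unit = 1

/-! ### The functorial splitting of `N` off `Y ⊗_Γ (X ⊗_Λ N)` -/

namespace BimoduleSplitting

open BalancedTensor

variable {Λ Γ X Y : Type u} [Ring Λ] [Ring Γ]
  [AddCommGroup X] [Module Γ X] [Module Λᵐᵒᵖ X] [SMulCommClass Γ Λᵐᵒᵖ X]
  [AddCommGroup Y] [Module Λ Y] [Module Γᵐᵒᵖ Y] [SMulCommClass Λ Γᵐᵒᵖ Y]
  (D : BimoduleSplitting Λ Γ X Y)
  (N : Type u) {N' : Type u} [AddCommGroup N] [Module Λ N] [AddCommGroup N'] [Module Λ N']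

/-- The natural map `N → Y ⊗_Γ (X ⊗_Λ N)`. -/
def incl : N →ₗ[Λ] BalancedTensor Γ Y (BalancedTensor Λ X N) where
  toFun n := assocTmul D.unit n
  map_add' := assocTmul_add_right D.unit
  map_smul' a n := by
    rw [← assocTmul_op_smul, ← D.unit_comm, ← smul_assocTmul, RingHom.id_apply]

theorem incl_apply (n : N) : D.incl N n = assocTmul D.unit n := rfl

/-- The natural map `Y ⊗_Γ (X ⊗_Λ N) → N`, as an additive map. -/
def retrAddHom : BalancedTensor Γ Y (BalancedTensor Λ X N) →+ N :=
  assocLift (fun z n => D.proj z • n) (fun z z' n => by rw [map_add, add_smul])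
    (fun z n n' => smul_add _ _ _) (fun z b n => by rw [D.proj_op_smul, mul_smul])

theorem retrAddHom_assocTmul (z : BalancedTensor Γ Y X) (n : N) :
    D.retrAddHom N (assocTmul z n) = D.proj z • n :=
  assocLift_assocTmul _ _ _ _ _ _

/-- The natural map `Y ⊗_Γ (X ⊗_Λ N) → N`. -/
def retr : BalancedTensor Γ Y (BalancedTensor Λ X N) →ₗ[Λ] N where
  toFun := D.retrAddHom N
  map_add' := map_add _
  map_smul' a t := by
    rw [RingHom.id_apply]
    induction t using assoc_induction with
    | zero => rw [smul_zero, map_zero, smul_zero]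
    | assocTmul z n =>
      rw [smul_assocTmul, retrAddHom_assocTmul, retrAddHom_assocTmul, D.proj_smul, mul_smul]
    | add s t hs ht => rw [smul_add, map_add, hs, ht, map_add, smul_add]

theorem retr_assocTmul (z : BalancedTensor Γ Y X) (n : N) :
    D.retr N (assocTmul z n) = D.proj z • n :=
  D.retrAddHom_assocTmul N z n

theorem retr_incl (n : N) : D.retr N (D.incl N n) = n := by
  rw [incl_apply, retr_assocTmul, D.proj_unit, one_smul]

variable {N}

/-- Naturality of `incl` and `retr`, applied to the reduction map, compares the splitting for a lift
`L` with the splitting for `V`. -/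
theorem lTensor₂_incl (g : N →ₗ[Λ] N') (n : N) :
    lTensor₂ Γ X Y g (D.incl N n) = D.incl N' (g n) :=
  lTensor₂_assocTmul Γ X Y g D.unit n

theorem retr_lTensor₂ (g : N →ₗ[Λ] N') (t : BalancedTensor Γ Y (BalancedTensor Λ X N)) :
    D.retr N' (lTensor₂ Γ X Y g t) = g (D.retr N t) := by
  induction t using assoc_induction with
  | zero => simp only [map_zero]
  | assocTmul z n => rw [lTensor₂_assocTmul, retr_assocTmul, retr_assocTmul, map_smul]
  | add s t hs ht => rw [map_add, map_add, hs, ht, map_add, map_add]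

variable {R : Type u} [CommRing R] [Module R N] [SMulCommClass Λ R N]

theorem incl_base_smul (r : R) (n : N) : D.incl N (r • n) = r • D.incl N n :=
  assocTmul_base_smul r D.unit n

theorem retr_base_smul (r : R) (t : BalancedTensor Γ Y (BalancedTensor Λ X N)) :
    D.retr N (r • t) = r • D.retr N t := by
  induction t using assoc_induction with
  | zero => simp only [map_zero, smul_zero]
  | assocTmul z n => rw [← assocTmul_base_smul, retr_assocTmul, retr_assocTmul, smul_comm]
  | add s t hs ht => rw [smul_add, map_add, hs, ht, map_add, smul_add]

end BimoduleSplitting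

/-! ### Recovering a lift from its double tensor product -/

namespace ModuleLift

open BalancedTensor

variable {k : Type u} [Field k] {Λ Γ : Type u} [Ring Λ] [Algebra k Λ] [Ring Γ] [Algebra k Γ]
  {V : Type u} [AddCommGroup V] [Module Λ V] {R : CompleteLocalAlg k}
  (X : Type u) [AddCommGroup X] [Module Γ X] [Module Λᵐᵒᵖ X] [SMulCommClass Γ Λᵐᵒᵖ X]
  [Module.Finite Λᵐᵒᵖ X] [Module.Projective Λᵐᵒᵖ X]
  (hX : ∀ (c : k) (x : X), algebraMap k Γ c • x = op (algebraMap k Λ c) • x)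
  (Y : Type u) [AddCommGroup Y] [Module Λ Y] [Module Γᵐᵒᵖ Y] [SMulCommClass Λ Γᵐᵒᵖ Y]
  [Module.Finite Γᵐᵒᵖ Y] [Module.Projective Γᵐᵒᵖ Y]
  (hY : ∀ (c : k) (y : Y), algebraMap k Λ c • y = op (algebraMap k Γ c) • y)

theorem tensor_tensor_red (L : ModuleLift Λ V R)
    (z : BalancedTensor Γ Y (BalancedTensor Λ X L.carrier)) :
    ((L.tensor X hX).tensor Y hY).red z = lTensor₂ Γ X Y L.red z := by
  refine (tensor_red Y hY (L.tensor X hX) z).trans ?_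
  congr 1
  exact congrArg _ (LinearMap.ext fun t => tensor_red X hX L t)

/-- Tensoring with `X` reflects isomorphism of lifts if tensoring with `Y` splits it. -/
theorem Isomorphic.of_tensor_tensor (D : BimoduleSplitting Λ Γ X Y) {L L' : ModuleLift Λ V R}
    (h : Isomorphic ((L.tensor X hX).tensor Y hY) ((L'.tensor X hX).tensor Y hY)) :
    Isomorphic L L' := by
  obtain ⟨f, hf, hr⟩ := h.exists_hom
  let F : BalancedTensor Γ Y (BalancedTensor Λ X L.carrier) →ₗ[R]
    BalancedTensor Γ Y (BalancedTensor Λ X L'.carrier) := f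
  have hF : ∀ (a : Λ) z, F (a • z) = a • F z := hf
  have hFr : ∀ z, lTensor₂ Γ X Y L'.red (F z) = lTensor₂ Γ X Y L.red z := fun z => by
    rw [← tensor_tensor_red X hX Y hY, ← tensor_tensor_red X hX Y hY]
    exact hr z
  -- The composite `retr ∘ F ∘ incl` reduces to `retr ∘ incl = id` on `V`, because `F` reduces to
  -- the identity of `Y ⊗ X ⊗ V`. Nothing more is needed for it to be an isomorphism of lifts.
  refine Isomorphic.of_hom
    ⟨⟨fun x => D.retr _ (F (D.incl _ x)), fun x y => by simp only [map_add]⟩, fun r x => ?_⟩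
    (fun a x => ?_) fun x => ?_
  · change D.retr _ (F (D.incl _ (r • x))) = r • D.retr _ (F (D.incl _ x))
    rw [D.incl_base_smul, map_smul, D.retr_base_smul]
  · change D.retr _ (F (D.incl _ (a • x))) = a • D.retr _ (F (D.incl _ x))
    rw [map_smul, hF, map_smul]
  · change L'.red (D.retr _ (F (D.incl _ x))) = _
    rw [← D.retr_lTensor₂, hFr, D.lTensor₂_incl, D.retr_incl]

end ModuleLift

/-! ### Self-injective algebras and lifting of maps that factor through a free module -/

/-- The coinduced module `Hom_k(Λ, Λ)`, on which `Λ` acts by `(a f)(x) = f(x a)`. -/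
def Coinduced (k Λ : Type u) [Field k] [Ring Λ] [Algebra k Λ] : Type u := Λ →ₗ[k] Λ

namespace Coinduced

variable {k Λ : Type u} [Field k] [Ring Λ] [Algebra k Λ]

instance : AddCommGroup (Coinduced k Λ) := inferInstanceAs (AddCommGroup (Λ →ₗ[k] Λ))

instance : Module Λ (Coinduced k Λ) where
  smul a f := LinearMap.comp (M₂ := Λ) (show Λ →ₗ[k] Λ from f) (LinearMap.mulRight k a)
  one_smul f := LinearMap.ext fun x => congrArg (show Λ →ₗ[k] Λ from f) (mul_one x)
  mul_smul a b f := LinearMap.ext fun x =>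
    congrArg (show Λ →ₗ[k] Λ from f) (mul_assoc x a b).symm
  smul_zero _ := rfl
  smul_add _ _ _ := rfl
  add_smul a b f := LinearMap.ext fun x => by
    refine (congrArg (show Λ →ₗ[k] Λ from f) (mul_add x a b)).trans ?_
    exact map_add (show Λ →ₗ[k] Λ from f) _ _
  zero_smul f := LinearMap.ext fun x => by
    refine (congrArg (show Λ →ₗ[k] Λ from f) (mul_zero x)).trans ?_
    exact map_zero (show Λ →ₗ[k] Λ from f)

variable (k Λ) in
/-- The embedding of `Λ` into the coinduced module. -/
def embed : Λ →ₗ[Λ] Coinduced k Λ where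
  toFun a := LinearMap.mulRight k a
  map_add' a b := LinearMap.ext fun x => mul_add x a b
  map_smul' a b := LinearMap.ext fun x => (mul_assoc x a b).symm

theorem embed_injective : Function.Injective (embed k Λ) := fun a b h => by
  have h1 : (1 : Λ) * a = 1 * b := LinearMap.congr_fun (f := LinearMap.mulRight k a) h 1
  rwa [one_mul, one_mul] at h1

end Coinduced

/-- In a self-injective algebra with `k`-basis `b` there are elements `d i c` such that
`∑ b i ⊗ d i c` satisfies the Casimir identity `∑ b i * a ⊗ d i c = ∑ b i ⊗ a * d i c`, and such
that every linear form `α` is recovered as a combination of traces of its coordinates. -/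
theorem exists_casimir {k Λ : Type u} [Field k] [Ring Λ] [Algebra k Λ] [Module.Injective Λ Λ]
    {ι : Type*} [Fintype ι] (b : Module.Basis ι k Λ) :
    ∃ d : ι → Λ → Λ,
      (∀ (a c : Λ) (i : ι), a * d i c = ∑ l, b.repr (b l * a) i • d l c) ∧
      ∀ (V : Type u) [AddCommGroup V] [Module Λ V] (α : V →ₗ[Λ] Λ) (v : V),
        α v = ∑ t, ∑ i, b.repr (α (b i • v)) t • d i (b t) := by
  -- Self-injectivity enters here: `a ↦ (x ↦ x a)` is a `Λ`-linear embedding into the coinduced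
  -- module, so it has a `Λ`-linear retraction `π`.
  obtain ⟨π, hπ⟩ := Module.Injective.out (Coinduced.embed k Λ) Coinduced.embed_injective
    LinearMap.id
  -- These are the rank one maps `x ↦ bᵢ*(x) c`. The witness `d i c` is the image of `E i c` under
  -- `π`.
  let E : ι → Λ → (Λ →ₗ[k] Λ) := fun i c => (b.coord i).smulRight c
  let π' : (Λ →ₗ[k] Λ) →+ Λ := π.toAddMonoidHom
  have hk : ∀ (c : k) (f : Λ →ₗ[k] Λ), π' (c • f) = c • π' f := fun c f => by
    refine Eq.trans ?_ ((LinearMap.map_smul π (algebraMap k Λ c) f).trans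
      (Algebra.smul_def c (π' f)).symm)
    refine congrArg π (LinearMap.ext fun x => ?_)
    change c • f x = f (x * algebraMap k Λ c)
    rw [← Algebra.commutes, ← Algebra.smul_def, map_smul]
  have hexp : ∀ f : Λ →ₗ[k] Λ, f = ∑ i, E i (f (b i)) := fun f => b.ext fun j => by
    classical
    rw [LinearMap.sum_apply, Finset.sum_eq_single j]
    · simp [E]
    · intro i _ hij
      simp [E, Finsupp.single_eq_of_ne hij]
    · simp
  have hEc : ∀ i c, E i c = ∑ t, b.repr c t • E i (b t) := fun i c => LinearMap.ext fun x => by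
    simp only [E, LinearMap.sum_apply, LinearMap.smul_apply, LinearMap.smulRight_apply]
    conv_lhs => rw [← b.sum_repr c, Finset.smul_sum]
    exact Finset.sum_congr rfl fun t _ => smul_comm _ _ _
  refine ⟨fun i c => π' (E i c), fun a c i => ?_, fun V _ _ α v => ?_⟩
  -- Linearity of `π` moves `a` inside. The map `x ↦ bᵢ*(x a) c` is then expanded through its values
  -- on the basis, `b_l` going to `bᵢ*(b_l a) c`.
  · have h1 : a * π' (E i c) = π' ((E i c).comp (LinearMap.mulRight k a)) :=
      (LinearMap.map_smul π a (E i c)).symm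
    rw [h1, hexp ((E i c).comp (LinearMap.mulRight k a)), map_sum]
    refine Finset.sum_congr rfl fun l _ => ?_
    rw [← hk]
    refine congrArg π' (LinearMap.ext fun x => ?_)
    exact smul_comm (b.coord l x) (b.coord i (b l * a)) c
  -- Right multiplication by `α v` sends `bᵢ` to `bᵢ α(v) = α(bᵢ v)`. Expanding it in the maps `E i
  -- (b t)` and applying `π` gives the trace formula.
  · have h1 : π' (LinearMap.mulRight k (α v)) = α v := hπ (α v)
    rw [← h1, hexp (LinearMap.mulRight k (α v)), map_sum, Finset.sum_comm]
    refine Finset.sum_congr rfl fun i _ => ?_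
    rw [hEc, map_sum]
    refine Finset.sum_congr rfl fun t _ => ?_
    rw [hk]
    congr 3
    exact (map_smul α (b i) v).symm

/-- Semilinear maps out of a free module lift along semilinear surjections. -/
theorem exists_linearMap_of_semilinear {R L L' W : Type*} [CommRing R] [AddCommGroup L]
    [Module R L] [Module.Free R L] [AddCommGroup L'] [Module R L'] [AddCommGroup W]
    (T : R → W → W) (ρ : L' →+ W) (hρ : ∀ r y, ρ (r • y) = T r (ρ y))
    (hs : Function.Surjective ρ) (h : L →+ W) (hh : ∀ r x, h (r • x) = T r (h x)) :
    ∃ f : L →ₗ[R] L', ∀ x, ρ (f x) = h x := by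
  let b := Module.Free.chooseBasis R L
  choose s hs using hs
  let f := b.constr ℕ fun i => s (h (b i))
  refine ⟨f, fun x => ?_⟩
  have hx : x ∈ Submodule.span R (Set.range b) := b.span_eq ▸ Submodule.mem_top
  induction hx using Submodule.span_induction with
  | mem x hx =>
    obtain ⟨i, rfl⟩ := hx
    rw [b.constr_basis, hs]
  | zero => simp only [map_zero]
  | add x y _ _ hx hy => rw [map_add, map_add, map_add, hx, hy]
  | smul r x _ hx => rw [map_smul, hρ, hx, hh]

namespace ModuleLift

variable {k : Type u} [Field k] {Λ : Type u} [Ring Λ] [Algebra k Λ]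
  {V₁ V₂ : Type u} [AddCommGroup V₁] [Module Λ V₁] [AddCommGroup V₂] [Module Λ V₂]
  {R : CompleteLocalAlg k}

/-- Over a self-injective algebra, a map that factors through a finite free module lifts to any
lifts of its source and target. -/
theorem exists_hom_lifting [Module.Finite k Λ] [Module.Injective Λ Λ]
    (M₁ : ModuleLift Λ V₁ R) (M₂ : ModuleLift Λ V₂ R) {ι : Type*} [Fintype ι]
    (α : ι → V₁ →ₗ[Λ] Λ) (w : ι → V₂) :
    ∃ f : M₁.carrier →ₗ[R] M₂.carrier, (∀ (a : Λ) x, f (a • x) = a • f x) ∧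
      ∀ x, M₂.red (f x) = ∑ s, α s (M₁.red x) • w s := by
  let b := Module.finBasis k Λ
  obtain ⟨d, hd, hα⟩ := exists_casimir b
  haveI hcomm : ∀ M : ModuleLift Λ V₂ R, SMulCommClass R Λ M.carrier :=
    fun M => SMulCommClass.symm Λ R M.carrier
  -- Each `k`-linear form `b_t* ∘ α_s` on `V₁` lifts to an `R`-linear form on the free module `M₁`.
  -- No `Λ`-linearity is asked of it.
  have hγ : ∀ s t, ∃ γ : M₁.carrier →ₗ[R] R,
      ∀ x, R.residue (γ x) = b.repr (α s (M₁.red x)) t := fun s t =>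
    exists_linearMap_of_semilinear (fun r c => R.residue r * c) R.residue.toAddMonoidHom
      (fun r y => map_mul R.residue r y) R.residue_surjective
      (AddMonoidHom.mk' (fun x => b.repr (α s (M₁.red x)) t) fun x y => by simp)
      (fun r x => by
        change b.repr (α s (M₁.red (r • x))) t = _
        rw [red_smul, map_smul, smul_eq_mul, ← Algebra.smul_def]
        simp)
  choose γ hγ using hγ
  choose w' hw' using fun s => M₂.red_surjective (w s)
  let act : Λ → M₁.carrier →ₗ[R] M₁.carrier := fun a => Module.toModuleEnd R M₁.carrier a
  -- The trace formula for `α`, with the `k`-linear forms and the vectors `w s` replaced by lifts.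
  -- It is `Λ`-linear by the Casimir identity and reduces to the prescribed map by the formula
  -- itself.
  let f : M₁.carrier →ₗ[R] M₂.carrier :=
    ∑ s, ∑ t, ∑ i, (γ s t ∘ₗ act (b i)).smulRight (d i (b t) • w' s)
  have hf : ∀ x, f x = ∑ s, ∑ t, ∑ i, γ s t (b i • x) • d i (b t) • w' s := fun x => by
    simp only [f, LinearMap.sum_apply, LinearMap.smulRight_apply]
    rfl
  have hk : ∀ (s t) (c : k) (y : M₁.carrier),
      γ s t ((c • (1 : Λ)) • y) = algebraMap k R c * γ s t y := fun s t c y => by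
    rw [← Algebra.algebraMap_eq_smul_one, M₁.algebraMap_smul, map_smul, smul_eq_mul]
  refine ⟨f, fun a x => ?_, fun x => ?_⟩
  · rw [hf, hf, Finset.smul_sum]
    refine Finset.sum_congr rfl fun s _ => ?_
    rw [Finset.smul_sum]
    refine Finset.sum_congr rfl fun t _ => ?_
    rw [Finset.smul_sum]
    -- Both sides of `f (a x) = a f(x)` become the same double sum: the left by expanding `b_l a` in
    -- the basis, the right by the Casimir identity for `a * d i (b t)`.
    have h1 : ∀ l, γ s t (b l • a • x) • d l (b t) • w' s =
        ∑ i, (algebraMap k R (b.repr (b l * a) i) * γ s t (b i • x)) • d l (b t) • w' s :=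
      fun l => by
        rw [← Finset.sum_smul]
        congr 1
        rw [← mul_smul]
        conv_lhs => rw [← b.sum_repr (b l * a), Finset.sum_smul, map_sum]
        refine Finset.sum_congr rfl fun i _ => ?_
        rw [← hk, ← mul_smul, smul_mul_assoc, one_mul]
    have h2 : ∀ i, a • γ s t (b i • x) • d i (b t) • w' s =
        ∑ l, (algebraMap k R (b.repr (b l * a) i) * γ s t (b i • x)) • d l (b t) • w' s :=
      fun i => by
        rw [smul_comm, ← mul_smul a, hd, Finset.sum_smul, Finset.smul_sum]
        refine Finset.sum_congr rfl fun l _ => ?_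
        rw [Algebra.smul_def, mul_smul, M₂.algebraMap_smul, ← mul_smul, mul_comm]
    rw [Finset.sum_congr rfl fun l _ => h1 l, Finset.sum_congr rfl fun i _ => h2 i,
      Finset.sum_comm]
  · rw [hf, map_sum]
    refine Finset.sum_congr rfl fun s _ => ?_
    rw [hα V₁ (α s) (M₁.red x), map_sum, Finset.sum_smul]
    refine Finset.sum_congr rfl fun t _ => ?_
    rw [map_sum, Finset.sum_smul]
    refine Finset.sum_congr rfl fun i _ => ?_
    rw [red_smul, hγ, LinearMap.map_smul M₁.red, LinearMap.map_smul M₂.red, hw', Algebra.smul_def, mul_smul]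

end ModuleLift

/-! ### Bimodules of the form `Λ ⊕ P` with `P` projective -/

namespace IsRegularPlusProjective

open BalancedTensor

variable {k Λ Γ X Y : Type u} [Field k] [Ring Λ] [Algebra k Λ] [Ring Γ]
  [AddCommGroup X] [Module Γ X] [Module Λᵐᵒᵖ X] [SMulCommClass Γ Λᵐᵒᵖ X]
  [AddCommGroup Y] [Module Λ Y] [Module Γᵐᵒᵖ Y] [SMulCommClass Λ Γᵐᵒᵖ Y]

/-! ### `Λ`-valued forms coming from bimodule maps to `Λ ⊗ Λᵒᵖ` -/

section Trace

variable {V : Type u} [AddCommGroup V] [Module Λ V] [Module k V] [IsScalarTower k Λ V]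

/-- The map `Λ ⊗ Λᵒᵖ → Λ`, `a ⊗ c ↦ γ(c v) a`. -/
def evalForm (γ : V →ₗ[k] k) (v : V) : Λ ⊗[k] Λᵐᵒᵖ →ₗ[k] Λ :=
  TensorProduct.lift (LinearMap.mk₂ k (fun (a : Λ) (c : Λᵐᵒᵖ) => γ (unop c • v) • a)
    (fun a a' c => smul_add _ _ _) (fun r a c => smul_comm _ _ _)
    (fun a c c' => by rw [MulOpposite.unop_add, add_smul, map_add, add_smul])
    (fun r a c => by rw [MulOpposite.unop_smul, smul_assoc, map_smul, smul_assoc]))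

theorem evalForm_tmul (γ : V →ₗ[k] k) (v : V) (a : Λ) (c : Λᵐᵒᵖ) :
    evalForm γ v (a ⊗ₜ c) = γ (unop c • v) • a := rfl

theorem evalForm_add (γ : V →ₗ[k] k) (v v' : V) (t : Λ ⊗[k] Λᵐᵒᵖ) :
    evalForm γ (v + v') t = evalForm γ v t + evalForm γ v' t := by
  induction t using TensorProduct.induction_on with
  | zero => simp only [map_zero, add_zero]
  | tmul a c => rw [evalForm_tmul, smul_add, map_add, add_smul]; rfl
  | add s t hs ht => rw [map_add, map_add, map_add, hs, ht]; abel

theorem evalForm_left_mul (γ : V →ₗ[k] k) (v : V) (a : Λ) (t : Λ ⊗[k] Λᵐᵒᵖ) :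
    evalForm γ v ((a ⊗ₜ 1) * t) = a * evalForm γ v t := by
  induction t using TensorProduct.induction_on with
  | zero => simp only [map_zero, mul_zero]
  | tmul b c =>
    rw [Algebra.TensorProduct.tmul_mul_tmul, one_mul, evalForm_tmul, evalForm_tmul,
      mul_smul_comm]
  | add s t hs ht => rw [mul_add, map_add, map_add, hs, ht, mul_add]

/-- This balancing lets the form descend to `(Λ ⊗ Λᵒᵖ) ⊗_Λ V`, which is `Λ ⊗_k V`. There it is the
application of `γ` to the second factor. -/
theorem evalForm_right_mul (γ : V →ₗ[k] k) (v : V) (b : Λ) (t : Λ ⊗[k] Λᵐᵒᵖ) :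
    evalForm γ v ((1 ⊗ₜ op b) * t) = evalForm γ (b • v) t := by
  induction t using TensorProduct.induction_on with
  | zero => simp only [map_zero, mul_zero]
  | tmul a c =>
    rw [Algebra.TensorProduct.tmul_mul_tmul, one_mul, evalForm_tmul, evalForm_tmul, unop_mul,
      unop_op, mul_smul]
  | add s t hs ht => rw [mul_add, map_add, map_add, hs, ht]

/-- The linear form on `Y ⊗_Γ (X ⊗_Λ V)` induced by a bimodule map `Y ⊗_Γ X → Λ ⊗ Λᵒᵖ` and a
linear form on `V`. -/
def assocForm (h : BalancedTensor Γ Y X →+ Λ ⊗[k] Λᵐᵒᵖ)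
    (hl : ∀ (a : Λ) z, h (a • z) = (a ⊗ₜ 1) * h z)
    (hr : ∀ (b : Λ) z, h (op b • z) = (1 ⊗ₜ op b) * h z) (γ : V →ₗ[k] k) :
    BalancedTensor Γ Y (BalancedTensor Λ X V) →ₗ[Λ] Λ :=
  let F : BalancedTensor Γ Y (BalancedTensor Λ X V) →+ Λ :=
    assocLift (fun z v => evalForm γ v (h z)) (fun z z' v => by rw [map_add, map_add])
      (fun z v v' => evalForm_add γ v v' (h z))
      (fun z b v => by rw [hr, evalForm_right_mul])
  { toFun := F
    map_add' := map_add F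
    map_smul' := fun a t => by
      rw [RingHom.id_apply]
      induction t using assoc_induction with
      | zero => rw [smul_zero, map_zero, smul_zero]
      | assocTmul z v =>
        have hF : ∀ z v, F (assocTmul z v) = evalForm γ v (h z) := fun z v =>
          assocLift_assocTmul _ _ _ _ z v
        rw [smul_assocTmul, hF, hF, hl, evalForm_left_mul, smul_eq_mul]
      | add s t hs ht => rw [smul_add, map_add, hs, ht, map_add, smul_add] }

theorem assocForm_assocTmul (h : BalancedTensor Γ Y X →+ Λ ⊗[k] Λᵐᵒᵖ)
    (hl : ∀ (a : Λ) z, h (a • z) = (a ⊗ₜ 1) * h z)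
    (hr : ∀ (b : Λ) z, h (op b • z) = (1 ⊗ₜ op b) * h z) (γ : V →ₗ[k] k)
    (z : BalancedTensor Γ Y X) (v : V) :
    assocForm h hl hr γ (assocTmul z v) = evalForm γ v (h z) :=
  assocLift_assocTmul (fun z v => evalForm γ v (h z)) (fun z z' v => by rw [map_add, map_add])
      (fun z v v' => evalForm_add γ v v' (h z))
      (fun z b v => by rw [hr, evalForm_right_mul]) z v

end Trace

/-- The splitting comes from the summand `Λ` and serves all `V` at once. The bimodule `P` is finite
projective, hence a summand of `(Λ ⊗ Λᵒᵖ) ^ n`, so `P ⊗_Λ V` is a summand of `(Λ ⊗_k V) ^ n`, which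
is finite free over `Λ`. Written out with a dual basis of `P` and a basis of `V`, the projection to
this part is the sum of the `α s t • w s`. -/
theorem exists_splitting [Module.Finite Λ Y] [Module.Finite Λᵐᵒᵖ X]
    (h : IsRegularPlusProjective k Λ (BalancedTensor Γ Y X)) :
    ∃ D : BimoduleSplitting Λ Γ X Y,
      ∀ (V : Type u) [AddCommGroup V] [Module Λ V] [Module k V] [IsScalarTower k Λ V]
        [Module.Finite k V],
        ∃ (m : ℕ) (α : Fin m → BalancedTensor Γ Y (BalancedTensor Λ X V) →ₗ[Λ] Λ)
          (w : Fin m → BalancedTensor Γ Y (BalancedTensor Λ X V)),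
          ∀ t, t = D.incl V (D.retr V t) + ∑ s, α s t • w s := by
  obtain ⟨P, _, _, hP, e, hel, her⟩ := h
  let D : BimoduleSplitting Λ Γ X Y :=
    { proj := (AddMonoidHom.fst Λ P).comp e.toAddMonoidHom
      proj_smul := fun a z => congrArg Prod.fst (hel a z)
      proj_op_smul := fun b z => congrArg Prod.fst (her b z)
      unit := e.symm (1, 0)
      unit_comm := fun a => e.injective (by simp [hel, her])
      proj_unit := by
        change (e (e.symm (1, 0))).1 = 1
        rw [AddEquiv.apply_symm_apply] }
  -- `P` is a quotient of `Y ⊗_Γ X`, which is generated as a bimodule by the `y ⊗ x` with `y` among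
  -- left generators of `Y` and `x` among right generators of `X`.
  have hfin : Module.Finite (Λ ⊗[k] Λᵐᵒᵖ) P := by
    obtain ⟨sY, hsY⟩ := (Module.Finite.fg_top : (⊤ : Submodule Λ Y).FG)
    obtain ⟨sX, hsX⟩ := (Module.Finite.fg_top : (⊤ : Submodule Λᵐᵒᵖ X).FG)
    let g : Y → X → P := fun y x => (e (tmul Γ y x)).2
    let S : Submodule (Λ ⊗[k] Λᵐᵒᵖ) P := Submodule.span _ (Set.image2 g sY sX)
    have h1 : ∀ y ∈ sY, ∀ x, g y x ∈ S := fun y hy x => by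
      have hx : x ∈ Submodule.span Λᵐᵒᵖ (sX : Set X) := hsX ▸ Submodule.mem_top
      induction hx using Submodule.span_induction with
      | mem x hx => exact Submodule.subset_span ⟨y, hy, x, hx, rfl⟩
      | zero => simp only [g, tmul_zero, map_zero, Prod.snd_zero, Submodule.zero_mem]
      | add x x' _ _ h h' =>
        simp only [g, tmul_add, map_add, Prod.snd_add] at h h' ⊢
        exact S.add_mem h h'
      | smul b x _ h =>
        have h2 : g y (b • x) = ((1 : Λ) ⊗ₜ[k] b) • g y x :=
          congrArg Prod.snd (her (unop b) (tmul Γ y x))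
        rw [h2]
        exact S.smul_mem _ h
    have h2 : ∀ y x, g y x ∈ S := fun y x => by
      have hy : y ∈ Submodule.span Λ (sY : Set Y) := hsY ▸ Submodule.mem_top
      induction hy using Submodule.span_induction with
      | mem y hy => exact h1 y hy x
      | zero => simp only [g, zero_tmul, map_zero, Prod.snd_zero, Submodule.zero_mem]
      | add y y' _ _ h h' =>
        simp only [g, add_tmul, map_add, Prod.snd_add] at h h' ⊢
        exact S.add_mem h h'
      | smul a y _ h =>
        have h2 : g (a • y) x = (a ⊗ₜ[k] (1 : Λᵐᵒᵖ)) • g y x :=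
          congrArg Prod.snd (hel a (tmul Γ y x))
        rw [h2]
        exact S.smul_mem _ h
    have h3 : ∀ z, (e z).2 ∈ S := fun z => by
      induction z using induction_on with
      | zero => simp only [map_zero, Prod.snd_zero, Submodule.zero_mem]
      | tmul y x => exact h2 y x
      | add z z' h h' => rw [map_add, Prod.snd_add]; exact S.add_mem h h'
    have h4 : S = ⊤ := (Submodule.eq_top_iff').2 fun p => by
      have h := h3 (e.symm (0, p))
      rwa [AddEquiv.apply_symm_apply] at h
    exact ⟨h4 ▸ Submodule.fg_span ((Finset.finite_toSet sY).image2 g (Finset.finite_toSet sX))⟩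
  refine ⟨D, fun V _ _ _ _ _ => ?_⟩
  obtain ⟨n, p, f, hpf⟩ := exists_finite_dualBasis (Λ ⊗[k] Λᵐᵒᵖ) P
  let b := Module.finBasis k V
  let j : P →+ BalancedTensor Γ Y X :=
    e.symm.toAddMonoidHom.comp (AddMonoidHom.inr Λ P)
  have hj : ∀ q, e (j q) = (0, q) := fun q => e.apply_symm_apply _
  have hjl : ∀ (a : Λ) q, j ((a ⊗ₜ[k] (1 : Λᵐᵒᵖ)) • q) = a • j q := fun a q => e.injective (by
    rw [hel, hj, hj, mul_zero])
  have hjr : ∀ (a : Λ) q, j (((1 : Λ) ⊗ₜ[k] op a) • q) = op a • j q := fun a q => e.injective (by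
    rw [her, hj, hj, zero_mul])
  -- Scalars act centrally on the image of `P`, because `c ⊗ 1 = 1 ⊗ c` over `k`.
  have hjk : ∀ (c : k) q, algebraMap k Λ c • j q = op (algebraMap k Λ c) • j q := fun c q => by
    rw [← hjl, ← hjr]
    congr 2
    rw [Algebra.algebraMap_eq_smul_one, op_smul, op_one, TensorProduct.smul_tmul]
  -- For `t = a ⊗ c` both sides are `a (j q ⊗ c v)`, the left one with `c v` expanded in the basis
  -- of `V`.
  have hact : ∀ (t : Λ ⊗[k] Λᵐᵒᵖ) (q : P) (v : V),
      ∑ l, evalForm (b.coord l) v t • assocTmul (Λ := Λ) (j q) (b l) =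
        assocTmul (j (t • q)) v := fun t q v => by
    induction t using TensorProduct.induction_on with
    | zero =>
      have h0 : (0 : Λ ⊗[k] Λᵐᵒᵖ) • q = 0 := Module.zero_smul q
      simp only [h0, map_zero, zero_smul, Finset.sum_const_zero, assocTmul_zero_left]
    | tmul a c =>
      have h1 : (a ⊗ₜ[k] c) • q = (a ⊗ₜ[k] (1 : Λᵐᵒᵖ)) • ((1 : Λ) ⊗ₜ[k] op (unop c)) • q := by
        rw [← mul_smul, Algebra.TensorProduct.tmul_mul_tmul, mul_one, one_mul, op_unop]
      have h2 : ∀ l, evalForm (b.coord l) v (a ⊗ₜ c) • assocTmul (Λ := Λ) (j q) (b l) =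
          a • assocTmul (j q) (b.repr (unop c • v) l • b l) := fun l => by
        rw [evalForm_tmul, Module.Basis.coord_apply, Algebra.smul_def, Algebra.commutes, mul_smul,
          smul_assocTmul (algebraMap k Λ _), hjk, assocTmul_op_smul, algebraMap_smul]
      let A : V →+ BalancedTensor Γ Y (BalancedTensor Λ X V) :=
        AddMonoidHom.mk' (assocTmul (j q)) (assocTmul_add_right (j q))
      have h3 : ∑ l, assocTmul (Λ := Λ) (j q) (b.repr (unop c • v) l • b l) =
          assocTmul (j q) (unop c • v) := by
        have := congrArg A (b.sum_repr (unop c • v))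
        rwa [map_sum] at this
      rw [Finset.sum_congr rfl fun l _ => h2 l, ← Finset.smul_sum, h3, h1, hjl, hjr,
        ← smul_assocTmul, assocTmul_op_smul]
    | add s t hs ht =>
      simp only [map_add, add_smul, Finset.sum_add_distrib, assocTmul_add_left] at hs ht ⊢
      rw [hs, ht]
  let h : Fin n → BalancedTensor Γ Y X →+ Λ ⊗[k] Λᵐᵒᵖ := fun s =>
    (f s).toAddMonoidHom.comp ((AddMonoidHom.snd Λ P).comp e.toAddMonoidHom)
  have hh : ∀ s z, h s z = f s (e z).2 := fun s z => rfl
  have hhl : ∀ s (a : Λ) z, h s (a • z) = (a ⊗ₜ 1) * h s z := fun s a z => by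
    rw [hh, hh, hel, map_smul, smul_eq_mul]
  have hhr : ∀ s (a : Λ) z, h s (op a • z) = (1 ⊗ₜ op a) * h s z := fun s a z => by
    rw [hh, hh, her, map_smul, smul_eq_mul]
  -- The index `s` runs over pairs of a dual basis vector of `P` and a basis vector of `V`.
  let ε := Fintype.equivFin (Fin n × Fin (Module.finrank k V))
  refine ⟨_, fun s => assocForm (h (ε.symm s).1) (hhl _) (hhr _) (b.coord (ε.symm s).2),
    fun s => assocTmul (j (p (ε.symm s).1)) (b (ε.symm s).2), fun t => ?_⟩
  rw [ε.symm.sum_comp fun s => assocForm (h s.1) (hhl _) (hhr _) (b.coord s.2) t •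
    assocTmul (j (p s.1)) (b s.2), Fintype.sum_prod_type]
  induction t using assoc_induction with
  | zero => simp only [map_zero, zero_smul, Finset.sum_const_zero, add_zero]
  | assocTmul z v =>
    simp only [assocForm_assocTmul, hact]
    rw [D.retr_assocTmul, D.incl_apply]
    let A : BalancedTensor Γ Y X →+ BalancedTensor Γ Y (BalancedTensor Λ X V) :=
      AddMonoidHom.mk' (fun z => assocTmul z v) fun z z' => assocTmul_add_left z z' v
    have h1 : ∑ s, assocTmul (Λ := Λ) (j (h s z • p s)) v = assocTmul (j (e z).2) v := by
      have := congrArg (A.comp j) (hpf (e z).2)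
      rwa [map_sum] at this
    -- What is left is the decomposition of `z` in `Y ⊗ X`: the unit times `proj z`, plus the
    -- component in `P`.
    rw [h1, ← assocTmul_op_smul, ← assocTmul_add_left]
    congr 1
    apply e.injective
    rw [map_add, her, hj]
    change e z = ((e (e.symm (1, 0))).1 * (e z).1, _ • (e (e.symm (1, 0))).2) + _
    rw [AddEquiv.apply_symm_apply]
    simp
  | add s t hs ht =>
    simp only [map_add, add_smul, Finset.sum_add_distrib]
    conv_lhs => rw [hs, ht]
    abel

end IsRegularPlusProjective

/-! ### Bijectivity of tensoring lifts -/

theorem LinearMap.map_mem_smul_top {R M N : Type*} [CommRing R] [AddCommGroup M] [Module R M]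
    [AddCommGroup N] [Module R N] (f : M →ₗ[R] N) (I : Ideal R) {x : M}
    (hx : x ∈ I • (⊤ : Submodule R M)) : f x ∈ I • (⊤ : Submodule R N) := by
  have h := Submodule.mem_map_of_mem (f := f) hx
  rw [Submodule.map_smul''] at h
  exact Submodule.smul_mono le_rfl le_top h

namespace ModuleLift

open BalancedTensor

variable {k : Type u} [Field k] {Λ Γ : Type u} [Ring Λ] [Algebra k Λ] [Ring Γ] [Algebra k Γ]
  {V : Type u} [AddCommGroup V] [Module Λ V] (R : CompleteLocalAlg k)

/-! ### The trivial lift -/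

section Trivial

variable (W : Type u) [AddCommGroup W] [Module Λ W] [Module k W] [IsScalarTower k Λ W]

/-- The map `R ⊗_k W → W`. -/
def trivialRed : BaseChange (algebraMap k R) W →ₗ[Λ] W :=
  letI : Module R W := Module.compHom W R.residue
  let f : BaseChange (algebraMap k R) W →ₗ[R] W :=
    BaseChange.lift (algebraMap k R) (AddMonoidHom.id W) fun c x => by
      change c • x = R.residue (algebraMap k R c) • x
      rw [R.residue_algebraMap]
  { toFun := f
    map_add' := map_add f
    map_smul' := fun a z => by
      rw [RingHom.id_apply]
      induction z using BaseChange.induction_on with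
      | zero => rw [smul_zero, map_zero, smul_zero]
      | tmul r x => exact smul_comm (R.residue r) a x
      | add y z hy hz => rw [smul_add, map_add, map_add, hy, hz, smul_add] }

theorem trivialRed_tmul (r : R) (x : W) :
    trivialRed (Λ := Λ) R W (BaseChange.tmul (algebraMap k R) r x) = R.residue r • x := rfl

theorem sub_one_tmul_trivialRed_mem (z : BaseChange (algebraMap k R) W) :
    z - BaseChange.tmul (algebraMap k R) 1 (trivialRed (Λ := Λ) R W z) ∈
      IsLocalRing.maximalIdeal R • (⊤ : Submodule R (BaseChange (algebraMap k R) W)) := by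
  induction z using BaseChange.induction_on with
  | zero => simp only [map_zero, BaseChange.tmul_zero, sub_zero, Submodule.zero_mem]
  | tmul r x =>
    have h : BaseChange.tmul (algebraMap k R) r x -
        BaseChange.tmul (algebraMap k R) 1 (R.residue r • x) =
        (r - algebraMap k R (R.residue r)) • BaseChange.tmul (algebraMap k R) 1 x := by
      simp only [BaseChange.tmul_smul, sub_smul, BaseChange.smul_tmul, mul_one]
    rw [trivialRed_tmul, h]
    exact Submodule.smul_mem_smul (R.sub_algebraMap_residue_mem r) Submodule.mem_top
  | add y z hy hz =>
    rw [map_add, BaseChange.tmul_add, add_sub_add_comm]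
    exact Submodule.add_mem _ hy hz

/-- The trivial lift `R ⊗_k W` of `W`. -/
abbrev trivial [Module.Finite k W] : ModuleLift Λ W R :=
  ofRed (BaseChange (algebraMap k R) W)
    (fun c z => by
      induction z using BaseChange.induction_on with
      | zero => rw [smul_zero, smul_zero]
      | tmul r x =>
        rw [BaseChange.action_tmul, _root_.algebraMap_smul, BaseChange.tmul_smul, BaseChange.smul_tmul]
      | add y z hy hz => rw [smul_add, smul_add, hy, hz])
    (trivialRed R W)
    (fun r z => by
      induction z using BaseChange.induction_on with
      | zero => simp only [smul_zero, map_zero]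
      | tmul s x =>
        rw [BaseChange.smul_tmul, trivialRed_tmul, trivialRed_tmul, map_mul, mul_smul,
          _root_.algebraMap_smul]
      | add y z hy hz => rw [smul_add, map_add, map_add, hy, hz, smul_add])
    (fun x => ⟨BaseChange.tmul (algebraMap k R) 1 x, by
      rw [trivialRed_tmul, map_one, one_smul]⟩)
    (fun z hz => by
      have h := sub_one_tmul_trivialRed_mem (Λ := Λ) R W z
      rwa [hz, BaseChange.tmul_zero, sub_zero] at h)

end Trivial

variable {R}

theorem finite_of_lift [Module k V] [IsScalarTower k Λ V] (L : ModuleLift Λ V R) :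
    Module.Finite k V := by
  haveI : RingHomSurjective R.residue := ⟨R.residue_surjective⟩
  let f : L.carrier →ₛₗ[R.residue] V :=
    { toFun := L.red
      map_add' := map_add L.red
      map_smul' := fun r x => by rw [red_smul, _root_.algebraMap_smul] }
  exact Module.Finite.of_surjective f L.red_surjective

variable {X : Type u} [AddCommGroup X] [Module Γ X] [Module Λᵐᵒᵖ X] [SMulCommClass Γ Λᵐᵒᵖ X]
  {Y : Type u} [AddCommGroup Y] [Module Λ Y] [Module Γᵐᵒᵖ Y] [SMulCommClass Λ Γᵐᵒᵖ Y]

/-- The kernel of a surjective linear map between lifts, as a lift. -/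
theorem exists_lift_ker {V₁ V₂ : Type u} [AddCommGroup V₁] [Module Λ V₁] [AddCommGroup V₂]
    [Module Λ V₂] (M : ModuleLift Λ V₁ R) (T : ModuleLift Λ V₂ R)
    (r : M.carrier →ₗ[R] T.carrier) (hr : ∀ (a : Λ) x, r (a • x) = a • r x)
    (q : V₁ →ₗ[Λ] V₂) (hq : ∀ x, T.red (r x) = q (M.red x)) (hqs : Function.Surjective q)
    (i : V →ₗ[Λ] V₁) (p : V₁ →ₗ[Λ] V) (hpi : ∀ v, p (i v) = v) (hqi : ∀ v, q (i v) = 0)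
    (hqp : ∀ v, q v = 0 → i (p v) = v) :
    ∃ (L : ModuleLift Λ V R) (j : L.carrier →ₗ[R] M.carrier),
      (∀ (a : Λ) x, j (a • x) = a • j x) ∧ ∀ x, M.red (j x) = i (L.red x) := by
  -- Since `q` is surjective, so is `r` by Nakayama. As `T` is free, `r` has a section `σ`, and its
  -- kernel is the image of the projection `1 - σ r`. Hence the kernel is finite projective, and so
  -- free over the local ring.
  have hs : Function.Surjective r := T.surjective_of_red r fun w => by
    obtain ⟨v, rfl⟩ := hqs w
    obtain ⟨x, rfl⟩ := M.red_surjective v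
    exact ⟨x, hq x⟩
  obtain ⟨σ, hσ⟩ := r.exists_rightInverse_of_surjective (LinearMap.range_eq_top.2 hs)
  have hσ' : ∀ y, r (σ y) = y := fun y => LinearMap.congr_fun hσ y
  let N : Submodule R M.carrier := LinearMap.ker r
  let π : M.carrier →ₗ[R] N := LinearMap.codRestrict N (LinearMap.id - σ ∘ₗ r) fun x => by
    change r (x - σ (r x)) = 0
    rw [map_sub, hσ', sub_self]
  have hπ : ∀ x, (π x : M.carrier) = x - σ (r x) := fun x => rfl
  have hπN : ∀ x : N, π x = x := fun x => Subtype.ext (by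
    rw [hπ, LinearMap.mem_ker.1 x.2, map_zero, sub_zero])
  letI : SMul Λ N := ⟨fun a x => ⟨a • x.1, by
    rw [LinearMap.mem_ker, hr, LinearMap.mem_ker.1 x.2, smul_zero]⟩⟩
  letI : Module Λ N := Function.Injective.module Λ N.toAddSubgroup.subtype Subtype.val_injective
    fun _ _ => rfl
  haveI : SMulCommClass Λ R N := ⟨fun a s x => Subtype.ext (smul_comm a s x.1)⟩
  haveI : Module.Finite R N := Module.Finite.of_surjective π fun x => ⟨x, hπN x⟩
  haveI : Module.Projective R N :=
    Module.Projective.of_split N.subtype π (LinearMap.ext hπN)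
  haveI : Module.Free R N := Module.free_of_flat_of_isLocalRing
  let g : N →ₗ[Λ] V :=
    { toFun := fun x => p (M.red x)
      map_add' := fun x y => by rw [Submodule.coe_add, map_add, map_add]
      map_smul' := fun a x => by
        change p (M.red (a • x.1)) = _
        rw [map_smul, map_smul, RingHom.id_apply] }
  have hg : ∀ x, g x = p (M.red x) := fun x => rfl
  have hN : ∀ x : N, q (M.red x) = 0 := fun x => by
    rw [← hq, LinearMap.mem_ker.1 x.2, map_zero]
  let L : ModuleLift Λ V R := ofRed N (fun c x => Subtype.ext (M.algebraMap_smul c x.1)) g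
    (fun s x => by
      rw [hg, hg, Submodule.coe_smul, red_smul, map_smul])
    (fun v => by
      obtain ⟨x, hx⟩ := M.red_surjective (i v)
      refine ⟨π x, ?_⟩
      -- A preimage `x` of `i v` need not lie in the kernel, but `r x` lies in `𝔪 T`. The correction
      -- `σ (r x)` is then in `𝔪 M` and leaves the reduction unchanged.
      have h1 : r x ∈ IsLocalRing.maximalIdeal R • (⊤ : Submodule R T.carrier) := by
        rw [← red_eq_zero_iff, hq, hx, hqi]
      have h2 := (M.red_eq_zero_iff _).2 (σ.map_mem_smul_top _ h1)
      rw [hg, hπ, map_sub, h2, sub_zero, hx, hpi])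
    (fun x hx => by
      -- The reduction is killed by both `p` and `q`, so it vanishes. This gives `x ∈ 𝔪 M` only, and
      -- the projection `π` carries that to `x ∈ 𝔪 N`.
      have h1 : M.red x = 0 := by
        rw [← hqp _ (hN x), ← hg, hx, map_zero]
      rw [← hπN x]
      exact π.map_mem_smul_top _ ((M.red_eq_zero_iff _).1 h1))
  refine ⟨L, N.subtype, fun a x => rfl, fun x => ?_⟩
  have h1 : L.red x = g x := ofRed_red N _ _ _ _ _ x
  rw [h1, hg, hqp _ (hN x)]
  rfl

variable [Module.Finite Λᵐᵒᵖ X] [Module.Projective Λᵐᵒᵖ X]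
  (hX : ∀ (c : k) (x : X), algebraMap k Γ c • x = op (algebraMap k Λ c) • x)
  [Module.Finite Γᵐᵒᵖ Y] [Module.Projective Γᵐᵒᵖ Y]
  (hY : ∀ (c : k) (y : Y), algebraMap k Λ c • y = op (algebraMap k Γ c) • y)

/-- Let `K` be the kernel of the retraction of `Y ⊗ X ⊗ V` onto `V`. The projection to `K` factors
through a finite free module, so it lifts to a map from `M` to the trivial lift of `K`, whose kernel
is the desired `L`. The isomorphism is assembled from two maps, one reducing to `incl ∘ retr` and
one reducing to the projection to `K`. -/
theorem exists_isomorphic_tensor_tensor [Module.Finite k Λ] [Module.Injective Λ Λ]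
    (D : BimoduleSplitting Λ Γ X Y) {m : ℕ}
    (α : Fin m → BalancedTensor Γ Y (BalancedTensor Λ X V) →ₗ[Λ] Λ)
    (w : Fin m → BalancedTensor Γ Y (BalancedTensor Λ X V))
    (hD : ∀ t, t = D.incl V (D.retr V t) + ∑ s, α s t • w s)
    (M : ModuleLift Λ (BalancedTensor Γ Y (BalancedTensor Λ X V)) R) :
    ∃ L : ModuleLift Λ V R, Isomorphic ((L.tensor X hX).tensor Y hY) M := by
  let W := BalancedTensor Γ Y (BalancedTensor Λ X V)
  letI : Module k W := Module.compHom W (algebraMap k Λ)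
  haveI : IsScalarTower k Λ W := ⟨fun c a x => by
    change (c • a) • x = algebraMap k Λ c • a • x
    rw [Algebra.smul_def, mul_smul]⟩
  -- The lift `M` is finite over `R` and reduces onto `W`, so `W` and its submodule `K` are finite
  -- dimensional, as the trivial lift of `K` requires.
  haveI : Module.Finite k W := M.finite_of_lift
  let K : Submodule Λ W := LinearMap.ker (D.retr V)
  haveI : Module.Finite k K := Module.Finite.of_injective
    ((K.restrictScalars k).subtype) Subtype.val_injective
  let q : W →ₗ[Λ] K := LinearMap.codRestrict K (LinearMap.id - D.incl V ∘ₗ D.retr V) fun t => by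
    change D.retr V (t - D.incl V (D.retr V t)) = 0
    rw [map_sub, D.retr_incl, sub_self]
  have hq : ∀ t, (q t : W) = t - D.incl V (D.retr V t) := fun t => rfl
  have hqK : ∀ t : K, q t = t := fun t => Subtype.ext (by
    rw [hq, LinearMap.mem_ker.1 t.2, map_zero, sub_zero])
  have hqα : ∀ t, ∑ s, α s t • w s = (q t : W) := fun t => by
    rw [hq, eq_sub_iff_add_eq, add_comm]
    exact (hD t).symm
  have hqα' : ∀ t, ∑ s, α s t • q (w s) = q t := fun t => by
    have h := congrArg q (hqα t)
    rw [map_sum, hqK] at h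
    simpa only [map_smul] using h
  obtain ⟨r, hr, hrq⟩ := exists_hom_lifting M (trivial (Λ := Λ) R K) α fun s => q (w s)
  obtain ⟨L, j, hj, hjr⟩ := exists_lift_ker M (trivial (Λ := Λ) R K) r hr q
    (fun x => (hrq x).trans (hqα' _)) (fun t => ⟨t, hqK t⟩) (D.incl V) (D.retr V)
    (D.retr_incl V) (fun v => Subtype.ext (by rw [hq, D.retr_incl, sub_self]; rfl))
    (fun t ht => by
      have h := hq t
      rw [ht] at h
      exact (sub_eq_zero.1 h.symm).symm)
  -- The idempotent of `W` with image `K` also lifts, now as a map from `Y ⊗ X ⊗ L` to `M`. Added to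
  -- `j ∘ retr`, it reduces to the identity by `hD`.
  obtain ⟨ψ, hψ, hψr⟩ := exists_hom_lifting ((L.tensor X hX).tensor Y hY) M α w
  let ρ : BalancedTensor Γ Y (BalancedTensor Λ X L.carrier) →ₗ[R] L.carrier :=
    ⟨⟨D.retr L.carrier, map_add _⟩, D.retr_base_smul⟩
  refine ⟨L, Isomorphic.of_hom (j ∘ₗ ρ + ψ) (fun a t => ?_) fun t => ?_⟩
  · have h1 : ρ (a • t) = a • ρ t := map_smul (D.retr L.carrier) a t
    rw [LinearMap.add_apply, LinearMap.add_apply, hψ, smul_add]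
    exact congrArg (· + a • ψ t) ((congrArg j h1).trans (hj a (ρ t)))
  · have h2 : L.red (D.retr L.carrier t) =
        D.retr V (((L.tensor X hX).tensor Y hY).red t) := by
      rw [tensor_tensor_red, D.retr_lTensor₂]
    rw [LinearMap.add_apply, map_add, hψr]
    refine Eq.trans ?_ (hD _).symm
    congr 1
    refine (hjr (ρ t)).trans ?_
    exact congrArg (D.incl V) h2

end ModuleLift

/-! ### The induced transformation of deformation functors -/

section Functor

variable {k : Type u} [Field k] {Λ Γ : Type u} [Ring Λ] [Algebra k Λ] [Ring Γ] [Algebra k Γ]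
  (V : Type u) [AddCommGroup V] [Module Λ V]
  (X : Type u) [AddCommGroup X] [Module Γ X] [Module Λᵐᵒᵖ X] [SMulCommClass Γ Λᵐᵒᵖ X]
  [Module.Finite Λᵐᵒᵖ X] [Module.Projective Λᵐᵒᵖ X]
  (hX : ∀ (c : k) (x : X), algebraMap k Γ c • x = op (algebraMap k Λ c) • x)

/-- Tensoring deformations with a bimodule. -/
def tensorDeformation (R : CompleteLocalAlg k) :
    (deformationFunctor (k := k) Λ V).obj R →
      (deformationFunctor (k := k) Γ (BalancedTensor Λ X V)).obj R :=
  Quotient.map (ModuleLift.tensor X hX) fun _ _ h => ModuleLift.Isomorphic.tensor X hX h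

/-- If tensoring deformations with a bimodule is bijective, it is an isomorphism of deformation
functors. -/
theorem nonempty_iso_of_bijective
    (h : ∀ R, Function.Bijective (tensorDeformation V X hX R)) :
    Nonempty (deformationFunctor (k := k) Λ V ≅
      deformationFunctor (k := k) Γ (BalancedTensor Λ X V)) :=
  ⟨NatIso.ofComponents (fun R => (Equiv.ofBijective _ (h R)).toIso) fun {R S} α => by
    ext ξ
    induction ξ using Quotient.inductionOn with
    | h L => exact Quotient.sound (ModuleLift.tensor_baseChange X hX α L).symm⟩

end Functor

/-! ### Constructions in the category of complete local algebras -/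

namespace CompleteLocalAlg

open IsLocalRing

variable {k : Type u} [Field k]

/-- The residue map as a `k`-algebra homomorphism. -/
def residueAlgHom (R : CompleteLocalAlg k) : R →ₐ[k] k :=
  { R.residue with commutes' := R.residue_algebraMap }

/-- Every `k`-algebra homomorphism between objects is local. -/
def Hom.ofAlgHom {R S : CompleteLocalAlg k} (f : R →ₐ[k] S) : R ⟶ S :=
  ⟨f, ⟨fun r hr => by
    by_contra h
    -- The kernel of `R → S → k` is maximal because the composite is onto `k`, so it is the maximal
    -- ideal of the local ring `R`.
    have hmax : (RingHom.ker (S.residue.comp f.toRingHom)).IsMaximal :=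
      RingHom.ker_isMaximal_of_surjective _ fun c => ⟨algebraMap k R c, by
        change S.residue (f (algebraMap k R c)) = c
        rw [f.commutes, residue_algebraMap]⟩
    have h1 : r ∈ RingHom.ker (S.residue.comp f.toRingHom) := by
      rw [eq_maximalIdeal hmax]
      exact h
    exact ((S.residue_eq_zero_iff _).1 h1 : f r ∈ nonunits S) hr⟩⟩

theorem hom_ext {R S : CompleteLocalAlg k} {f g : R ⟶ S}
    (h : ∀ r, Hom.ringHom f r = Hom.ringHom g r) : f = g :=
  Hom.ext (AlgHom.ext h)

theorem ringHom_comp_apply {R S T : CompleteLocalAlg k} (f : R ⟶ S) (g : S ⟶ T) (r : R) :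
    Hom.ringHom (f ≫ g) r = Hom.ringHom g (Hom.ringHom f r) := rfl

theorem ringHom_mem_maximalIdeal {R S : CompleteLocalAlg k} (f : R ⟶ S) {r : R}
    (hr : r ∈ maximalIdeal R) : Hom.ringHom f r ∈ maximalIdeal S := by
  rw [← residue_eq_zero_iff] at hr ⊢
  rw [residue_ringHom, hr]

theorem ringHom_mem_maximalIdeal_pow {R S : CompleteLocalAlg k} (f : R ⟶ S) {n : ℕ} {r : R}
    (hr : r ∈ maximalIdeal R ^ n) : Hom.ringHom f r ∈ maximalIdeal S ^ n := by
  have h := Ideal.mem_map_of_mem (Hom.ringHom f) hr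
  rw [Ideal.map_pow] at h
  have hle : (maximalIdeal R).map (Hom.ringHom f) ≤ maximalIdeal S :=
    Ideal.map_le_iff_le_comap.2 fun x hx => ringHom_mem_maximalIdeal f hx
  exact Ideal.pow_right_mono hle n h

theorem nonempty_iso_of_bijective {R S : CompleteLocalAlg k} (f : R ⟶ S)
    (hf : Function.Bijective (Hom.ringHom f)) : Nonempty (R ≅ S) := by
  let e : R ≃ₐ[k] S := AlgEquiv.ofBijective f.toAlgHom hf
  exact ⟨⟨f, Hom.ofAlgHom e.symm.toAlgHom, hom_ext fun r => e.symm_apply_apply r,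
    hom_ext fun s => e.apply_symm_apply s⟩⟩

/-! ### Quotients and truncations -/

section Quotient

theorem maximalIdeal_quotient {A : Type*} [CommRing A] [IsLocalRing A] (I : Ideal A)
    [IsLocalRing (A ⧸ I)] :
    maximalIdeal (A ⧸ I) = (maximalIdeal A).map (algebraMap A (A ⧸ I)) := by
  have hs : Function.Surjective (algebraMap A (A ⧸ I)) := Ideal.Quotient.mk_surjective
  have hI : I ≤ maximalIdeal A := le_maximalIdeal fun h =>
    one_ne_zero (α := A ⧸ I) (Ideal.Quotient.eq_zero_iff_mem.2 (h ▸ Submodule.mem_top))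
  rcases Ideal.map_eq_top_or_isMaximal_of_surjective _ hs (maximalIdeal.isMaximal A) with h | h
  · have h1 : (1 : A ⧸ I) ∈ (maximalIdeal A).map (algebraMap A (A ⧸ I)) :=
      h ▸ Submodule.mem_top
    obtain ⟨x, hx, hx1⟩ := (Ideal.mem_map_iff_of_surjective _ hs).1 h1
    have h2 : x - 1 ∈ I := (Ideal.Quotient.mk_eq_mk_iff_sub_mem x 1).1 hx1
    have h3 := Submodule.sub_mem _ hx (hI h2)
    rw [sub_sub_cancel] at h3
    exact absurd ((Ideal.eq_top_iff_one _).2 h3) (maximalIdeal.isMaximal A).ne_top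
  · exact (eq_maximalIdeal h).symm

/-- Adic completion preserves surjections, so every element of the completion of `A ⧸ I` comes from
the completion of `A`, hence from `A`. -/
theorem isPrecomplete_quotient {A : Type*} [CommRing A] (J I : Ideal A) [IsPrecomplete J A] :
    IsPrecomplete J (A ⧸ I) := by
  rw [← AdicCompletion.of_surjective_iff]
  intro y
  obtain ⟨x, rfl⟩ := AdicCompletion.map_surjective J (f := I.mkQ) I.mkQ_surjective y
  obtain ⟨x, rfl⟩ := AdicCompletion.of_surjective J A x
  exact ⟨I.mkQ x, (AdicCompletion.map_of J I.mkQ x).symm⟩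

theorem nontrivial_quotient {A : Type*} [CommRing A] {I : Ideal A} (hI : I ≠ ⊤) :
    Nontrivial (A ⧸ I) :=
  Ideal.Quotient.nontrivial_iff.2 hI

theorem isLocalRing_quotient {A : Type*} [CommRing A] [IsLocalRing A] {I : Ideal A}
    (hI : I ≠ ⊤) : IsLocalRing (A ⧸ I) :=
  haveI := nontrivial_quotient hI
  IsLocalRing.of_surjective' (Ideal.Quotient.mk I) Ideal.Quotient.mk_surjective

/-- The quotient of a complete local algebra by a proper ideal. -/
def quotient (R : CompleteLocalAlg k) (I : Ideal R) (hI : I ≠ ⊤) : CompleteLocalAlg k :=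
  haveI := isLocalRing_quotient hI
  { carrier := R ⧸ I
    isAdicComplete :=
      haveI : IsPrecomplete (maximalIdeal (R ⧸ I)) (R ⧸ I) := by
        rw [maximalIdeal_quotient, IsPrecomplete.map_algebraMap_iff]
        exact isPrecomplete_quotient _ I
      { }
    residue_bijective := by
      refine ⟨(algebraMap k _).injective, fun y => ?_⟩
      obtain ⟨x, rfl⟩ := IsLocalRing.residue_surjective y
      obtain ⟨r, rfl⟩ := Ideal.Quotient.mk_surjective x
      refine ⟨R.residue r, ?_⟩
      change IsLocalRing.residue (R ⧸ I) (Ideal.Quotient.mk I (algebraMap k R (R.residue r))) = _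
      rw [← sub_eq_zero, ← map_sub, ← map_sub, IsLocalRing.residue_eq_zero_iff,
        maximalIdeal_quotient]
      refine Ideal.mem_map_of_mem _ ?_
      rw [← neg_sub, neg_mem_iff]
      exact R.sub_algebraMap_residue_mem r }

/-- The quotient map. -/
def quotientMk (R : CompleteLocalAlg k) (I : Ideal R) (hI : I ≠ ⊤) : R ⟶ R.quotient I hI :=
  Hom.ofAlgHom (Ideal.Quotient.mkₐ k I)

theorem ringHom_quotientMk_eq_zero_iff (R : CompleteLocalAlg k) (I : Ideal R) (hI : I ≠ ⊤)
    (r : R) : Hom.ringHom (R.quotientMk I hI) r = 0 ↔ r ∈ I :=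
  Ideal.Quotient.eq_zero_iff_mem

theorem quotientMk_surjective (R : CompleteLocalAlg k) (I : Ideal R) (hI : I ≠ ⊤) :
    Function.Surjective (Hom.ringHom (R.quotientMk I hI)) :=
  Ideal.Quotient.mk_surjective

/-- Homomorphisms out of a quotient. -/
def quotientLift {R S : CompleteLocalAlg k} (I : Ideal R) (hI : I ≠ ⊤) (f : R ⟶ S)
    (hf : ∀ r ∈ I, Hom.ringHom f r = 0) : R.quotient I hI ⟶ S :=
  Hom.ofAlgHom (Ideal.Quotient.liftₐ I f.toAlgHom hf)

theorem quotientMk_lift {R S : CompleteLocalAlg k} (I : Ideal R) (hI : I ≠ ⊤) (f : R ⟶ S)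
    (hf : ∀ r ∈ I, Hom.ringHom f r = 0) : R.quotientMk I hI ≫ quotientLift I hI f hf = f :=
  hom_ext fun _ => rfl

theorem quotient_hom_ext {R S : CompleteLocalAlg k} (I : Ideal R) (hI : I ≠ ⊤)
    {f g : R.quotient I hI ⟶ S} (h : R.quotientMk I hI ≫ f = R.quotientMk I hI ≫ g) : f = g :=
  hom_ext fun r => by
    obtain ⟨r, rfl⟩ := R.quotientMk_surjective I hI r
    rw [← ringHom_comp_apply, ← ringHom_comp_apply, h]

theorem maximalIdeal_pow_succ_ne_top (R : CompleteLocalAlg k) (n : ℕ) :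
    maximalIdeal R ^ (n + 1) ≠ ⊤ := fun h =>
  (maximalIdeal.isMaximal R).ne_top
    (top_le_iff.1 (h ▸ Ideal.pow_le_self n.succ_ne_zero))

/-- The quotient `R / 𝔪ⁿ⁺¹`. -/
abbrev powQuotient (R : CompleteLocalAlg k) (n : ℕ) : CompleteLocalAlg k :=
  R.quotient (maximalIdeal R ^ (n + 1)) (R.maximalIdeal_pow_succ_ne_top n)

/-- The quotient map `R → R / 𝔪ⁿ⁺¹`. -/
abbrev powMk (R : CompleteLocalAlg k) (n : ℕ) : R ⟶ R.powQuotient n :=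
  R.quotientMk _ (R.maximalIdeal_pow_succ_ne_top n)

/-- The transition map `R / 𝔪ⁿ⁺² → R / 𝔪ⁿ⁺¹`. -/
def powTransition (R : CompleteLocalAlg k) (n : ℕ) : R.powQuotient (n + 1) ⟶ R.powQuotient n :=
  quotientLift _ _ (R.powMk n) fun r hr => by
    rw [ringHom_quotientMk_eq_zero_iff]
    exact Ideal.pow_le_pow_right (Nat.le_succ _) hr

theorem powMk_transition (R : CompleteLocalAlg k) (n : ℕ) :
    R.powMk (n + 1) ≫ R.powTransition n = R.powMk n :=
  quotientMk_lift _ _ _ _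

theorem powTransition_surjective (R : CompleteLocalAlg k) (n : ℕ) :
    Function.Surjective (Hom.ringHom (R.powTransition n)) := fun x => by
  obtain ⟨r, rfl⟩ := R.quotientMk_surjective _ _ x
  refine ⟨Hom.ringHom (R.powMk (n + 1)) r, ?_⟩
  rw [← ringHom_comp_apply, powMk_transition]

theorem maximalIdeal_powQuotient_pow (R : CompleteLocalAlg k) (n : ℕ) :
    maximalIdeal (R.powQuotient n) ^ (n + 1) = ⊥ := by
  haveI := isLocalRing_quotient (R.maximalIdeal_pow_succ_ne_top n)
  change maximalIdeal (R ⧸ maximalIdeal R ^ (n + 1)) ^ (n + 1) = ⊥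
  rw [maximalIdeal_quotient, ← Ideal.map_pow]
  exact Ideal.map_quotient_self _

instance (R : CompleteLocalAlg k) (n : ℕ) : IsArtinianRing (R.powQuotient n) :=
  (isArtinianRing_iff_isNilpotent_maximalIdeal _).2 ⟨n + 1, R.maximalIdeal_powQuotient_pow n⟩

end Quotient

/-- A compatible system of maps to `S / 𝔪ⁿ⁺¹` comes from a map to `S`. -/
theorem exists_hom_of_powQuotient {R S : CompleteLocalAlg k} (g : ∀ n, R ⟶ S.powQuotient n)
    (hg : ∀ n, g (n + 1) ≫ S.powTransition n = g n) : ∃ f : R ⟶ S, ∀ n, f ≫ S.powMk n = g n := by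
  have ha : StrictMono fun n : ℕ => n + 1 := fun m n h => Nat.succ_lt_succ h
  let G : ∀ n, R →+* S ⧸ maximalIdeal S ^ (n + 1) := fun n => Hom.ringHom (g n)
  have hG : ∀ {m}, (Ideal.Quotient.factorPow (maximalIdeal S) (ha.monotone m.le_succ)).comp
      (G (m + 1)) = G m := fun {m} => by
    ext r
    refine Eq.trans ?_ (congrArg (fun f => Hom.ringHom f r) (hg m))
    change _ = Hom.ringHom (S.powTransition m) (Hom.ringHom (g (m + 1)) r)
    obtain ⟨s, hs⟩ := S.quotientMk_surjective _ _ (Hom.ringHom (g (m + 1)) r)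
    rw [RingHom.comp_apply]
    change Ideal.Quotient.factorPow _ _ (Hom.ringHom (g (m + 1)) r) = _
    rw [← hs]
    rfl
  let f := IsAdicComplete.StrictMono.liftRingHom (maximalIdeal S) ha G hG
  have hf : ∀ n r, Ideal.Quotient.mk (maximalIdeal S ^ (n + 1)) (f r) = G n r := fun n r =>
    IsAdicComplete.StrictMono.mk_liftRingHom (maximalIdeal S) ha G hG r
  let F : R →ₐ[k] S :=
    { f with
      commutes' := fun c => by
        -- Since `S` is separated, compatibility with scalars may be checked modulo all powers of
        -- `𝔪`, where it holds because each `g n` is a `k`-algebra map.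
        have h : ∀ n, f (algebraMap k R c) ≡ algebraMap k S c
            [SMOD (maximalIdeal S ^ (n + 1) • ⊤ : Submodule S S)] := fun n => by
          rw [smul_eq_mul, Ideal.mul_top]
          refine (hf n _).trans ?_
          exact Hom.ringHom_algebraMap (g n) c
        change f (algebraMap k R c) = algebraMap k S c
        refine sub_eq_zero.1 (IsHausdorff.haus (I := maximalIdeal S) inferInstance _ fun n => ?_)
        rw [SModEq.zero]
        have h1 := SModEq.sub_mem.1 (h n)
        exact Submodule.smul_mono_left (Ideal.pow_le_pow_right n.le_succ) h1 }
  exact ⟨Hom.ofAlgHom F, fun n => hom_ext fun r => hf n r⟩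

end CompleteLocalAlg

/-! ### Uniqueness of hulls -/

namespace CompleteLocalAlg

open IsLocalRing

variable {k : Type u} [Field k]

/-- The homomorphism `R → k[ε]` attached to a linear form that vanishes on `1` and on `𝔪²`. -/
def tangentHom (R : CompleteLocalAlg k) (ψ : R →ₗ[k] k) (h1 : ψ 1 = 0)
    (h2 : ∀ r ∈ maximalIdeal R ^ 2, ψ r = 0) : R ⟶ dualNumber k :=
  Hom.ofAlgHom (show R →ₐ[k] DualNumber k from
    AlgHom.ofLinearMap
      ((Algebra.linearMap k (DualNumber k)).comp R.residueAlgHom.toLinearMap +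
        (DualNumber.eps : DualNumber k) • (Algebra.linearMap k (DualNumber k)).comp ψ)
      (by simp [h1])
      (fun r s => by
        -- The Leibniz rule: the product of `r` and `s`, each minus its residue, lies in `𝔪²`, where
        -- `ψ` vanishes, and `ψ` vanishes on constants.
        have h3 : ψ (r * s) = R.residue r * ψ s + R.residue s * ψ r := by
          have h4 := h2 ((r - algebraMap k R (R.residue r)) * (s - algebraMap k R (R.residue s)))
            (by
              rw [pow_two]
              exact Ideal.mul_mem_mul (R.sub_algebraMap_residue_mem r)
                (R.sub_algebraMap_residue_mem s))
          have h5 : (r - algebraMap k R (R.residue r)) * (s - algebraMap k R (R.residue s)) =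
              r * s - R.residue r • s - R.residue s • r +
                (R.residue r * R.residue s) • 1 := by
            simp only [Algebra.smul_def, map_mul]
            ring
          rw [h5, map_add, map_sub, map_sub, map_smul, map_smul, map_smul, h1] at h4
          simp only [smul_eq_mul, mul_zero, add_zero] at h4
          linear_combination h4
        have hr : ∀ t, R.residueAlgHom t = R.residue t := fun t => rfl
        simp only [LinearMap.add_apply, LinearMap.comp_apply, LinearMap.smul_apply,
          AlgHom.toLinearMap_apply, map_mul, h3, map_add, Algebra.linearMap_apply, smul_eq_mul,
          hr]
        linear_combination (-(algebraMap k (DualNumber k) (ψ r)) *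
          algebraMap k (DualNumber k) (ψ s)) * DualNumber.eps_mul_eps (R := k)))

theorem snd_tangentHom (R : CompleteLocalAlg k) (ψ : R →ₗ[k] k) (h1 : ψ 1 = 0)
    (h2 : ∀ r ∈ maximalIdeal R ^ 2, ψ r = 0) (r : R) :
    TrivSqZeroExt.snd (show DualNumber k from Hom.ringHom (R.tangentHom ψ h1 h2) r) = ψ r := by
  change TrivSqZeroExt.snd (algebraMap k (DualNumber k) (R.residue r) +
    DualNumber.eps * algebraMap k (DualNumber k) (ψ r)) = ψ r
  simp [TrivSqZeroExt.algebraMap_eq_inl]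

/-- By Nakayama the image of `𝔪_R` generates `𝔪_S`. Then `g` is surjective modulo `𝔪_R S`, and
completeness of `R` with separatedness of `S` gives surjectivity. -/
theorem surjective_of_range_add_sq {R S : CompleteLocalAlg k} (g : R ⟶ S)
    (h : ∀ s : S, ∃ r : R, s - Hom.ringHom g r ∈ maximalIdeal S ^ 2) :
    Function.Surjective (Hom.ringHom g) := by
  have hle : (maximalIdeal R).map (Hom.ringHom g) ≤ maximalIdeal S :=
    Ideal.map_le_iff_le_comap.2 fun x hx => ringHom_mem_maximalIdeal g hx
  have hmap : maximalIdeal S = (maximalIdeal R).map (Hom.ringHom g) := by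
    refine le_antisymm ?_ hle
    refine Submodule.le_of_le_smul_of_le_jacobson_bot (I := maximalIdeal S)
      (IsNoetherian.noetherian _) (maximalIdeal_le_jacobson _) fun s hs => ?_
    obtain ⟨r, hr⟩ := h s
    have hr' : r ∈ maximalIdeal R := by
      rw [← residue_eq_zero_iff, ← residue_ringHom g]
      have h1 := (S.residue_eq_zero_iff _).2 (Ideal.pow_le_self two_ne_zero hr)
      rw [map_sub, (S.residue_eq_zero_iff _).2 hs, zero_sub, neg_eq_zero] at h1
      exact h1
    rw [← sub_add_cancel s (Hom.ringHom g r), add_comm]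
    refine Submodule.add_mem_sup (Ideal.mem_map_of_mem _ hr') ?_
    rwa [smul_eq_mul, ← pow_two]
  haveI : IsHausdorff ((maximalIdeal R).map (Hom.ringHom g)) S := hmap ▸ inferInstance
  refine surjective_of_mk_map_comp_surjective (I := maximalIdeal R) (Hom.ringHom g) fun y => ?_
  obtain ⟨s, rfl⟩ := Ideal.Quotient.mk_surjective y
  obtain ⟨r, hr⟩ := h s
  refine ⟨r, ((Ideal.Quotient.mk_eq_mk_iff_sub_mem _ _).2 ?_).symm⟩
  rw [← hmap]
  exact Ideal.pow_le_self two_ne_zero hr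

/-- If the image of `g` together with `𝔪_S²` were proper, a nonzero linear form would vanish on it.
Such a form is a nonzero tangent vector of `S` that becomes trivial on `R`. -/
theorem surjective_of_tangent_injective {R S : CompleteLocalAlg k} (g : R ⟶ S)
    (h : ∀ f f' : S ⟶ dualNumber k, g ≫ f = g ≫ f' → f = f') :
    Function.Surjective (Hom.ringHom g) := by
  refine surjective_of_range_add_sq g ?_
  let U : Submodule k S := LinearMap.range g.toAlgHom.toLinearMap ⊔
    (maximalIdeal S ^ 2).restrictScalars k
  by_cases hU : U = ⊤
  · intro s
    have hs : s ∈ U := hU ▸ Submodule.mem_top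
    obtain ⟨_, ⟨r, rfl⟩, t, ht, rfl⟩ := Submodule.mem_sup.1 hs
    refine ⟨r, ?_⟩
    change g.toAlgHom r + t - g.toAlgHom r ∈ _
    rw [add_sub_cancel_left]
    exact ht
  · exfalso
    obtain ⟨ψ, hψ, hle⟩ := Submodule.exists_le_ker_of_lt_top U (lt_top_iff_ne_top.2 hU)
    have hg : ∀ r, ψ (Hom.ringHom g r) = 0 := fun r =>
      hle (Submodule.mem_sup_left ⟨r, rfl⟩)
    have h1 : ψ 1 = 0 := by rw [← map_one (Hom.ringHom g), hg]
    have h2 : ∀ r ∈ maximalIdeal S ^ 2, ψ r = 0 := fun r hr =>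
      hle (Submodule.mem_sup_right hr)
    have heq := h (S.tangentHom ψ h1 h2) (S.tangentHom 0 rfl fun _ _ => rfl)
      (hom_ext fun r => TrivSqZeroExt.ext ?_ ?_)
    · refine hψ (LinearMap.ext fun s => ?_)
      rw [← snd_tangentHom S ψ h1 h2 s, heq, snd_tangentHom]
    · have hfst : ∀ (ψ : S →ₗ[k] k) (h1 h2) (s : S),
          TrivSqZeroExt.fst (show DualNumber k from Hom.ringHom (S.tangentHom ψ h1 h2) s) =
            S.residue s := fun ψ h1 h2 s => by
        change TrivSqZeroExt.fst (algebraMap k (DualNumber k) (S.residue s) +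
          DualNumber.eps * algebraMap k (DualNumber k) (ψ s)) = S.residue s
        simp [TrivSqZeroExt.algebraMap_eq_inl]
      exact (hfst ψ h1 h2 (Hom.ringHom g r)).trans
        (hfst 0 rfl (fun _ _ => rfl) (Hom.ringHom g r)).symm
    · refine (snd_tangentHom S ψ h1 h2 (Hom.ringHom g r)).trans ?_
      rw [hg]
      exact (snd_tangentHom S 0 rfl (fun _ _ => rfl) (Hom.ringHom g r)).symm

/-- The kernels of the powers of `f` stabilise, say at `n`. Any `x` in the kernel of `f` is `f ^ n`
of some `y`, and then `y` lies in the kernel of `f ^ (n + 1)`, which is that of `f ^ n`. -/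
theorem injective_of_surjective_endomorphism {A : Type*} [CommRing A] [IsNoetherianRing A]
    (f : A →+* A) (hf : Function.Surjective f) : Function.Injective f := by
  let c : ℕ →o Ideal A := ⟨fun n => RingHom.ker (f ^ n), monotone_nat_of_le_succ fun n x hx => by
    rw [RingHom.mem_ker] at hx ⊢
    rw [pow_succ', RingHom.mul_def, RingHom.comp_apply, hx, map_zero]⟩
  obtain ⟨n, hn⟩ := monotone_stabilizes_iff_noetherian.2 (inferInstance : IsNoetherianRing A) c
  have hs : Function.Surjective (f ^ n) := by
    rw [RingHom.coe_pow]
    exact hf.iterate n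
  rw [injective_iff_map_eq_zero]
  intro x hx
  obtain ⟨y, rfl⟩ := hs x
  have h1 : y ∈ c (n + 1) := by
    change (f ^ (n + 1)) y = 0
    rw [pow_succ', RingHom.mul_def, RingHom.comp_apply, hx]
  rw [← hn (n + 1) n.le_succ] at h1
  exact h1

end CompleteLocalAlg

/-! ### Comparison of two hulls -/

namespace IsHull

open CompleteLocalAlg IsLocalRing

variable {k : Type u} [Field k] {F : CompleteLocalAlg k ⥤ Type w}
  {R R' : CompleteLocalAlg k} {ξ : F.obj R} {ξ' : F.obj R'}

/-- A hull maps to any other pair, compatibly modulo the powers of the maximal ideal. -/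
theorem exists_hom (hF : ∀ A : CompleteLocalAlg k, maximalIdeal A = ⊥ → Subsingleton (F.obj A))
    (h : IsHull F R ξ) (ξ' : F.obj R') :
    ∃ g : R ⟶ R', ∀ n, F.map (g ≫ R'.powMk n) ξ = F.map (R'.powMk n) ξ' := by
  let good : ℕ → Type u := fun n =>
    { g : R ⟶ R'.powQuotient n // F.map g ξ = F.map (R'.powMk n) ξ' }
  have h0 : Nonempty (good 0) := by
    have hbot : maximalIdeal (R'.powQuotient 0) = ⊥ := by
      rw [← R'.maximalIdeal_powQuotient_pow 0, zero_add, pow_one]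
    -- Over the residue field `F` has at most one point, so `R → k → R' ⧸ 𝔪` is a valid start.
    -- Smoothness then lifts it one power of `𝔪` at a time.
    haveI := hF _ hbot
    exact ⟨⟨Hom.ofAlgHom ((Algebra.ofId k _).comp R.residueAlgHom), Subsingleton.elim _ _⟩⟩
  have hsucc : ∀ n (g : good n), ∃ g' : good (n + 1), g'.1 ≫ R'.powTransition n = g.1 := by
    intro n g
    obtain ⟨g', h1, h2⟩ := h.smooth _ _ (R'.powTransition n) (R'.powTransition_surjective n) g.1
      (F.map (R'.powMk (n + 1)) ξ') (by
        rw [g.2, ← R'.powMk_transition n, F.map_comp]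
        rfl)
    exact ⟨⟨g', h2⟩, h1⟩
  choose next hnext using hsucc
  let g : ∀ n, good n := fun n => Nat.rec h0.some next n
  obtain ⟨f, hf⟩ := exists_hom_of_powQuotient (fun n => (g n).1) fun n => hnext n (g n)
  exact ⟨f, fun n => by rw [hf]; exact (g n).2⟩

/-- Maps to `k[ε]` kill `𝔪²`, so agreement of the classes modulo `𝔪²` shows that the class attached
to `f` depends only on `g ≫ f`. Injectivity on tangent spaces of the hull `R'` then applies. -/
theorem surjective_of_compatible (h' : IsHull F R' ξ') (g : R ⟶ R')
    (hg : F.map (g ≫ R'.powMk 1) ξ = F.map (R'.powMk 1) ξ') :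
    Function.Surjective (Hom.ringHom g) := by
  have key : ∀ f : R' ⟶ dualNumber k, F.map f ξ' = F.map (g ≫ f) ξ := fun f => by
    have hker : ∀ r ∈ maximalIdeal R' ^ 2, Hom.ringHom f r = 0 := fun r hr => by
      have h1 : Hom.ringHom f r ∈ maximalIdeal (DualNumber k) ^ 2 :=
        ringHom_mem_maximalIdeal_pow f hr
      rwa [dualNumber_maximalIdeal_sq] at h1
    have hfac := quotientMk_lift _ (R'.maximalIdeal_pow_succ_ne_top 1) f hker
    rw [← hfac, F.map_comp, ← Category.assoc, F.map_comp]
    exact congrArg _ hg.symm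
  refine surjective_of_tangent_injective g fun f f' hff' => h'.tangent.1 ?_
  change F.map f ξ' = F.map f' ξ'
  rw [key, key, hff']

/-- The comparison maps respect the classes only modulo each power of `𝔪`, and they need not be
mutually inverse. Both are surjective, and the composite is a surjective endomorphism of a
Noetherian ring, which is enough. -/
theorem nonempty_iso
    (hF : ∀ A : CompleteLocalAlg k, maximalIdeal A = ⊥ → Subsingleton (F.obj A))
    (h : IsHull F R ξ) (h' : IsHull F R' ξ') : Nonempty (R ≅ R') := by
  obtain ⟨g, hg⟩ := h.exists_hom hF ξ'
  obtain ⟨g', hg'⟩ := h'.exists_hom hF ξ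
  have hs := h'.surjective_of_compatible g (hg 1)
  have hs' := h.surjective_of_compatible g' (hg' 1)
  have hinj := injective_of_surjective_endomorphism (Hom.ringHom (g ≫ g')) (hs'.comp hs)
  exact CompleteLocalAlg.nonempty_iso_of_bijective g ⟨Function.Injective.of_comp hinj, hs⟩

theorem of_iso {G : CompleteLocalAlg k ⥤ Type w} (e : F ≅ G) (h : IsHull F R ξ) :
    IsHull G R (e.hom.app R ξ) := by
  have hnat : ∀ {A B : CompleteLocalAlg k} (f : A ⟶ B) (x : F.obj A),
      G.map f (e.hom.app A x) = e.hom.app B (F.map f x) := fun f x =>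
    (NatTrans.naturality_apply e.hom f x).symm
  have hinv : ∀ {A : CompleteLocalAlg k} (x : G.obj A), e.hom.app A (e.inv.app A x) = x :=
    fun {A} x => by simp
  have hinv' : ∀ {A : CompleteLocalAlg k} (x : F.obj A), e.inv.app A (e.hom.app A x) = x :=
    fun {A} x => by simp
  refine ⟨fun A B _ _ p hp g η hη => ?_, ?_⟩
  · obtain ⟨f, h1, h2⟩ := h.smooth A B p hp g (e.inv.app B η) (by
      rw [← hinv' (F.map g ξ), ← hnat, ← hη]
      exact (NatTrans.naturality_apply e.inv p η).symm)
    exact ⟨f, h1, by rw [hnat, h2, hinv]⟩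
  · have h1 : (fun f : R ⟶ dualNumber k => G.map f (e.hom.app R ξ)) =
        fun f => e.hom.app _ (F.map f ξ) := funext fun f => hnat f ξ
    rw [h1]
    exact (Function.bijective_iff_has_inverse.2 ⟨_, hinv', hinv⟩).comp h.tangent

end IsHull

/-- Representability is invariant under isomorphism of functors and of objects. -/
theorem exists_bijective_map_of_iso {C : Type*} [Category C] {F G : C ⥤ Type w}
    (e : F ≅ G) {R R' : C} (i : R ≅ R')
    (h : ∃ ξ : F.obj R, ∀ S, Function.Bijective fun α : R ⟶ S => F.map α ξ) :
    ∃ ξ : G.obj R', ∀ S, Function.Bijective fun α : R' ⟶ S => G.map α ξ := by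
  obtain ⟨ξ, hξ⟩ := h
  refine ⟨G.map i.hom (e.hom.app R ξ), fun S => ?_⟩
  have h1 : (fun α : R' ⟶ S => G.map α (G.map i.hom (e.hom.app R ξ))) =
      fun α => e.hom.app S (F.map (i.hom ≫ α) ξ) := funext fun α => by
    rw [NatTrans.naturality_apply, G.map_comp]
    rfl
  rw [h1]
  have h2 : Function.Bijective (e.hom.app S) := Function.bijective_iff_has_inverse.2
    ⟨e.inv.app S, fun x => by simp, fun x => by simp⟩
  have h3 : Function.Bijective fun α : R' ⟶ S => i.hom ≫ α :=
    Function.bijective_iff_has_inverse.2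
      ⟨fun α => i.inv ≫ α, fun α => by simp, fun α => by simp⟩
  exact h2.comp ((hξ S).comp h3)

theorem deformationFunctor_subsingleton {k : Type u} [Field k] (Λ : Type u) [Ring Λ]
    [Algebra k Λ] (V : Type u) [AddCommGroup V] [Module Λ V] (A : CompleteLocalAlg k)
    (hA : IsLocalRing.maximalIdeal A = ⊥) :
    Subsingleton ((deformationFunctor (k := k) Λ V).obj A) :=
  ⟨fun x y => Quotient.inductionOn₂ x y fun L L' =>
    Quotient.sound (ModuleLift.isomorphic_of_maximalIdeal_eq_bot hA L L')⟩

/-! ### Power series rings -/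

namespace CompleteLocalAlg

open IsLocalRing

variable {k : Type u} [Field k] {σ : Type}

theorem mvPowerSeries_mem_maximalIdeal_iff (f : MvPowerSeries σ k) :
    f ∈ maximalIdeal (MvPowerSeries σ k) ↔ MvPowerSeries.constantCoeff f = 0 := by
  rw [mem_maximalIdeal, mem_nonunits_iff, MvPowerSeries.isUnit_iff_constantCoeff,
    isUnit_iff_ne_zero, not_not]

variable [Finite σ]

/-- The power series ring is the completion of the polynomial ring at the ideal of the variables.
That ideal is finitely generated, so its extension is the kernel of evaluation at the first level,
the series without constant term. -/
theorem mvPowerSeries_maximalIdeal :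
    maximalIdeal (MvPowerSeries σ k) = Ideal.span (Set.range MvPowerSeries.X) := by
  refine le_antisymm (fun f hf => ?_) (Ideal.span_le.2 ?_)
  · rw [mvPowerSeries_mem_maximalIdeal_iff] at hf
    let e := (MvPowerSeries.toAdicCompletionAlgEquiv σ k).toRingEquiv
    have he : Ideal.map e (Ideal.span (Set.range MvPowerSeries.X)) =
        (MvPolynomial.idealOfVars σ k).map (algebraMap ..) := by
      simp_rw [Ideal.map_span, ← Set.range_comp]
      congr 2
      ext1
      simp [e, AdicCompletion.algebraMap_apply, ← MvPolynomial.coe_X,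
        MvPowerSeries.toAdicCompletion_coe]
    have h1 : e f ∈ Ideal.map e (Ideal.span (Set.range MvPowerSeries.X)) := by
      rw [he, ← AdicCompletion.ker_evalOneₐ_eq_map _ (MvPolynomial.idealOfVars_fg σ k)]
      change AdicCompletion.evalOneₐ _ (MvPowerSeries.toAdicCompletion σ k f) = 0
      have h3 : MvPowerSeries.truncTotal 1 f ∈ MvPolynomial.idealOfVars σ k ^ 1 := by
        rw [MvPolynomial.mem_pow_idealOfVars_iff']
        intro x hx
        rw [MvPowerSeries.coeff_truncTotal _ hx]
        rw [Nat.lt_one_iff, Finsupp.degree_eq_zero_iff] at hx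
        rw [hx]
        exact hf
      rw [MvPowerSeries.toAdicCompletion, AdicCompletion.evalOneₐ_liftAlgHom _ _ fun h =>
        AlgHom.ext fun _ => (Ideal.Quotient.mk_eq_mk_iff_sub_mem _ _).2
          (MvPowerSeries.truncTotal_sub_truncTotal_mem_pow_idealOfVars h le_rfl _),
        MvPowerSeries.truncTotalAlgHom_apply, Ideal.Quotient.eq_zero_iff_mem.2 h3, map_zero]
    rw [Ideal.mem_map_of_equiv] at h1
    obtain ⟨g, hg, hgf⟩ := h1
    exact e.injective hgf ▸ hg
  · rintro _ ⟨s, rfl⟩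
    exact (mvPowerSeries_mem_maximalIdeal_iff _).2 (MvPowerSeries.constantCoeff_X s)

variable (k σ) in
/-- The power series ring `k⟦X_s | s ∈ σ⟧`. -/
def mvPowerSeries : CompleteLocalAlg k where
  carrier := MvPowerSeries σ k
  isAdicComplete := by
    rw [mvPowerSeries_maximalIdeal]
    infer_instance
  residue_bijective := by
    refine ⟨(algebraMap k _).injective, fun y => ?_⟩
    obtain ⟨f, rfl⟩ := IsLocalRing.residue_surjective y
    refine ⟨MvPowerSeries.constantCoeff f, ?_⟩
    change IsLocalRing.residue _ (algebraMap k (MvPowerSeries σ k) _) = _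
    rw [← sub_eq_zero, ← map_sub, IsLocalRing.residue_eq_zero_iff,
      mvPowerSeries_mem_maximalIdeal_iff]
    simp [MvPowerSeries.algebraMap_apply]

/-- The coordinates of the power series ring. -/
def mvPowerSeriesX (s : σ) : mvPowerSeries k σ := (MvPowerSeries.X s : MvPowerSeries σ k)

theorem maximalIdeal_mvPowerSeries :
    maximalIdeal (mvPowerSeries k σ) = Ideal.span (Set.range mvPowerSeriesX) :=
  mvPowerSeries_maximalIdeal

theorem mvPowerSeriesX_mem (s : σ) : mvPowerSeriesX s ∈ maximalIdeal (mvPowerSeries k σ) := by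
  rw [maximalIdeal_mvPowerSeries]
  exact Ideal.subset_span ⟨s, rfl⟩

/-- The difference `f - g` takes values in every power of `𝔪_B`, by induction. On the generators of
`𝔪` it vanishes, and `f(a x) - g(a x) = f(a) (f x - g x) + (f a - g a) g(x)` gains one power.
Constants do not contribute. -/
theorem mvPowerSeries_hom_ext {B : CompleteLocalAlg k} {f g : mvPowerSeries k σ ⟶ B}
    (h : ∀ s, Hom.ringHom f (mvPowerSeriesX s) = Hom.ringHom g (mvPowerSeriesX s)) : f = g := by
  have key : ∀ (n : ℕ) r, Hom.ringHom f r - Hom.ringHom g r ∈ maximalIdeal B ^ n := by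
    intro n
    induction n with
    | zero => simp
    | succ n ih =>
      have hm : ∀ r ∈ maximalIdeal (mvPowerSeries k σ),
          Hom.ringHom f r - Hom.ringHom g r ∈ maximalIdeal B ^ (n + 1) := by
        intro r hr
        rw [maximalIdeal_mvPowerSeries] at hr
        refine Submodule.span_induction ?_ ?_ (fun x y _ _ hx hy => ?_)
          (fun a x hx' hx => ?_) hr
        · rintro _ ⟨s, rfl⟩
          rw [h, sub_self]
          exact zero_mem _
        · simp
        · rw [map_add, map_add, add_sub_add_comm]
          exact add_mem hx hy
        · rw [smul_eq_mul, map_mul, map_mul, ← sub_add_sub_cancel _ (Hom.ringHom f a * Hom.ringHom g x),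
            ← mul_sub, ← sub_mul]
          refine add_mem (Ideal.mul_mem_left _ _ hx) ?_
          rw [pow_succ]
          refine Ideal.mul_mem_mul (ih a) (ringHom_mem_maximalIdeal g ?_)
          rw [maximalIdeal_mvPowerSeries]
          exact hx'
      intro r
      have h1 := hm _ (sub_algebraMap_residue_mem _ r)
      rwa [map_sub, map_sub, Hom.ringHom_algebraMap, Hom.ringHom_algebraMap,
        sub_sub_sub_cancel_right] at h1
  refine hom_ext fun r => ?_
  refine sub_eq_zero.1 (IsHausdorff.haus (I := maximalIdeal B) inferInstance _ fun n => ?_)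
  rw [SModEq.zero, smul_eq_mul, Ideal.mul_top]
  exact key n r

/-- Some power `𝔪 ^ n` of the maximal ideal of the Artinian ring `B` is zero, so evaluation at `x`
depends only on the truncation in degrees below `n`. -/
theorem exists_mvPowerSeries_hom {B : CompleteLocalAlg k} [IsArtinianRing B] (x : σ → B)
    (hx : ∀ s, x s ∈ maximalIdeal B) :
    ∃ f : mvPowerSeries k σ ⟶ B, ∀ s, Hom.ringHom f (mvPowerSeriesX s) = x s := by
  obtain ⟨n, hn⟩ := (isArtinianRing_iff_isNilpotent_maximalIdeal B).1 inferInstance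
  have hle : MvPolynomial.idealOfVars σ k ^ n ≤ RingHom.ker (MvPolynomial.aeval (R := k) x) := by
    have h1 : (MvPolynomial.idealOfVars σ k).map (MvPolynomial.aeval (R := k) x) ≤
        maximalIdeal B := by
      rw [Ideal.map_span, Ideal.span_le]
      rintro _ ⟨_, ⟨s, rfl⟩, rfl⟩
      rw [MvPolynomial.aeval_X]
      exact hx s
    intro p hp
    have h2 := Ideal.mem_map_of_mem (MvPolynomial.aeval (R := k) x) hp
    rw [Ideal.map_pow] at h2
    have h3 := Ideal.pow_right_mono h1 n h2
    rw [hn] at h3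
    exact h3
  let f : MvPowerSeries σ k →ₐ[k] B := (Ideal.Quotient.liftₐ _ (MvPolynomial.aeval (R := k) x)
    fun p hp => hle hp).comp ((MvPowerSeries.truncTotalAlgHom σ k n).restrictScalars k)
  refine ⟨Hom.ofAlgHom f, fun s => ?_⟩
  change f (MvPowerSeries.X s) = x s
  have h1 : MvPowerSeries.truncTotalAlgHom σ k n (MvPowerSeries.X s) =
      Ideal.Quotient.mk _ (MvPolynomial.X s) := by
    rw [← MvPolynomial.coe_X]
    exact (MvPowerSeries.truncTotalAlgHom σ k n).commutes (MvPolynomial.X s)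
  change Ideal.Quotient.liftₐ _ (MvPolynomial.aeval (R := k) x) (fun p hp => hle hp)
    (MvPowerSeries.truncTotalAlgHom σ k n (MvPowerSeries.X s)) = _
  rw [h1]
  exact MvPolynomial.aeval_X x s

end CompleteLocalAlg

/-! ### Deformations of matrix representations -/

namespace MatrixRep

open IsLocalRing CompleteLocalAlg

variable {k : Type u} [Field k] {Λ : Type u} [Ring Λ] [Algebra k Λ] {δ ι : Type}
  [Fintype ι] [DecidableEq ι]

/-- The matrix representation `φ` over `B` reduces to `ρ`. -/
def IsFramed (ρ : Λ →ₐ[k] Matrix ι ι k) {B : CompleteLocalAlg k} (φ : Λ →ₐ[k] Matrix ι ι B) :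
    Prop :=
  ∀ a i j, B.residue (φ a i j) = ρ a i j

/-- The extension of scalars of a matrix representation. -/
def push {A B : CompleteLocalAlg k} (f : A ⟶ B) (φ : Λ →ₐ[k] Matrix ι ι A) :
    Λ →ₐ[k] Matrix ι ι B :=
  (Hom.toAlgHom f).mapMatrix.comp φ

theorem push_apply {A B : CompleteLocalAlg k} (f : A ⟶ B) (φ : Λ →ₐ[k] Matrix ι ι A) (a : Λ) :
    push f φ a = (φ a).map (Hom.ringHom f) := rfl

theorem push_comp {A B D : CompleteLocalAlg k} (f : A ⟶ B) (g : B ⟶ D)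
    (φ : Λ →ₐ[k] Matrix ι ι A) : push g (push f φ) = push (f ≫ g) φ := rfl

variable {ρ : Λ →ₐ[k] Matrix ι ι k}

theorem IsFramed.push {A B : CompleteLocalAlg k} {φ : Λ →ₐ[k] Matrix ι ι A} (hφ : IsFramed ρ φ)
    (f : A ⟶ B) : IsFramed ρ (push f φ) := fun a i j =>
  (residue_ringHom f _).trans (hφ a i j)

theorem IsFramed.sub_mem {B : CompleteLocalAlg k} {φ : Λ →ₐ[k] Matrix ι ι B}
    (hφ : IsFramed ρ φ) (a : Λ) (i j : ι) :
    φ a i j - algebraMap k B (ρ a i j) ∈ maximalIdeal B := by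
  rw [← hφ]
  exact B.sub_algebraMap_residue_mem _

theorem isUnit_det {B : CompleteLocalAlg k} (v : Matrix ι ι B)
    (hv : v.map B.residue = 1) : IsUnit v.det := by
  by_contra h
  have h1 : B.residue v.det = 0 := (B.residue_eq_zero_iff _).2 h
  rw [RingHom.map_det, RingHom.mapMatrix_apply, hv, Matrix.det_one] at h1
  exact one_ne_zero h1

theorem exists_conj {B : CompleteLocalAlg k} (v : Matrix ι ι B) (hv : v.map B.residue = 1)
    {φ : Λ →ₐ[k] Matrix ι ι B} (hφ : IsFramed ρ φ) :
    ∃ φ' : Λ →ₐ[k] Matrix ι ι B, IsFramed ρ φ' ∧ ∀ a, φ' a * v = v * φ a := by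
  have hu := isUnit_det v hv
  let φ' : Λ →ₐ[k] Matrix ι ι B := AlgHom.ofLinearMap
    ((LinearMap.mulRight k v⁻¹ ∘ₗ LinearMap.mulLeft k v) ∘ₗ φ.toLinearMap)
    (by simp [Matrix.mul_nonsing_inv v hu])
    (fun a b => by
      change v * φ (a * b) * v⁻¹ = (v * φ a * v⁻¹) * (v * φ b * v⁻¹)
      rw [map_mul, mul_assoc (v * φ a), ← mul_assoc v⁻¹, ← mul_assoc v⁻¹,
        Matrix.nonsing_inv_mul v hu, one_mul]
      simp only [mul_assoc])
  have h' : ∀ a, φ' a * v = v * φ a := fun a => by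
    change v * φ a * v⁻¹ * v = v * φ a
    rw [mul_assoc, Matrix.nonsing_inv_mul v hu, mul_one]
  refine ⟨φ', fun a i j => ?_, h'⟩
  have h1 := congrArg (fun M : Matrix ι ι B => M.map B.residue) (h' a)
  simp only [Matrix.map_mul, hv, mul_one, one_mul] at h1
  exact (congrFun (congrFun h1 i) j).trans (hφ a i j)

section Coordinates

variable (d : Module.Basis δ k Λ) (ρ)

/-- The linear family of matrices with given coordinates, centered at `ρ`. -/
def family {B : CompleteLocalAlg k} (x : δ × ι × ι → B) : Λ →ₗ[k] Matrix ι ι B :=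
  d.constr k fun s => Matrix.of fun i j => algebraMap k B (ρ (d s) i j) + x (s, i, j)

theorem family_basis {B : CompleteLocalAlg k} (x : δ × ι × ι → B) (s : δ) (i j : ι) :
    family ρ d x (d s) i j = algebraMap k B (ρ (d s) i j) + x (s, i, j) := by
  rw [family, Module.Basis.constr_basis, Matrix.of_apply]

theorem map_family {A B : CompleteLocalAlg k} (f : A ⟶ B) (x : δ × ι × ι → A) (a : Λ) :
    (family ρ d x a).map (Hom.ringHom f) = family ρ d (fun s => Hom.ringHom f (x s)) a := by
  have h : (Hom.toAlgHom f).mapMatrix.toLinearMap ∘ₗ family ρ d x =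
      family ρ d fun s => Hom.ringHom f (x s) := d.ext fun s => by
    ext i j
    rw [family_basis]
    change Hom.ringHom f (family ρ d x (d s) i j) = _
    rw [family_basis, map_add, Hom.ringHom_algebraMap]
  exact LinearMap.congr_fun h a

/-- The coordinates of a representation, relative to `ρ`. -/
def coords {B : CompleteLocalAlg k} (φ : Λ →ₐ[k] Matrix ι ι B) (s : δ × ι × ι) : B :=
  φ (d s.1) s.2.1 s.2.2 - algebraMap k B (ρ (d s.1) s.2.1 s.2.2)

theorem family_coords {B : CompleteLocalAlg k} (φ : Λ →ₐ[k] Matrix ι ι B) :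
    family ρ d (coords ρ d φ) = φ.toLinearMap := d.ext fun s => by
  ext i j
  rw [family_basis, coords, add_sub_cancel]
  rfl

theorem coords_push {A B : CompleteLocalAlg k} (f : A ⟶ B) (φ : Λ →ₐ[k] Matrix ι ι A)
    (s : δ × ι × ι) : coords ρ d (push f φ) s = Hom.ringHom f (coords ρ d φ s) := by
  rw [coords, coords, map_sub, Hom.ringHom_algebraMap]
  rfl

/-- The matrix of `N ↦ (N ρ(d_s) - ρ(d_s) N)_s`. -/
def commutatorMatrix : Matrix (δ × ι × ι) (ι × ι) k := fun s p =>
  (if s.2.1 = p.1 then ρ (d s.1) p.2 s.2.2 else 0) -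
    if p.2 = s.2.2 then ρ (d s.1) s.2.1 p.1 else 0

theorem commutatorMatrix_mulVec {B : CompleteLocalAlg k} (N : Matrix ι ι B) (s : δ × ι × ι) :
    ((commutatorMatrix ρ d).map (algebraMap k B)).mulVec (fun p => N p.1 p.2) s =
      (N * (ρ (d s.1)).map (algebraMap k B) - (ρ (d s.1)).map (algebraMap k B) * N)
        s.2.1 s.2.2 := by
  simp only [Matrix.mulVec, dotProduct, Fintype.sum_prod_type, Matrix.map_apply,
    commutatorMatrix, map_sub, sub_mul, Finset.sum_sub_distrib, Matrix.sub_apply,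
    Matrix.mul_apply]
  congr 1
  · rw [Finset.sum_eq_single s.2.1]
    · refine Finset.sum_congr rfl fun q _ => ?_
      rw [if_pos rfl, mul_comm]
    · intro p _ hp
      simp [Ne.symm hp]
    · simp
  · refine Finset.sum_congr rfl fun p _ => ?_
    rw [Finset.sum_eq_single s.2.2]
    · rw [if_pos rfl]
    · intro q _ hq
      simp [hq]
    · simp

/-- To first order, conjugation by `1 + N` translates the coordinates by the commutator. -/
theorem coords_sub_mem {B : CompleteLocalAlg k} {φ φ' : Λ →ₐ[k] Matrix ι ι B}
    (hφ : IsFramed ρ φ) (hφ' : IsFramed ρ φ') (N : Matrix ι ι B) (I : Ideal B)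
    (hN : ∀ i j, N i j ∈ I) (h : ∀ a, φ' a * (1 + N) = (1 + N) * φ a) (s : δ × ι × ι) :
    coords ρ d φ' s - coords ρ d φ s -
      ((commutatorMatrix ρ d).map (algebraMap k B)).mulVec (fun p => N p.1 p.2) s ∈
        maximalIdeal B * I := by
  obtain ⟨s, i, j⟩ := s
  rw [commutatorMatrix_mulVec]
  set r := (ρ (d s)).map (algebraMap k B) with hr
  -- Subtracting the commutator with the constant matrix `r` leaves products of entries of `N` with
  -- entries of `φ - r` or `φ' - r`. The latter lie in `𝔪`.
  have h1 : φ' (d s) - φ (d s) - (N * r - r * N) =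
      N * (φ (d s) - r) - (φ' (d s) - r) * N := by
    have h2 := h (d s)
    rw [mul_add, add_mul, mul_one, one_mul] at h2
    rw [mul_sub, sub_mul, sub_eq_sub_iff_add_eq_add.2 (h2.trans (add_comm _ _))]
    abel
  have h3 : coords ρ d φ' (s, i, j) - coords ρ d φ (s, i, j) - (N * r - r * N) i j =
      (N * (φ (d s) - r) - (φ' (d s) - r) * N) i j := by
    rw [← h1, coords, coords, sub_sub_sub_cancel_right]
    rfl
  rw [h3, Matrix.sub_apply, Matrix.mul_apply, Matrix.mul_apply]
  refine sub_mem (Ideal.sum_mem _ fun q _ => ?_) (Ideal.sum_mem _ fun q _ => ?_)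
  · rw [mul_comm (N i q)]
    exact Ideal.mul_mem_mul (hφ.sub_mem (d s) q j) (hN i q)
  · exact Ideal.mul_mem_mul (hφ'.sub_mem (d s) i q) (hN q j)

end Coordinates

end MatrixRep

theorem Matrix.mulVec_mem_ideal {m n B : Type*} [Fintype n] [CommRing B] (M : Matrix m n B)
    {I : Ideal B} {x : n → B} (hx : ∀ i, x i ∈ I) (j : m) : M.mulVec x j ∈ I :=
  Ideal.sum_mem _ fun i _ => Ideal.mul_mem_left _ _ (hx i)

/-- Every matrix over a field has a generalized inverse. -/
theorem Matrix.exists_mul_mul_eq_self {k m n : Type*} [Field k] [Fintype m] [DecidableEq m]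
    [Fintype n] [DecidableEq n] (C : Matrix m n k) : ∃ T : Matrix n m k, C * T * C = C := by
  let f := Matrix.toLin' C
  -- The generalized inverse is a section of `C` over its range, extended arbitrarily to the whole
  -- space.
  obtain ⟨g, hg⟩ := f.rangeRestrict.exists_rightInverse_of_surjective f.range_rangeRestrict
  obtain ⟨g', hg'⟩ := LinearMap.exists_extend g
  refine ⟨LinearMap.toMatrix' g', Matrix.toLin'.injective ?_⟩
  rw [Matrix.toLin'_mul, Matrix.toLin'_mul, Matrix.toLin'_toMatrix']
  refine LinearMap.ext fun x => ?_
  have h1 : g' (f x) = g (f.rangeRestrict x) := LinearMap.congr_fun hg' (f.rangeRestrict x)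
  have h2 := congrArg Subtype.val (LinearMap.congr_fun hg (f.rangeRestrict x))
  change f (g' (f x)) = f x
  rw [h1]
  exact h2

/-! ### The hull of the functor of deformations of a matrix representation -/

namespace MatrixRep

open IsLocalRing CompleteLocalAlg

variable {k : Type u} [Field k] {Λ : Type u} [Ring Λ] [Algebra k Λ] {δ ι : Type}
  [Fintype δ] [Fintype ι] [DecidableEq ι]
  (ρ : Λ →ₐ[k] Matrix ι ι k) (d : Module.Basis δ k Λ) (T : Matrix (ι × ι) (δ × ι × ι) k)

/-- The slice transversal to the conjugation orbits, given by a generalized inverse `T` of the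
commutator matrix. -/
def slice {B : CompleteLocalAlg k} (x : δ × ι × ι → B) : δ × ι × ι → B :=
  ((commutatorMatrix ρ d * T).map (algebraMap k B)).mulVec x

theorem map_slice {A B : CompleteLocalAlg k} (f : A ⟶ B) (x : δ × ι × ι → A) (s : δ × ι × ι) :
    Hom.ringHom f (slice ρ d T x s) = slice ρ d T (fun t => Hom.ringHom f (x t)) s := by
  simp only [slice, Matrix.mulVec, dotProduct, map_sum, map_mul, Matrix.map_apply,
    Hom.ringHom_algebraMap]

/-- The coordinates `x` define a representation in the slice. -/
def IsSolution {B : CompleteLocalAlg k} (x : δ × ι × ι → B) : Prop :=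
  family ρ d x 1 = 1 ∧ (∀ a b, family ρ d x (a * b) = family ρ d x a * family ρ d x b) ∧
    ∀ s, slice ρ d T x s = 0

variable {ρ d T} in
theorem IsSolution.of_coords {B : CompleteLocalAlg k} {φ : Λ →ₐ[k] Matrix ι ι B}
    (h : ∀ s, slice ρ d T (coords ρ d φ) s = 0) : IsSolution ρ d T (coords ρ d φ) := by
  refine ⟨?_, fun a b => ?_, h⟩
  · rw [family_coords]
    exact map_one φ
  · rw [family_coords]
    exact map_mul φ a b

/-- The ideal of equations for solutions. -/
def relations : Ideal (mvPowerSeries k (δ × ι × ι)) :=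
  Ideal.span {r | (∃ i j, r = (family ρ d mvPowerSeriesX 1 - 1) i j) ∨
    (∃ a b i j, r = (family ρ d mvPowerSeriesX (a * b) -
      family ρ d mvPowerSeriesX a * family ρ d mvPowerSeriesX b) i j) ∨
    ∃ s, r = slice ρ d T mvPowerSeriesX s}

theorem forall_relations_iff {B : CompleteLocalAlg k} (f : mvPowerSeries k (δ × ι × ι) ⟶ B) :
    (∀ r ∈ relations ρ d T, Hom.ringHom f r = 0) ↔
      IsSolution ρ d T fun s => Hom.ringHom f (mvPowerSeriesX s) := by
  have h1 : ∀ i j, Hom.ringHom f ((family ρ d mvPowerSeriesX 1 - 1) i j) =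
      (family ρ d (fun s => Hom.ringHom f (mvPowerSeriesX s)) 1 - 1) i j := fun i j => by
    rw [← map_family, Matrix.sub_apply, Matrix.sub_apply, map_sub, Matrix.map_apply,
      Matrix.one_apply, Matrix.one_apply, apply_ite (Hom.ringHom f), map_one (Hom.ringHom f),
      map_zero]
  have h2 : ∀ a b i j, Hom.ringHom f ((family ρ d mvPowerSeriesX (a * b) -
      family ρ d mvPowerSeriesX a * family ρ d mvPowerSeriesX b) i j) =
      (family ρ d (fun s => Hom.ringHom f (mvPowerSeriesX s)) (a * b) -
        family ρ d (fun s => Hom.ringHom f (mvPowerSeriesX s)) a *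
        family ρ d (fun s => Hom.ringHom f (mvPowerSeriesX s)) b) i j := fun a b i j => by
    rw [← map_family, ← map_family, ← map_family, ← Matrix.map_mul, Matrix.sub_apply,
      Matrix.sub_apply, map_sub, Matrix.map_apply, Matrix.map_apply]
  constructor
  · intro h
    refine ⟨?_, fun a b => ?_, fun s => ?_⟩
    · ext i j
      rw [← sub_eq_zero, ← Matrix.sub_apply, ← h1]
      exact h _ (Ideal.subset_span (Or.inl ⟨i, j, rfl⟩))
    · ext i j
      rw [← sub_eq_zero, ← Matrix.sub_apply, ← h2]
      exact h _ (Ideal.subset_span (Or.inr (Or.inl ⟨a, b, i, j, rfl⟩)))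
    · rw [← map_slice]
      exact h _ (Ideal.subset_span (Or.inr (Or.inr ⟨s, rfl⟩)))
  · rintro ⟨hone, hmul, hsl⟩
    change relations ρ d T ≤ RingHom.ker (Hom.ringHom f)
    refine Ideal.span_le.2 ?_
    rintro _ (⟨i, j, rfl⟩ | ⟨a, b, i, j, rfl⟩ | ⟨s, rfl⟩)
    · refine (h1 i j).trans ?_
      rw [hone, sub_self]
      rfl
    · refine (h2 a b i j).trans ?_
      rw [hmul, sub_self]
      rfl
    · exact (map_slice ρ d T f _ s).trans (hsl s)

variable {ρ d T} in
theorem exists_hom_of_isSolution {B : CompleteLocalAlg k} [IsArtinianRing B]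
    {x : δ × ι × ι → B} (hx : ∀ s, x s ∈ maximalIdeal B) (h : IsSolution ρ d T x) :
    ∃ f : mvPowerSeries k (δ × ι × ι) ⟶ B, (∀ s, Hom.ringHom f (mvPowerSeriesX s) = x s) ∧
      ∀ r ∈ relations ρ d T, Hom.ringHom f r = 0 := by
  obtain ⟨f, hf⟩ := exists_mvPowerSeries_hom x hx
  refine ⟨f, hf, (forall_relations_iff ρ d T f).2 ?_⟩
  rwa [funext hf]

/-- The constant representation `ρ` is a solution over the residue field, with all coordinates zero.
The corresponding homomorphism kills the relations but not `1`. -/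
theorem relations_ne_top : relations ρ d T ≠ ⊤ := by
  intro h
  let B := (mvPowerSeries k (δ × ι × ι)).powQuotient 0
  let φ : Λ →ₐ[k] Matrix ι ι B := (Algebra.ofId k B).mapMatrix.comp ρ
  have hφ : coords ρ d φ = 0 := funext fun s => sub_self _
  have h0 : IsSolution ρ d T (coords ρ d φ) := IsSolution.of_coords fun s => by
    rw [hφ, slice, Matrix.mulVec_zero]
    rfl
  obtain ⟨f, -, hf⟩ := exists_hom_of_isSolution
    (fun s => by rw [hφ]; exact zero_mem (maximalIdeal B)) h0
  have h1 := hf 1 (h ▸ Submodule.mem_top)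
  rw [map_one] at h1
  exact one_ne_zero h1

/-- The ring of the hull. -/
abbrev hullRing : CompleteLocalAlg k :=
  (mvPowerSeries k (δ × ι × ι)).quotient (relations ρ d T) (relations_ne_top ρ d T)

/-- The coordinates of the versal representation. -/
def hullCoords (s : δ × ι × ι) : hullRing ρ d T :=
  Hom.ringHom (quotientMk _ (relations ρ d T) (relations_ne_top ρ d T)) (mvPowerSeriesX s)

theorem isSolution_hullCoords : IsSolution ρ d T (hullCoords ρ d T) :=
  (forall_relations_iff ρ d T _).1 fun r hr =>
    (ringHom_quotientMk_eq_zero_iff _ (relations ρ d T) (relations_ne_top ρ d T) r).2 hr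

/-- The versal representation. -/
def hullRep : Λ →ₐ[k] Matrix ι ι (hullRing ρ d T) :=
  AlgHom.ofLinearMap (family ρ d (hullCoords ρ d T)) (isSolution_hullCoords ρ d T).1
    (isSolution_hullCoords ρ d T).2.1

theorem coords_hullRep : coords ρ d (hullRep ρ d T) = hullCoords ρ d T := funext fun s => by
  change family ρ d (hullCoords ρ d T) (d s.1) s.2.1 s.2.2 - _ = _
  rw [family_basis, add_sub_cancel_left]

theorem isFramed_hullRep : IsFramed ρ (hullRep ρ d T) := by
  have h : (residueAlgHom (hullRing ρ d T)).mapMatrix.toLinearMap ∘ₗ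
      (hullRep ρ d T).toLinearMap = ρ.toLinearMap := d.ext fun s => by
    ext i j
    change (hullRing ρ d T).residue (family ρ d (hullCoords ρ d T) (d s) i j) = _
    rw [family_basis, map_add, residue_algebraMap, hullCoords, residue_ringHom,
      (residue_eq_zero_iff _ _).2 (mvPowerSeriesX_mem _), add_zero]
    rfl
  exact fun a i j => congrFun (congrFun (LinearMap.congr_fun h a) i) j

variable {ρ d T}

theorem hullRing_hom_ext {B : CompleteLocalAlg k} {f g : hullRing ρ d T ⟶ B}
    (h : ∀ s, coords ρ d (push f (hullRep ρ d T)) s = coords ρ d (push g (hullRep ρ d T)) s) :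
    f = g := by
  refine quotient_hom_ext _ _ (mvPowerSeries_hom_ext fun s => ?_)
  have h1 := h s
  rwa [coords_push, coords_push, coords_hullRep] at h1

/-- Power series homomorphisms to an Artinian ring are free choices of coordinates in `𝔪`, so the
hull ring represents framed representations in the slice. This explains why no conjugation appears.
-/
theorem exists_push_eq {B : CompleteLocalAlg k} [IsArtinianRing B] {φ : Λ →ₐ[k] Matrix ι ι B}
    (hφ : IsFramed ρ φ) (h : ∀ s, slice ρ d T (coords ρ d φ) s = 0) :
    ∃ f : hullRing ρ d T ⟶ B, push f (hullRep ρ d T) = φ := by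
  obtain ⟨f, hf, hr⟩ := exists_hom_of_isSolution (fun s => hφ.sub_mem _ _ _)
    (IsSolution.of_coords h)
  refine ⟨quotientLift _ (relations_ne_top ρ d T) f hr, AlgHom.ext fun a => ?_⟩
  have h1 : family ρ d (fun s => Hom.ringHom (quotientLift _ (relations_ne_top ρ d T) f hr)
      (hullCoords ρ d T s)) = φ.toLinearMap := by
    rw [← family_coords ρ d φ]
    congr 1
    exact funext hf
  exact (map_family ρ d _ _ a).trans (LinearMap.congr_fun h1 a)

theorem slice_hull {B : CompleteLocalAlg k} (f : hullRing ρ d T ⟶ B) (s : δ × ι × ι) :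
    slice ρ d T (coords ρ d (push f (hullRep ρ d T))) s = 0 := by
  have h := map_slice ρ d T f (hullCoords ρ d T) s
  rw [(isSolution_hullCoords ρ d T).2.2 s, map_zero] at h
  rw [h]
  congr 1
  funext t
  rw [coords_push, coords_hullRep]

/-- With `C T C = C`, the slice map `C T` is the identity on the image of `C`, the tangent
directions of the conjugation orbits. Its kernel is therefore a complement to those directions. -/
theorem slice_commutator
    (hT : commutatorMatrix ρ d * T * commutatorMatrix ρ d = commutatorMatrix ρ d)
    {B : CompleteLocalAlg k} (x : ι × ι → B) :
    slice ρ d T (((commutatorMatrix ρ d).map (algebraMap k B)).mulVec x) =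
      ((commutatorMatrix ρ d).map (algebraMap k B)).mulVec x := by
  rw [slice, Matrix.mulVec_mulVec, ← Matrix.map_mul, hT]

/-- Moving a representation towards the slice by conjugation. -/
theorem exists_conj_slice_mem
    (hT : commutatorMatrix ρ d * T * commutatorMatrix ρ d = commutatorMatrix ρ d)
    {B : CompleteLocalAlg k} {φ : Λ →ₐ[k] Matrix ι ι B} (hφ : IsFramed ρ φ) {I : Ideal B}
    (hI : I ≤ maximalIdeal B) (h : ∀ s, slice ρ d T (coords ρ d φ) s ∈ I) :
    ∃ (φ' : Λ →ₐ[k] Matrix ι ι B) (N : Matrix ι ι B), IsFramed ρ φ' ∧ (∀ i j, N i j ∈ I) ∧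
      (∀ a, φ' a * (1 + N) = (1 + N) * φ a) ∧
      ∀ s, slice ρ d T (coords ρ d φ') s ∈ maximalIdeal B * I := by
  let x := coords ρ d φ
  -- With this choice `C n = -C T x`, so to first order conjugation by `1 + N` subtracts exactly the
  -- slice component. The error lies in `𝔪 I`.
  let n : ι × ι → B := -(T.map (algebraMap k B)).mulVec (slice ρ d T x)
  let N : Matrix ι ι B := fun i j => n (i, j)
  have hN : ∀ i j, N i j ∈ I := fun i j => neg_mem (Matrix.mulVec_mem_ideal _ h (i, j))
  have hv : (1 + N).map B.residue = 1 := by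
    ext i j
    rw [Matrix.map_apply, Matrix.add_apply, map_add, (B.residue_eq_zero_iff _).2 (hI (hN i j)),
      add_zero, Matrix.one_apply, Matrix.one_apply, apply_ite B.residue, map_one, map_zero]
  obtain ⟨φ', hφ', hc⟩ := exists_conj (1 + N) hv hφ
  refine ⟨φ', N, hφ', hN, hc, fun s => ?_⟩
  have h1 := coords_sub_mem ρ d hφ hφ' N I hN hc
  have h2 : slice ρ d T (slice ρ d T x) = slice ρ d T x := by
    have h3 : slice ρ d T x = ((commutatorMatrix ρ d).map (algebraMap k B)).mulVec
        ((T.map (algebraMap k B)).mulVec x) := by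
      rw [slice, Matrix.mulVec_mulVec, ← Matrix.map_mul]
    rw [h3, slice_commutator hT]
  have h4 : ((commutatorMatrix ρ d).map (algebraMap k B)).mulVec (fun p => N p.1 p.2) =
      -slice ρ d T x := by
    change ((commutatorMatrix ρ d).map (algebraMap k B)).mulVec n = _
    rw [Matrix.mulVec_neg, Matrix.mulVec_mulVec, ← Matrix.map_mul]
    exact congrArg Neg.neg h2
  have h5 : slice ρ d T (coords ρ d φ') =
      slice ρ d T (coords ρ d φ' - coords ρ d φ -
        ((commutatorMatrix ρ d).map (algebraMap k B)).mulVec fun p => N p.1 p.2) := by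
    rw [h4, slice, slice, Matrix.mulVec_sub, Matrix.mulVec_sub, Matrix.mulVec_neg]
    change _ = _ - slice ρ d T x - -slice ρ d T (slice ρ d T x)
    rw [h2, sub_neg_eq_add, sub_add_cancel]
  rw [h5]
  exact Matrix.mulVec_mem_ideal _ h1 s

/-- Each conjugation improves the slice coordinates by one power of `𝔪`, which is nilpotent. All
conjugating matrices stay congruent to `1` modulo `I`. -/
theorem exists_conj_slice_eq_zero
    (hT : commutatorMatrix ρ d * T * commutatorMatrix ρ d = commutatorMatrix ρ d)
    {B : CompleteLocalAlg k} [IsArtinianRing B] {φ : Λ →ₐ[k] Matrix ι ι B} (hφ : IsFramed ρ φ)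
    {I : Ideal B} (hI : I ≤ maximalIdeal B) (h : ∀ s, slice ρ d T (coords ρ d φ) s ∈ I) :
    ∃ (φ' : Λ →ₐ[k] Matrix ι ι B) (v : Matrix ι ι B), IsFramed ρ φ' ∧
      (∀ i j, (v - 1) i j ∈ I) ∧ (∀ a, φ' a * v = v * φ a) ∧
      ∀ s, slice ρ d T (coords ρ d φ') s = 0 := by
  obtain ⟨n, hn⟩ := (isArtinianRing_iff_isNilpotent_maximalIdeal B).1 inferInstance
  have key : ∀ n : ℕ, ∃ (φ' : Λ →ₐ[k] Matrix ι ι B) (v : Matrix ι ι B), IsFramed ρ φ' ∧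
      (∀ i j, (v - 1) i j ∈ I) ∧ (∀ a, φ' a * v = v * φ a) ∧
      ∀ s, slice ρ d T (coords ρ d φ') s ∈ maximalIdeal B ^ n * I := by
    intro n
    induction n with
    | zero =>
      refine ⟨φ, 1, hφ, fun i j => ?_, fun a => by rw [mul_one, one_mul], fun s => ?_⟩
      · rw [sub_self]
        exact zero_mem I
      · rw [pow_zero, one_mul]
        exact h s
    | succ n ih =>
      obtain ⟨φ₁, v, h1, h2, h3, h4⟩ := ih
      have hle : maximalIdeal B ^ n * I ≤ I := Ideal.mul_le_right
      obtain ⟨φ₂, N, h5, h6, h7, h8⟩ := exists_conj_slice_mem hT h1 (hle.trans hI) h4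
      refine ⟨φ₂, (1 + N) * v, h5, fun i j => ?_, fun a => ?_, fun s => ?_⟩
      · rw [add_mul, one_mul, add_sub_right_comm, Matrix.add_apply]
        refine add_mem (h2 i j) (Ideal.sum_mem _ fun q _ => Ideal.mul_mem_right _ _ ?_)
        exact hle (h6 i q)
      · rw [← mul_assoc, h7, mul_assoc, h3, mul_assoc]
      · rw [pow_succ', mul_assoc]
        exact h8 s
  obtain ⟨φ', v, h1, h2, h3, h4⟩ := key n
  refine ⟨φ', v, h1, h2, h3, fun s => ?_⟩
  have h5 := h4 s
  rw [hn, zero_mul] at h5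
  exact h5

/-- The conjugator `u` is lifted to `B` so that the representation over `A` becomes the given point
of the slice. The lift is then moved into the slice by a matrix congruent to `1` modulo the kernel
of `p`, which does not disturb its image over `A`. -/
theorem hull_smooth
    (hT : commutatorMatrix ρ d * T * commutatorMatrix ρ d = commutatorMatrix ρ d)
    {A B : CompleteLocalAlg k} [IsArtinianRing B] (p : B ⟶ A)
    (hp : Function.Surjective (Hom.ringHom p)) (g : hullRing ρ d T ⟶ A)
    {φ : Λ →ₐ[k] Matrix ι ι B} (hφ : IsFramed ρ φ) (u : Matrix ι ι A)
    (hu : u.map A.residue = 1) (huφ : ∀ a, push g (hullRep ρ d T) a * u = u * push p φ a) :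
    ∃ h : hullRing ρ d T ⟶ B, h ≫ p = g ∧ ∃ v : Matrix ι ι B, v.map B.residue = 1 ∧
      ∀ a, push h (hullRep ρ d T) a * v = v * φ a := by
  choose q hq using hp
  let v₀ : Matrix ι ι B := u.map q
  have hv₀ : v₀.map (Hom.ringHom p) = u := by
    ext i j
    exact hq _
  have hv₀' : v₀.map B.residue = 1 := by
    rw [← hu, ← hv₀]
    ext i j
    exact (residue_ringHom p _).symm
  obtain ⟨φ₁, h1, h2⟩ := exists_conj v₀ hv₀' hφ
  have hpush : ∀ {ψ ψ' : Λ →ₐ[k] Matrix ι ι B} {w : Matrix ι ι B},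
      (∀ a, ψ' a * w = w * ψ a) → ∀ a, push p ψ' a * w.map (Hom.ringHom p) =
        w.map (Hom.ringHom p) * push p ψ a := fun {ψ ψ' w} hw a => by
    rw [push_apply, push_apply, ← Matrix.map_mul, hw, Matrix.map_mul]
  have h3 : push p φ₁ = push g (hullRep ρ d T) := AlgHom.ext fun a => by
    have h4 := hpush h2 a
    rw [hv₀, ← huφ] at h4
    exact (Matrix.isUnit_iff_isUnit_det u).2 (isUnit_det u hu) |>.mul_right_cancel h4
  have hK : RingHom.ker (Hom.ringHom p) ≤ maximalIdeal B := by
    intro r hr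
    rw [← B.residue_eq_zero_iff, ← residue_ringHom p, hr, map_zero]
  -- Over `A` the representation lies in the slice, so over `B` its slice coordinates lie in the
  -- kernel of `p`.
  obtain ⟨φ₂, v, h4, h5, h6, h7⟩ := exists_conj_slice_eq_zero hT h1 hK fun s => by
    rw [RingHom.mem_ker, map_slice]
    have h8 := slice_hull g s
    rw [← h3] at h8
    rwa [funext (coords_push ρ d p φ₁)] at h8
  obtain ⟨h, rfl⟩ := exists_push_eq h4 h7
  have hv : v.map (Hom.ringHom p) = 1 := by
    ext i j
    have h8 : Hom.ringHom p ((v - 1) i j) = 0 := h5 i j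
    rw [Matrix.sub_apply, map_sub, sub_eq_zero] at h8
    rw [Matrix.map_apply, h8, Matrix.one_apply, Matrix.one_apply, apply_ite (Hom.ringHom p),
      map_one (Hom.ringHom p), map_zero]
  -- Because `v` maps to `1` over `A`, the equation `h ≫ p = g` holds on the nose and not merely up
  -- to conjugation.
  refine ⟨h, hullRing_hom_ext fun s => ?_, v * v₀, ?_, fun a => ?_⟩
  · congr 1
    rw [← push_comp, ← h3]
    refine AlgHom.ext fun a => ?_
    have h8 := hpush h6 a
    rwa [hv, mul_one, one_mul] at h8
  · have hv' : v.map B.residue = 1 := by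
      ext i j
      rw [Matrix.map_apply, ← residue_ringHom p]
      change A.residue (v.map (Hom.ringHom p) i j) = _
      rw [hv, Matrix.one_apply, Matrix.one_apply, apply_ite A.residue, map_one, map_zero]
    rw [Matrix.map_mul, hv', hv₀', one_mul]
  · rw [← mul_assoc, h6, mul_assoc, h2, mul_assoc]

/-- When `𝔪² = 0` the first-order formula is exact, so the coordinates of two conjugate points
differ by an element of the image of the commutator matrix. The slice map fixes this image, yet it
kills the difference of two points of the slice, so the difference is zero. -/
theorem hull_tangent_injective
    (hT : commutatorMatrix ρ d * T * commutatorMatrix ρ d = commutatorMatrix ρ d)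
    {B : CompleteLocalAlg k} (hB : maximalIdeal B * maximalIdeal B = ⊥)
    (f g : hullRing ρ d T ⟶ B) (u : Matrix ι ι B) (hu : u.map B.residue = 1)
    (h : ∀ a, push g (hullRep ρ d T) a * u = u * push f (hullRep ρ d T) a) : f = g := by
  let N := u - 1
  have hN : ∀ i j, N i j ∈ maximalIdeal B := fun i j => by
    change (u - 1) i j ∈ _
    rw [← B.residue_eq_zero_iff, Matrix.sub_apply, map_sub, sub_eq_zero]
    refine (congrFun (congrFun hu i) j).trans ?_
    rw [Matrix.one_apply, Matrix.one_apply, apply_ite B.residue, map_one, map_zero]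
  have hu' : u = 1 + N := (add_sub_cancel 1 u).symm
  rw [hu'] at h
  have h1 := coords_sub_mem ρ d ((isFramed_hullRep ρ d T).push f)
    ((isFramed_hullRep ρ d T).push g) N _ hN h
  rw [hB] at h1
  have h2 : coords ρ d (push g (hullRep ρ d T)) - coords ρ d (push f (hullRep ρ d T)) =
      ((commutatorMatrix ρ d).map (algebraMap k B)).mulVec fun p => N p.1 p.2 :=
    funext fun s => sub_eq_zero.1 (h1 s)
  have h3 := slice_commutator hT fun p => N p.1 p.2
  have h4 : slice ρ d T (coords ρ d (push g (hullRep ρ d T)) -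
      coords ρ d (push f (hullRep ρ d T))) = 0 := by
    rw [slice, Matrix.mulVec_sub]
    funext s
    exact (congrArg₂ (· - ·) (slice_hull g s) (slice_hull f s)).trans (sub_zero 0)
  rw [← h2, h4] at h3
  exact hullRing_hom_ext fun s => (sub_eq_zero.1 (congrFun h3.symm s)).symm

end MatrixRep

/-! ### Lifts of modules and matrix representations -/

namespace MatrixRep

open IsLocalRing CompleteLocalAlg

variable {k : Type u} [Field k] {Λ : Type u} [Ring Λ] [Algebra k Λ] {ι : Type}
  [Fintype ι] [DecidableEq ι]

/-- The space of a matrix representation. -/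
def Space {B : CompleteLocalAlg k} (_ : Λ →ₐ[k] Matrix ι ι B) : Type u := ι → B

section Space

variable {B : CompleteLocalAlg k} (φ : Λ →ₐ[k] Matrix ι ι B)

instance : AddCommGroup (Space φ) := inferInstanceAs (AddCommGroup (ι → B))

instance : Module B (Space φ) := inferInstanceAs (Module B (ι → B))

instance : Module.Free B (Space φ) := inferInstanceAs (Module.Free B (ι → B))

instance : Module.Finite B (Space φ) := inferInstanceAs (Module.Finite B (ι → B))

instance : Module Λ (Space φ) where
  smul a x := (φ a).mulVec x
  one_smul x := by
    change (φ 1).mulVec x = x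
    rw [map_one]
    exact Matrix.one_mulVec (v := (x : ι → B))
  mul_smul a b x := by
    change (φ (a * b)).mulVec x = (φ a).mulVec ((φ b).mulVec x)
    rw [map_mul]
    exact (Matrix.mulVec_mulVec x (φ a) (φ b)).symm
  smul_zero a := Matrix.mulVec_zero (φ a)
  smul_add a := Matrix.mulVec_add (φ a)
  add_smul a b x := by
    change (φ (a + b)).mulVec x = (φ a).mulVec x + (φ b).mulVec x
    rw [map_add]
    exact Matrix.add_mulVec (φ a) (φ b) x
  zero_smul x := by
    change (φ 0).mulVec x = 0
    rw [map_zero]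
    exact Matrix.zero_mulVec (v := (x : ι → B))

theorem smul_def (a : Λ) (x : Space φ) : a • x = (φ a).mulVec x := rfl

instance : SMulCommClass Λ B (Space φ) where
  smul_comm a r x := Matrix.mulVec_smul (φ a) r x

theorem algebraMap_smul_space (c : k) (x : Space φ) :
    algebraMap k Λ c • x = algebraMap k B c • x := by
  rw [smul_def, AlgHom.commutes, Matrix.algebraMap_eq_diagonal]
  exact funext fun i => Matrix.mulVec_diagonal _ (x : ι → B) i

end Space

variable {V : Type u} [AddCommGroup V] [Module k V] [Module Λ V] [IsScalarTower k Λ V]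
  (b : Module.Basis ι k V)

variable (Λ) in
/-- The matrix representation of a module with a basis. -/
def ofBasis : Λ →ₐ[k] Matrix ι ι k :=
  (LinearMap.toMatrixAlgEquiv b).toAlgHom.comp (Algebra.lsmul k k V)

theorem ofBasis_mulVec (a : Λ) (x : ι → k) :
    b.equivFun.symm ((ofBasis Λ b a).mulVec x) = a • b.equivFun.symm x := by
  have h := LinearMap.toMatrix_mulVec_repr b b (Algebra.lsmul k k V a) (b.equivFun.symm x)
  rw [LinearEquiv.symm_apply_eq]
  refine Eq.trans ?_ (h.trans rfl)
  congr 1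
  exact (b.equivFun.apply_symm_apply x).symm

variable {B : CompleteLocalAlg k}

/-- The reduction map of the space of a framed representation. -/
def spaceRed {φ : Λ →ₐ[k] Matrix ι ι B} (hφ : IsFramed (ofBasis Λ b) φ) : Space φ →ₗ[Λ] V where
  toFun x := b.equivFun.symm fun i => B.residue (x i)
  map_add' x y := by
    rw [← map_add]
    congr 1
    exact funext fun i => map_add B.residue (x i) (y i)
  map_smul' a x := by
    rw [RingHom.id_apply, ← ofBasis_mulVec]
    congr 1
    have h1 : (φ a).map B.residue = ofBasis Λ b a := Matrix.ext (hφ a)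
    rw [← h1]
    exact funext fun i => RingHom.map_mulVec B.residue (φ a) x i

theorem spaceRed_apply {φ : Λ →ₐ[k] Matrix ι ι B} (hφ : IsFramed (ofBasis Λ b) φ)
    (x : Space φ) : spaceRed b hφ x = b.equivFun.symm fun i => B.residue (x i) := rfl

/-- The lift given by a framed representation. -/
abbrev toLift {φ : Λ →ₐ[k] Matrix ι ι B} (hφ : IsFramed (ofBasis Λ b) φ) : ModuleLift Λ V B :=
  ModuleLift.ofRed (Space φ) (algebraMap_smul_space φ) (spaceRed b hφ)
    (fun r x => by
      rw [spaceRed_apply, spaceRed_apply, algebraMap_smul, ← map_smul]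
      congr 1
      exact funext fun i => map_mul B.residue r (x i))
    (fun v => ⟨fun i => algebraMap k B (b.equivFun v i), by
      refine Eq.trans ?_ (b.equivFun.symm_apply_apply v)
      exact congrArg b.equivFun.symm (funext fun i => B.residue_algebraMap _)⟩)
    (fun x hx => by
      rw [spaceRed_apply, LinearEquiv.map_eq_zero_iff] at hx
      have h1 : x = ∑ i, (x i : B) • (Pi.single i (1 : B) : ι → B) :=
        pi_eq_sum_univ' x
      rw [h1]
      refine Submodule.sum_mem _ fun i _ => Submodule.smul_mem_smul ?_ Submodule.mem_top
      exact (B.residue_eq_zero_iff _).1 (congrFun hx i))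

theorem toLift_red {φ : Λ →ₐ[k] Matrix ι ι B} (hφ : IsFramed (ofBasis Λ b) φ) (x : Space φ) :
    (toLift b hφ).red x = b.equivFun.symm fun i => B.residue (x i) :=
  ModuleLift.ofRed_red _ _ _ _ _ _ x

/-- With the converse and `exists_toLift` below, deformations of `V` are framed representations
modulo conjugation by matrices reducing to `1`. -/
theorem toLift_isomorphic_of_conj {φ φ' : Λ →ₐ[k] Matrix ι ι B}
    (hφ : IsFramed (ofBasis Λ b) φ) (hφ' : IsFramed (ofBasis Λ b) φ') (v : Matrix ι ι B)
    (hv : v.map B.residue = 1) (h : ∀ a, φ' a * v = v * φ a) :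
    ModuleLift.Isomorphic (toLift b hφ) (toLift b hφ') := by
  let f : Space φ →ₗ[B] Space φ' := Matrix.mulVecLin v
  refine ModuleLift.Isomorphic.of_hom f (fun a x => ?_) fun x => ?_
  · refine (Matrix.mulVec_mulVec (x : ι → B) v (φ a)).trans ?_
    rw [← h]
    exact (Matrix.mulVec_mulVec (x : ι → B) (φ' a) v).symm
  · rw [toLift_red, toLift_red]
    congr 1
    have h1 := RingHom.map_mulVec B.residue v x
    funext i
    refine (h1 i).trans ?_
    rw [hv, Matrix.one_mulVec]
    rfl

theorem exists_conj_of_toLift_isomorphic {φ φ' : Λ →ₐ[k] Matrix ι ι B}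
    (hφ : IsFramed (ofBasis Λ b) φ) (hφ' : IsFramed (ofBasis Λ b) φ')
    (h : ModuleLift.Isomorphic (toLift b hφ) (toLift b hφ')) :
    ∃ v : Matrix ι ι B, v.map B.residue = 1 ∧ ∀ a, φ' a * v = v * φ a := by
  obtain ⟨f, hf, hr⟩ := h.exists_hom
  let f' : (ι → B) →ₗ[B] (ι → B) := f
  have h1 : ∀ x, (LinearMap.toMatrix' f').mulVec x = f' x := fun x =>
    LinearMap.toMatrix'_mulVec f' x
  refine ⟨LinearMap.toMatrix' f', ?_, fun a => ?_⟩
  · ext i j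
    have h2 := hr (Pi.single j (1 : B) : ι → B)
    have h3 := b.equivFun.symm.injective (((toLift_red b hφ' _).symm.trans h2).trans
      (toLift_red b hφ _))
    rw [Matrix.map_apply, LinearMap.toMatrix'_apply]
    refine (congrFun h3 i).trans ?_
    rw [Pi.single_apply, Matrix.one_apply, apply_ite B.residue, map_one, map_zero]
  · refine Matrix.ext_of_mulVec_single fun j => ?_
    rw [← Matrix.mulVec_mulVec, ← Matrix.mulVec_mulVec, h1, h1]
    exact (hf a _).symm

theorem toLift_baseChange {A : CompleteLocalAlg k} (α : B ⟶ A) {φ : Λ →ₐ[k] Matrix ι ι B}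
    (hφ : IsFramed (ofBasis Λ b) φ) :
    ModuleLift.Isomorphic ((toLift b hφ).baseChange α) (toLift b (hφ.push α)) := by
  let g : Space φ →+ Space (push α φ) :=
    { toFun := fun x i => Hom.ringHom α (x i)
      map_zero' := funext fun i => map_zero _
      map_add' := fun x y => funext fun i => map_add _ (x i) (y i) }
  have hg : ∀ (r : B) (x : Space φ), g (r • x) = Hom.ringHom α r • g x := fun r x =>
    funext fun i => map_mul (Hom.ringHom α) r (x i)
  let f := BaseChange.lift (Hom.ringHom α) g hg
  have hft : ∀ s x, f (BaseChange.tmul _ s x) = s • g x := BaseChange.lift_tmul _ g hg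
  refine ModuleLift.Isomorphic.of_hom f (fun a z => ?_) fun z => ?_
  · induction z using BaseChange.induction_on with
    | zero => rw [smul_zero, map_zero, smul_zero]
    | tmul s x =>
      rw [BaseChange.action_tmul, hft, hft, smul_comm]
      congr 1
      exact funext fun i => RingHom.map_mulVec (Hom.ringHom α) (φ a) x i
    | add y z hy hz => rw [smul_add, map_add, hy, hz, map_add, smul_add]
  · induction z using BaseChange.induction_on with
    | zero => rw [map_zero, map_zero, map_zero]
    | tmul s x =>
      rw [hft, ModuleLift.baseChange_red_tmul, ModuleLift.red_smul, toLift_red, toLift_red]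
      congr 2
      exact funext fun i => residue_ringHom α (x i)
    | add y z hy hz => rw [map_add, map_add, hy, hz, map_add]

/-- Every lift comes from a framed representation. -/
theorem exists_toLift (L : ModuleLift Λ V B) :
    ∃ (φ : Λ →ₐ[k] Matrix ι ι B) (hφ : IsFramed (ofBasis Λ b) φ),
      ModuleLift.Isomorphic (toLift b hφ) L := by
  -- The free module `B ^ ι` is regarded as a lift of `V` for the algebra `k` alone. This makes the
  -- comparison with `L` bijective before any `Λ`-action on `B ^ ι` is available.
  have hk : IsFramed (ofBasis k b) (Algebra.ofId k (Matrix ι ι B)) := fun c i j => by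
    change B.residue (algebraMap k (Matrix ι ι B) c i j) = _
    rw [show ofBasis k b c = algebraMap k (Matrix ι ι k) c from (ofBasis k b).commutes c,
      Matrix.algebraMap_matrix_apply, Matrix.algebraMap_matrix_apply, apply_ite B.residue,
      residue_algebraMap, map_zero]
    rfl
  choose l hl using fun i => L.red_surjective (b i)
  let f : (ι → B) →ₗ[B] L.carrier := Fintype.linearCombination B l
  have hfr : ∀ x, L.red (f x) = b.equivFun.symm fun i => B.residue (x i) := fun x => by
    rw [Fintype.linearCombination_apply, map_sum, Module.Basis.equivFun_symm_apply]
    exact Finset.sum_congr rfl fun i _ => by rw [L.red_smul, hl, algebraMap_smul]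
  have hf : Function.Bijective f := ModuleLift.bijective_of_red (toLift b hk) L f fun x =>
    (hfr x).trans (toLift_red b hk x).symm
  let l' : Module.Basis ι B L.carrier := Module.Basis.ofEquivFun (LinearEquiv.ofBijective f hf).symm
  have hl' : ∀ x, l'.equivFun.symm x = f x := fun x => by
    rw [Module.Basis.equivFun_ofEquivFun]
    rfl
  let ψ : Λ →+* Matrix ι ι B :=
    (LinearMap.toMatrixAlgEquiv l').toRingEquiv.toRingHom.comp (Module.toModuleEnd B L.carrier)
  let φ : Λ →ₐ[k] Matrix ι ι B :=
    { ψ with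
      commutes' := fun c => by
        have h1 : Module.toModuleEnd B L.carrier (algebraMap k Λ c) =
            algebraMap B (Module.End B L.carrier) (algebraMap k B c) :=
          LinearMap.ext fun x => L.algebraMap_smul c x
        change LinearMap.toMatrixAlgEquiv l' (Module.toModuleEnd B L.carrier (algebraMap k Λ c)) = _
        rw [h1, AlgEquiv.commutes, ← IsScalarTower.algebraMap_apply] }
  have hφ : ∀ a x, f ((φ a).mulVec x) = a • f x := fun a x => by
    have h := LinearMap.toMatrix_mulVec_repr l' l' (Module.toModuleEnd B L.carrier a) (f x)
    rw [← hl', LinearEquiv.symm_apply_eq]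
    refine Eq.trans ?_ (h.trans rfl)
    congr 1
    rw [← hl']
    exact (l'.equivFun.apply_symm_apply x).symm
  have hframed : IsFramed (ofBasis Λ b) φ := fun a i j => by
    have h1 := hfr ((φ a).mulVec (Pi.single j 1))
    rw [hφ, map_smul, hfr, ← ofBasis_mulVec, b.equivFun.symm.injective.eq_iff] at h1
    have h2 := congrFun h1 i
    rw [Matrix.mulVec_single_one] at h2
    refine h2.symm.trans ?_
    have h3 : (fun i => B.residue ((Pi.single j 1 : ι → B) i)) = Pi.single j 1 := by
      funext i
      rw [Pi.single_apply, Pi.single_apply, apply_ite B.residue, map_one, map_zero]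
    rw [h3, Matrix.mulVec_single_one]
    rfl
  exact ⟨φ, hframed, ModuleLift.Isomorphic.of_hom (L := toLift b hframed) f hφ fun x =>
    (hfr x).trans (toLift_red b hframed x).symm⟩

end MatrixRep

open CompleteLocalAlg IsLocalRing in
/-- Every finitely generated module over a finite dimensional algebra has a versal deformation
ring. -/
theorem exists_isVersalDeformationRing {k : Type u} [Field k] (Λ : Type u) [Ring Λ] [Algebra k Λ]
    [Module.Finite k Λ] (V : Type u) [AddCommGroup V] [Module Λ V] [Module.Finite Λ V] :
    ∃ R : CompleteLocalAlg k, IsVersalDeformationRing Λ V R := by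
  letI : Module k V := Module.compHom V (algebraMap k Λ)
  haveI : IsScalarTower k Λ V := IsScalarTower.of_algebraMap_smul fun _ _ => rfl
  haveI : Module.Finite k V := Module.Finite.trans Λ V
  let d := Module.finBasis k Λ
  let b := Module.finBasis k V
  let ρ := MatrixRep.ofBasis Λ b
  obtain ⟨T, hT⟩ := (MatrixRep.commutatorMatrix ρ d).exists_mul_mul_eq_self
  let R := MatrixRep.hullRing ρ d T
  have hR : MatrixRep.IsFramed ρ (MatrixRep.hullRep ρ d T) := MatrixRep.isFramed_hullRep ρ d T
  have hmap : ∀ {A : CompleteLocalAlg k} (f : R ⟶ A),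
      (deformationFunctor Λ V).map f (Quotient.mk _ (MatrixRep.toLift b hR)) =
        (Quotient.mk _ (MatrixRep.toLift b (hR.push f)) : Quotient (ModuleLift.setoid Λ V A)) :=
    fun f => Quotient.sound (MatrixRep.toLift_baseChange b f hR)
  -- Smoothness is stated separately because surjectivity on tangent spaces is deduced from it
  -- below.
  have hsm : ∀ (A B : CompleteLocalAlg k) [IsArtinianRing B] (p : B ⟶ A),
      Function.Surjective (Hom.ringHom p) → ∀ (g : R ⟶ A) (η : (deformationFunctor Λ V).obj B),
      (deformationFunctor Λ V).map p η =
        (deformationFunctor Λ V).map g (Quotient.mk _ (MatrixRep.toLift b hR)) →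
      ∃ h : R ⟶ B, h ≫ p = g ∧
        (deformationFunctor Λ V).map h (Quotient.mk _ (MatrixRep.toLift b hR)) = η := by
    intro A B _ p hp g η hη
    obtain ⟨L, rfl⟩ := Quotient.exists_rep η
    obtain ⟨φ, hφ, hL⟩ := MatrixRep.exists_toLift b L
    rw [hmap] at hη
    have h1 : ModuleLift.Isomorphic (L.baseChange p) (MatrixRep.toLift b (hR.push g)) :=
      Quotient.exact hη
    obtain ⟨u, hu, huφ⟩ := MatrixRep.exists_conj_of_toLift_isomorphic b (hφ.push p) (hR.push g)
      (((MatrixRep.toLift_baseChange b p hφ).symm.trans (hL.baseChange p)).trans h1)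
    obtain ⟨h, hh, v, hv, hvφ⟩ := MatrixRep.hull_smooth hT p hp g hφ u hu huφ
    refine ⟨h, hh, (hmap h).trans (Quotient.sound ?_)⟩
    exact (MatrixRep.toLift_isomorphic_of_conj b hφ (hR.push h) v hv hvφ).symm.trans hL
  refine ⟨R, Quotient.mk _ (MatrixRep.toLift b hR), fun A B _ _ p hp g η hη =>
    hsm A B p hp g η hη, fun f g hfg => ?_, fun η => ?_⟩
  · have h1 : ModuleLift.Isomorphic (MatrixRep.toLift b (hR.push f))
        (MatrixRep.toLift b (hR.push g)) :=
      Quotient.exact ((hmap f).symm.trans (hfg.trans (hmap g)))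
    obtain ⟨u, hu, huφ⟩ := MatrixRep.exists_conj_of_toLift_isomorphic b _ _ h1
    refine MatrixRep.hull_tangent_injective hT ?_ f g u hu huφ
    rw [← pow_two]
    exact dualNumber_maximalIdeal_sq
  -- Over the residue field all classes agree, so smoothness along `k[ε] → k` realizes every class
  -- over `k[ε]`.
  · have hbot : maximalIdeal ((dualNumber k).powQuotient 0) = ⊥ := by
      rw [← (dualNumber k).maximalIdeal_powQuotient_pow 0, zero_add, pow_one]
    haveI := deformationFunctor_subsingleton Λ V _ hbot
    haveI : IsArtinianRing (dualNumber k) :=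
      (isArtinianRing_iff_isNilpotent_maximalIdeal _).2 ⟨2, dualNumber_maximalIdeal_sq⟩
    obtain ⟨h, -, hh⟩ := hsm _ _ ((dualNumber k).powMk 0)
      (quotientMk_surjective _ _ _) (Hom.ofAlgHom ((Algebra.ofId k _).comp R.residueAlgHom)) η
      (Subsingleton.elim _ _)
    exact ⟨h, hh⟩

/-! ### Assembly of the main theorem -/

theorem mainTheorem3 {k Λ Γ : Type u} [Field k]
    [Ring Λ] [Algebra k Λ] [Module.Finite k Λ] [Module.Injective Λ Λ]
    [Ring Γ] [Algebra k Γ] [Module.Finite k Γ] [Module.Injective Γ Γ]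
    (X : Type u) [AddCommGroup X] [Module k X] [Module Γ X] [Module Λᵐᵒᵖ X]
    [SMulCommClass Γ Λᵐᵒᵖ X] [IsScalarTower k Γ X] [IsScalarTower k Λᵐᵒᵖ X] [Module.Finite k X]
    (Y : Type u) [AddCommGroup Y] [Module k Y] [Module Λ Y] [Module Γᵐᵒᵖ Y]
    [SMulCommClass Λ Γᵐᵒᵖ Y] [IsScalarTower k Λ Y] [IsScalarTower k Γᵐᵒᵖ Y] [Module.Finite k Y]
    (hXY : InducesStableEquivalenceOfMoritaType k Λ Γ X Y)
    (V : Type u) [AddCommGroup V] [Module Λ V] [Module.Finite Λ V] :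
    Nonempty (deformationFunctor (k := k) Λ V ≅
      deformationFunctor (k := k) Γ (BalancedTensor Λ X V)) ∧
    (∃ R : CompleteLocalAlg k, IsVersalDeformationRing Λ V R) ∧
    (∃ R' : CompleteLocalAlg k, IsVersalDeformationRing Γ (BalancedTensor Λ X V) R') ∧
    ∀ R R' : CompleteLocalAlg k, IsVersalDeformationRing Λ V R →
      IsVersalDeformationRing Γ (BalancedTensor Λ X V) R' →
      Nonempty (R ≅ R') ∧
      (IsUniversalDeformationRing Λ V R ↔
        IsUniversalDeformationRing Γ (BalancedTensor Λ X V) R') := by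
  have hX : ∀ (c : k) (x : X), algebraMap k Γ c • x = op (algebraMap k Λ c) • x := fun c x => by
    rw [algebraMap_smul, ← MulOpposite.algebraMap_apply, algebraMap_smul]
  have hY : ∀ (c : k) (y : Y), algebraMap k Λ c • y = op (algebraMap k Γ c) • y := fun c y => by
    rw [algebraMap_smul, ← MulOpposite.algebraMap_apply, algebraMap_smul]
  haveI := hXY.projective_right_X
  haveI := hXY.projective_right_Y
  haveI : Module.Finite Λᵐᵒᵖ X := Module.Finite.of_restrictScalars_finite k Λᵐᵒᵖ X
  haveI : Module.Finite Γᵐᵒᵖ Y := Module.Finite.of_restrictScalars_finite k Γᵐᵒᵖ Y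
  haveI : Module.Finite Γ X := Module.Finite.of_restrictScalars_finite k Γ X
  haveI : Module.Finite Λ Y := Module.Finite.of_restrictScalars_finite k Λ Y
  letI : Module k V := Module.compHom V (algebraMap k Λ)
  haveI : IsScalarTower k Λ V := IsScalarTower.of_algebraMap_smul fun _ _ => rfl
  haveI : Module.Finite k V := Module.Finite.trans Λ V
  obtain ⟨D, hD⟩ := hXY.tensor_YX.exists_splitting
  obtain ⟨D', -⟩ := hXY.tensor_XY.exists_splitting
  obtain ⟨m, α, w, hα⟩ := hD V
  have hbij : ∀ R, Function.Bijective (tensorDeformation (k := k) V X hX R) := fun R => by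
    refine ⟨fun ξ ξ' h => ?_, fun ξ => ?_⟩
    · obtain ⟨L, rfl⟩ := Quotient.exists_rep ξ
      obtain ⟨L', rfl⟩ := Quotient.exists_rep ξ'
      have h1 : ModuleLift.Isomorphic (L.tensor X hX) (L'.tensor X hX) := Quotient.exact h
      exact Quotient.sound (ModuleLift.Isomorphic.of_tensor_tensor X hX Y hY D (h1.tensor Y hY))
    · obtain ⟨L', rfl⟩ := Quotient.exists_rep ξ
      -- This yields `Y ⊗ X ⊗ L ≅ Y ⊗ L'` only. The factor `Y` is cancelled by tensoring with `X`
      -- and using the splitting `D'` of `Γ` off `X ⊗ Y`.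
      obtain ⟨L, hL⟩ := ModuleLift.exists_isomorphic_tensor_tensor hX hY D α w hα
        (L'.tensor Y hY)
      exact ⟨Quotient.mk _ L, Quotient.sound
        (ModuleLift.Isomorphic.of_tensor_tensor Y hY X hX D' (hL.tensor X hX))⟩
  obtain ⟨e⟩ := nonempty_iso_of_bijective V X hX hbij
  obtain ⟨R₀, ξ₀, h₀⟩ := exists_isVersalDeformationRing (k := k) Λ V
  refine ⟨⟨e⟩, ⟨R₀, ξ₀, h₀⟩, ⟨R₀, _, h₀.of_iso e⟩, ?_⟩
  rintro R R' ⟨ξ, h⟩ ⟨ξ', h'⟩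
  -- The hull for `V` becomes a hull for `X ⊗ V` along `e`, so uniqueness of hulls compares the two
  -- rings.
  obtain ⟨i⟩ := IsHull.nonempty_iso
    (deformationFunctor_subsingleton Γ (BalancedTensor Λ X V)) (h.of_iso e) h'
  exact ⟨⟨i⟩, exists_bijective_map_of_iso e i, exists_bijective_map_of_iso e.symm i.symm⟩

end
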